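/- Let $\mathcal C,\mathcal D$ be multifusion categories over $\mathbb C$ (finite semisimple $\mathbb C$-linear rigid monoidal categories; in particular, unitary multifusion categories) and let $\mathcal M={}_{\mathcal C}\mathcal M_{\mathcal D}$ be a finite semisimple $\mathbb C$-linear $\mathcal C|\mathcal D$-bimodule category with bilinear actions. Write $\operatorname{Irr}$ for (representatives of) the isomorphism classes of simple objects, and let $\operatorname{Irr}_0\subseteq\operatorname{Irr}$ be the simple direct summands $\mathbf 1_i$ of the tensor unit. *The tube algebra.* $\mathbf{Tube}({}_{\mathcal C}\mathcal M_{\mathcal D})$ is the direct sum, over $a\in\operatorname{Irr}(\mathcal C)$, $b\in\operatorname{Irr}(\mathcal D)$, $c,d,e,f,g,h\in\operatorname{Irr}(\mathcal M)$, of $$\operatorname{Hom}(c,d\otimes b)\otimes\operatorname{Hom}(d,a\otimes e)\otimes\operatorname{Hom}(g\otimes b,h)\otimes\operatorname{Hom}(a\otimes f,g).$$ The pure tensor $[a;b]^{f,g,h;\zeta,\gamma}_{c,d,e;\mu,\nu}$ of $\mu:c\to d\otimes b$, $\nu:d\to a\otimes e$, $\gamma:g\otimes b\to h$, $\zeta:a\otimes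 f\to g$ is drawn as a diagram with a left arc $a$ and, around it, a right arc $b$, outer edges $c$ (below) and $h$ (above), and inner edges $e$, $f$. Diagrams with arbitrary objects on the arcs, and arbitrary morphisms $c\to(X\otimes e)\otimes Y$, $(X\otimes f)\otimes Y\to h$, are evaluated in this space by inserting $\sum_\alpha p_\alpha\,\iota_\alpha$-resolutions of the identities of $X$, $Y$, and then of $a\otimes e$, $a\otimes f$, into simple objects (dual bases on the lower and the upper strand). The product draws the first diagram around the second (associators of the actions rebracket the arcs into $a\otimes a'$ and $b'\otimes b$), and vanishes unless the inner edges of the first are the outer edges of the second. The unit is the sum over $c,h$ of the pairs of strands $c$, $h$ with both arcs labelled by the tensor units. The coproduct is $$\Delta\,[a;b]^{f,g,h;\zeta,\gamma}_{c,d,e;\mu,\nu}=\sum_{i,j,k,\rho,\sigma}[a;b]^{f,g,h;\zeta,\gamma}_{k,j,i;\rho,\sigma}\otimes[a;b]^{i,j,k;\sigma^*,\rho^*}_{c,d,e;\mu,\nu},$$ with $\rho,\rho^*$ and $\sigma,\sigma^*$ running over dual bases of $\operatorname{Hom}(k,j\otimes b)$, $\operatorname{Hom}(j\otimes b,k)$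 and of $\operatorname{Hom}(j,a\otimes i)$, $\operatorname{Hom}(a\otimes i,j)$; the counit is $\delta_{c,h}\delta_{d,g}\delta_{e,f}$ times the product of the scalars $\gamma\circ\mu\in\operatorname{End}(c)$ and $\zeta\circ\nu\in\operatorname{End}(d)$. *The boundary subalgebras.* $\mathbf R(\mathcal M_{\mathcal D})$ and $\mathbf L({}_{\mathcal C}\mathcal M)$ are the spans of the diagrams with $a\in\operatorname{Irr}_0(\mathcal C)$ (dotted left arc), respectively $b\in\operatorname{Irr}_0(\mathcal D)$ (dotted right arc), with the same operations. *The crossed product.* $\mathbf R(\mathcal M_{\mathcal D})\Join\mathbf L({}_{\mathcal C}\mathcal M)$ is spanned by the elements $r\Join l$, for diagrams $r\in\mathbf R(\mathcal M_{\mathcal D})$ and $l\in\mathbf L({}_{\mathcal C}\mathcal M)$ such that the inner edges $(d,g)$ of $r$ are the outer edges of $l$; that is, it is the direct sum over all edge labels of the tensor products of the corresponding summands of $\mathbf R$ and $\mathbf L$, and $r\Join l:=0$ for diagrams whose edges do not match. Its product is $(r\Join l)(r'\Join l')=\sum(r\,r'')\Join(l''\,l')$, where $\sum r''\Join l''$ arises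 from the diagram in which $l$ is drawn around $r'$, by removing the dotted arcs, moving the left arc inside the right arc with the associator $a\otimes(m\otimes b)\cong(a\otimes m)\otimes b$ of $\mathcal M$, and decomposing $a\otimes m$ on each strand into simple objects. Its unit is $1\Join1$, its coproduct is $\Delta(r\Join l)=\Delta(r)\Join\Delta(l)$ and its counit is $\varepsilon(r\Join l)=\varepsilon(r)\varepsilon(l)$ for diagrams with matching edges. **Proposition.** $\mathbf R(\mathcal M_{\mathcal D})$ and $\mathbf L({}_{\mathcal C}\mathcal M)$ are unital subalgebras of $\mathbf{Tube}({}_{\mathcal C}\mathcal M_{\mathcal D})$ to which the coproduct and the counit restrict; the crossed product is an associative unital algebra; and the gluing map $$\Phi:\mathbf R(\mathcal M_{\mathcal D})\Join\mathbf L({}_{\mathcal C}\mathcal M)\to\mathbf{Tube}({}_{\mathcal C}\mathcal M_{\mathcal D}),\qquad[\mathbf 1;b]^{g,g,h;\gamma}_{c,d,d;\mu}\Join[a;\mathbf 1]^{f,g',g';\zeta}_{d',d',e;\nu}\mapsto\delta_{d,d'}\delta_{g,g'}\,[a;b]^{f,g,h;\zeta,\gamma}_{c,d,e;\mu,\nu},$$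 is a linear bijection that preserves product, unit, coproduct and counit. Moreover $\Phi(r\Join l)=r\cdot l$, the product in $\mathbf{Tube}({}_{\mathcal C}\mathcal M_{\mathcal D})$, for all $r\in\mathbf R(\mathcal M_{\mathcal D})$, $l\in\mathbf L({}_{\mathcal C}\mathcal M)$. -/

import Mathlib

open CategoryTheory MonoidalCategory TensorProduct
open scoped MonoidalLeftAction MonoidalRightAction

namespace DomainWall

noncomputable section

/-! ### Finite semisimple categories, multifusion categories, bimodule categories -/

section Semisimple

variable (C : Type*) [Category* C] [Preadditive C]

/-- Isomorphism of simple objects. -/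
instance simpleSetoid : Setoid {X : C // Simple X} where
  r X Y := Nonempty (X.1 ≅ Y.1)
  iseqv :=
    { refl := fun X => ⟨Iso.refl X.1⟩
      symm := fun ⟨i⟩ => ⟨i.symm⟩
      trans := fun ⟨i⟩ ⟨j⟩ => ⟨i ≪≫ j⟩ }

/-- `Irr C`: the set of isomorphism classes of simple objects of `C`. -/
def Irr : Type _ := Quotient (simpleSetoid C)

instance : DecidableEq (Irr C) := Classical.decEq _

variable {C}

/-- A chosen simple object in the isomorphism class `a`. -/
def Irr.rep (a : Irr C) : C := (Quotient.out a).1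

/-- A decomposition of `X` as a finite direct sum of the chosen simple objects. The families
`incl` and `proj` restrict, for every simple object, to dual bases of the morphism spaces
from and to that simple object. -/
structure SimpleDecomp (X : C) where
  n : ℕ
  s : Fin n → Irr C
  incl : ∀ k, (s k).rep ⟶ X
  proj : ∀ k, X ⟶ (s k).rep
  incl_proj_self : ∀ k, incl k ≫ proj k = 𝟙 (s k).rep
  incl_proj_ne : ∀ k l, k ≠ l → incl k ≫ proj l = 0
  sum_proj_incl : ∑ k, proj k ≫ incl k = 𝟙 X

variable (C) in
/-- Finite semisimple `ℂ`-linear categories: finite-dimensional morphism spaces, finitely many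
simple objects up to isomorphism, and every object is a finite direct sum of simple objects. -/
class IsFiniteSemisimple [Linear ℂ C] : Prop where
  finiteDimensional_hom : ∀ X Y : C, FiniteDimensional ℂ (X ⟶ Y)
  finite_irr : Finite (Irr C)
  exists_decomp : ∀ X : C, Nonempty (SimpleDecomp X)

variable [Linear ℂ C] [IsFiniteSemisimple C]

instance : Fintype (Irr C) :=
  haveI := IsFiniteSemisimple.finite_irr (C := C)
  Fintype.ofFinite _

/-- A chosen decomposition into simple objects. -/
def dec (X : C) : SimpleDecomp X := (IsFiniteSemisimple.exists_decomp X).some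

/-- The scalar of an endomorphism of a simple object `X`: as `End X` is one-dimensional, `f` is
the multiple of the identity by the trace of `g ↦ f ≫ g`. -/
def endScalar (X : C) : (X ⟶ X) →ₗ[ℂ] ℂ where
  toFun f := LinearMap.trace ℂ (X ⟶ X) (Linear.leftComp ℂ X f)
  map_add' f g := by
    rw [← map_add]; congr 1; ext x; simp
  map_smul' r f := by
    rw [RingHom.id_apply, ← map_smul]; congr 1; ext x; simp

variable (C) in
/-- All labels. -/
abbrev allLabels : Finset (Irr C) := Finset.univ

variable (C) in
/-- The simple direct summands `𝟙ᵢ` of the tensor unit; these label the dotted arcs. -/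
def unitLabels [MonoidalCategory C] : Finset (Irr C) :=
  open scoped Classical in
  Finset.univ.filter fun i =>
    ∃ (x : i.rep ⟶ 𝟙_ C) (y : 𝟙_ C ⟶ i.rep), x ≫ y = 𝟙 i.rep

section
variable [MonoidalCategory C]

lemma unitLabels_spec (i : unitLabels C) :
    ∃ (x : i.1.rep ⟶ 𝟙_ C) (y : 𝟙_ C ⟶ i.1.rep), x ≫ y = 𝟙 i.1.rep := by
  classical
  have h := i.2
  simp only [unitLabels, Finset.mem_filter] at h
  exact h.2

/-- The inclusion `𝟙ᵢ ⟶ 𝟙` of a simple summand of the tensor unit. -/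
def unitIncl (i : unitLabels C) : i.1.rep ⟶ 𝟙_ C := (unitLabels_spec i).choose

/-- The projection `𝟙 ⟶ 𝟙ᵢ` onto a simple summand of the tensor unit, split by `unitIncl`. -/
def unitProj (i : unitLabels C) : 𝟙_ C ⟶ i.1.rep := (unitLabels_spec i).choose_spec.choose

end

end Semisimple

/-- A left action on a `ℂ`-linear category that is `ℂ`-bilinear on morphisms. -/
class LinearLeftAction (C M : Type*) [Category* C] [Category* M] [Preadditive C] [Linear ℂ C]
    [Preadditive M] [Linear ℂ M] [MonoidalCategory C] [MonoidalLeftAction C M] : Prop where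
  add_actionHomLeft : ∀ {c c' : C} (f g : c ⟶ c') (m : M), (f + g) ⊵ₗ m = f ⊵ₗ m + g ⊵ₗ m
  smul_actionHomLeft : ∀ {c c' : C} (r : ℂ) (f : c ⟶ c') (m : M), (r • f) ⊵ₗ m = r • f ⊵ₗ m
  actionHomRight_add : ∀ (c : C) {m m' : M} (f g : m ⟶ m'), c ⊴ₗ (f + g) = c ⊴ₗ f + c ⊴ₗ g
  actionHomRight_smul : ∀ (c : C) {m m' : M} (r : ℂ) (f : m ⟶ m'), c ⊴ₗ (r • f) = r • c ⊴ₗ f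

/-- A right action on a `ℂ`-linear category that is `ℂ`-bilinear on morphisms. -/
class LinearRightAction (D M : Type*) [Category* D] [Category* M] [Preadditive D] [Linear ℂ D]
    [Preadditive M] [Linear ℂ M] [MonoidalCategory D] [MonoidalRightAction D M] : Prop where
  add_actionHomLeft : ∀ {m m' : M} (f g : m ⟶ m') (d : D), (f + g) ⊵ᵣ d = f ⊵ᵣ d + g ⊵ᵣ d
  smul_actionHomLeft : ∀ {m m' : M} (r : ℂ) (f : m ⟶ m') (d : D), (r • f) ⊵ᵣ d = r • f ⊵ᵣ d
  actionHomRight_add : ∀ (m : M) {d d' : D} (f g : d ⟶ d'), m ⊴ᵣ (f + g) = m ⊴ᵣ f + m ⊴ᵣ g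
  actionHomRight_smul : ∀ (m : M) {d d' : D} (r : ℂ) (f : d ⟶ d'), m ⊴ᵣ (r • f) = r • m ⊴ᵣ f

/-- A `C|D`-bimodule category: commuting left and right actions, with the middle associator
`(c ⊙ m) ⊙ d ≅ c ⊙ (m ⊙ d)`, its naturality, the two mixed pentagons and the two triangles. -/
class BimoduleCategory (C D M : Type*) [Category* C] [Category* D] [Category* M]
    [MonoidalCategory C] [MonoidalCategory D]
    [MonoidalLeftAction C M] [MonoidalRightAction D M] where
  midAssoc : ∀ (c : C) (m : M) (d : D), (c ⊙ₗ m) ⊙ᵣ d ≅ c ⊙ₗ (m ⊙ᵣ d)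
  midAssoc_naturality : ∀ {c c' : C} {m m' : M} {d d' : D}
    (f : c ⟶ c') (g : m ⟶ m') (h : d ⟶ d'),
    ((f ⊙ₗₘ g) ⊙ᵣₘ h) ≫ (midAssoc c' m' d').hom = (midAssoc c m d).hom ≫ (f ⊙ₗₘ (g ⊙ᵣₘ h))
  pentagon_left : ∀ (c c' : C) (m : M) (d : D),
    (αₗ c c' m).hom ⊵ᵣ d ≫ (midAssoc c (c' ⊙ₗ m) d).hom ≫ c ⊴ₗ (midAssoc c' m d).hom =
      (midAssoc (c ⊗ c') m d).hom ≫ (αₗ c c' (m ⊙ᵣ d)).hom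
  pentagon_right : ∀ (c : C) (m : M) (d d' : D),
    (midAssoc c m (d ⊗ d')).hom ≫ c ⊴ₗ (αᵣ m d d').hom =
      (αᵣ (c ⊙ₗ m) d d').hom ≫ (midAssoc c m d).hom ⊵ᵣ d' ≫ (midAssoc c (m ⊙ᵣ d) d').hom
  triangle_left : ∀ (m : M) (d : D),
    (midAssoc (𝟙_ C) m d).hom ≫ (λₗ[C] (m ⊙ᵣ d)).hom = (λₗ[C] m).hom ⊵ᵣ d
  triangle_right : ∀ (c : C) (m : M),
    (midAssoc c m (𝟙_ D)).hom ≫ c ⊴ₗ (ρᵣ[D] m).hom = (ρᵣ[D] (c ⊙ₗ m)).hom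

/-! ### Algebra-coalgebra data -/

/-- The structure maps of a (weak) bialgebra: product, unit, coproduct and counit. -/
structure BialgData (V : Type*) [AddCommGroup V] [Module ℂ V] where
  mul : V →ₗ[ℂ] V →ₗ[ℂ] V
  one : V
  comul : V →ₗ[ℂ] V ⊗[ℂ] V
  counit : V →ₗ[ℂ] ℂ

/-- The product is associative and unital. -/
structure BialgData.IsAlgebra {V : Type*} [AddCommGroup V] [Module ℂ V]
    (S : BialgData V) : Prop where
  assoc : ∀ x y z, S.mul (S.mul x y) z = S.mul x (S.mul y z)
  one_mul : ∀ x, S.mul S.one x = x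
  mul_one : ∀ x, S.mul x S.one = x

/-- `F` preserves product, unit, coproduct and counit. -/
structure BialgData.IsHom {V W : Type*} [AddCommGroup V] [Module ℂ V] [AddCommGroup W]
    [Module ℂ W] (S : BialgData V) (T : BialgData W) (F : V →ₗ[ℂ] W) : Prop where
  map_mul : ∀ x y, F (S.mul x y) = T.mul (F x) (F y)
  map_one : F S.one = T.one
  map_comul : ∀ x, TensorProduct.map F F (S.comul x) = T.comul (F x)
  map_counit : ∀ x, T.counit (F x) = S.counit x

/-- `F` is injective and preserves product, unit, coproduct and counit: it identifies its source
with a unital subalgebra of its target that is closed under the coproduct. -/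
structure BialgData.IsSub {V W : Type*} [AddCommGroup V] [Module ℂ V] [AddCommGroup W]
    [Module ℂ W] (S : BialgData V) (T : BialgData W) (F : V →ₗ[ℂ] W) : Prop
    extends BialgData.IsHom S T F where
  injective : Function.Injective F

/-! ### Tube diagrams -/

section Diagrams

variable {C D M : Type*} [Category* C] [Category* D] [Category* M]
  [Preadditive C] [Linear ℂ C] [Preadditive D] [Linear ℂ D] [Preadditive M] [Linear ℂ M]
  [MonoidalCategory C] [MonoidalCategory D] [MonoidalLeftAction C M] [MonoidalRightAction D M]

/-- The vertex spaces of a basic tube diagram with left arc `a`, right arc `b`: on the lower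
strand (read upwards) `μ : c ⟶ d ⊙ b`, then `ν : d ⟶ a ⊙ e`; on the upper strand
`ζ : a ⊙ f ⟶ g`, then `γ : g ⊙ b ⟶ h`. An element is a combination of
`(μ ⊗ ν) ⊗ (γ ⊗ ζ)`. -/
abbrev Cell (a : C) (b : D) (c d e f g h : M) : Type _ :=
  ((c ⟶ d ⊙ᵣ b) ⊗[ℂ] (d ⟶ a ⊙ₗ e)) ⊗[ℂ] ((g ⊙ᵣ b ⟶ h) ⊗[ℂ] (a ⊙ₗ f ⟶ g))

/-- Tube diagrams with arbitrary objects `X`, `Y` on the arcs and arbitrary morphisms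
`c ⟶ (X ⊙ e) ⊙ Y` and `(X ⊙ f) ⊙ Y ⟶ h` on the two strands. -/
abbrev Diag (X : C) (Y : D) (c e f h : M) : Type _ :=
  (c ⟶ (X ⊙ₗ e) ⊙ᵣ Y) ⊗[ℂ] ((X ⊙ₗ f) ⊙ᵣ Y ⟶ h)

/-- Diagrams with a right arc only. -/
abbrev HalfR (b : D) (c d g h : M) : Type _ := (c ⟶ d ⊙ᵣ b) ⊗[ℂ] (g ⊙ᵣ b ⟶ h)

/-- Diagrams with a left arc only. -/
abbrev HalfL (a : C) (d e f g : M) : Type _ := (d ⟶ a ⊙ₗ e) ⊗[ℂ] (a ⊙ₗ f ⟶ g)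

variable [LinearLeftAction C M] [LinearRightAction D M]

/-- Compose the vertices on each strand: `(μ ⊗ ν) ⊗ (γ ⊗ ζ) ↦ (μ ≫ ν ⊵ b) ⊗ (ζ ⊵ b ≫ γ)`. -/
def assemble (a : C) (b : D) (c d e f g h : M) :
    Cell a b c d e f g h →ₗ[ℂ] Diag a b c e f h :=
  TensorProduct.map
    (TensorProduct.lift (LinearMap.mk₂ ℂ (fun μ ν => μ ≫ ν ⊵ᵣ b)
      (by intros; simp) (by intros; simp)
      (by intros; simp [LinearRightAction.add_actionHomLeft])
      (by intros; simp [LinearRightAction.smul_actionHomLeft])))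
    (TensorProduct.lift (LinearMap.mk₂ ℂ (fun γ ζ => ζ ⊵ᵣ b ≫ γ)
      (by intros; simp) (by intros; simp)
      (by intros; simp [LinearRightAction.add_actionHomLeft])
      (by intros; simp [LinearRightAction.smul_actionHomLeft])))

variable [BimoduleCategory C D M]

/-- The rebracketing `(X ⊙ ((X' ⊙ m) ⊙ Y')) ⊙ Y ≅ ((X ⊗ X') ⊙ m) ⊙ (Y' ⊗ Y)`. -/
def stackIso (X X' : C) (Y Y' : D) (m : M) :
    (X ⊙ₗ ((X' ⊙ₗ m) ⊙ᵣ Y')) ⊙ᵣ Y ≅ ((X ⊗ X') ⊙ₗ m) ⊙ᵣ (Y' ⊗ Y) where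
  hom := (BimoduleCategory.midAssoc X (X' ⊙ₗ m) Y').inv ⊵ᵣ Y ≫
    (αᵣ (X ⊙ₗ (X' ⊙ₗ m)) Y' Y).inv ≫ (αₗ X X' m).inv ⊵ᵣ (Y' ⊗ Y)
  inv := (αₗ X X' m).hom ⊵ᵣ (Y' ⊗ Y) ≫ (αᵣ (X ⊙ₗ (X' ⊙ₗ m)) Y' Y).hom ≫
    (BimoduleCategory.midAssoc X (X' ⊙ₗ m) Y').hom ⊵ᵣ Y
  hom_inv_id := by
    simp [← MonoidalRightAction.comp_actionHomLeft]
  inv_hom_id := by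
    simp [← MonoidalRightAction.comp_actionHomLeft,
      ← MonoidalRightAction.comp_actionHomLeft_assoc]

/-- The first diagram is drawn around the second one; the arcs become `X ⊗ X'` and `Y' ⊗ Y`. -/
def stack (X X' : C) (Y Y' : D) (c m n h e f : M) :
    Diag X Y c m n h →ₗ[ℂ] Diag X' Y' m e f n →ₗ[ℂ] Diag (X ⊗ X') (Y' ⊗ Y) c e f h :=
  TensorProduct.map₂
    (LinearMap.mk₂ ℂ (fun u u' => u ≫ (X ⊴ₗ u') ⊵ᵣ Y ≫ (stackIso X X' Y Y' e).hom)
      (by intros; simp) (by intros; simp)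
      (by intros; simp [LinearRightAction.add_actionHomLeft, LinearLeftAction.actionHomRight_add])
      (by intros; simp [LinearRightAction.smul_actionHomLeft,
            LinearLeftAction.actionHomRight_smul]))
    (LinearMap.mk₂ ℂ (fun v v' => (stackIso X X' Y Y' f).inv ≫ (X ⊴ₗ v') ⊵ᵣ Y ≫ v)
      (by intros; simp) (by intros; simp)
      (by intros; simp [LinearRightAction.add_actionHomLeft, LinearLeftAction.actionHomRight_add])
      (by intros; simp [LinearRightAction.smul_actionHomLeft,
            LinearLeftAction.actionHomRight_smul]))

/-- A left arc drawn around a right arc, with the middle associator moving the left arc inside: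
for `ν : d ⟶ a ⊙ m`, `μ : m ⟶ e ⊙ b` the lower strand is `d ⟶ a ⊙ (e ⊙ b) ≅ (a ⊙ e) ⊙ b`,
and similarly on the upper strand. -/
def slide (a : C) (b : D) (d g m n e f : M) :
    HalfL a d m n g →ₗ[ℂ] HalfR b m e f n →ₗ[ℂ] Diag a b d e f g :=
  TensorProduct.map₂
    (LinearMap.mk₂ ℂ (fun ν μ => ν ≫ (a ⊴ₗ μ) ≫ (BimoduleCategory.midAssoc a e b).inv)
      (by intros; simp) (by intros; simp)
      (by intros; simp [LinearLeftAction.actionHomRight_add])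
      (by intros; simp [LinearLeftAction.actionHomRight_smul]))
    (LinearMap.mk₂ ℂ (fun ζ γ => (BimoduleCategory.midAssoc a f b).hom ≫ (a ⊴ₗ γ) ≫ ζ)
      (by intros; simp) (by intros; simp)
      (by intros; simp [LinearLeftAction.actionHomRight_add])
      (by intros; simp [LinearLeftAction.actionHomRight_smul]))

end Diagrams

/-! ### The tube algebra and its subalgebras of diagrams with restricted arc labels -/

section Tube

variable {C D : Type*} (M : Type*) [Category* C] [Category* D] [Category* M]
  [Preadditive C] [Linear ℂ C] [Preadditive D] [Linear ℂ D] [Preadditive M] [Linear ℂ M]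
  [MonoidalCategory C] [MonoidalCategory D] [MonoidalLeftAction C M] [MonoidalRightAction D M]

/-- Tube diagrams with outer edges `c` (below), `h` (above), inner edges `e`, `f`, left arc in
`A`, right arc in `B`; the index `(a, b, d, g)` lists the remaining labels. -/
def TubeComp (A : Finset (Irr C)) (B : Finset (Irr D)) (c h e f : Irr M) : Type _ :=
  (t : A × B × Irr M × Irr M) → Cell t.1.1.rep t.2.1.1.rep c.rep t.2.2.1.rep e.rep
    f.rep t.2.2.2.rep h.rep

instance (A : Finset (Irr C)) (B : Finset (Irr D)) (c h e f : Irr M) :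
    AddCommGroup (TubeComp M A B c h e f) :=
  inferInstanceAs (AddCommGroup ((t : A × B × Irr M × Irr M) → Cell _ _ _ _ _ _ _ _))

instance (A : Finset (Irr C)) (B : Finset (Irr D)) (c h e f : Irr M) :
    Module ℂ (TubeComp M A B c h e f) :=
  inferInstanceAs (Module ℂ ((t : A × B × Irr M × Irr M) → Cell _ _ _ _ _ _ _ _))

/-- The span of the tube diagrams whose left arc is in `A` and whose right arc is in `B`: the
direct sum over all edge labels of the tensor products of vertex spaces. -/
def TubeOn (A : Finset (Irr C)) (B : Finset (Irr D)) : Type _ :=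
  (q : Irr M × Irr M × Irr M × Irr M) → TubeComp M A B q.1 q.2.1 q.2.2.1 q.2.2.2

instance (A : Finset (Irr C)) (B : Finset (Irr D)) : AddCommGroup (TubeOn M A B) :=
  inferInstanceAs (AddCommGroup ((q : Irr M × Irr M × Irr M × Irr M) → TubeComp M A B _ _ _ _))

instance (A : Finset (Irr C)) (B : Finset (Irr D)) : Module ℂ (TubeOn M A B) :=
  inferInstanceAs (Module ℂ ((q : Irr M × Irr M × Irr M × Irr M) → TubeComp M A B _ _ _ _))

variable {M}

section
variable (A : Finset (Irr C)) (B : Finset (Irr D))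

/-- The inclusion of the summand with outer edges `c`, `h` and inner edges `e`, `f`. -/
def emb (c h e f : Irr M) : TubeComp M A B c h e f →ₗ[ℂ] TubeOn M A B :=
  LinearMap.single ℂ (fun q : Irr M × Irr M × Irr M × Irr M =>
    TubeComp M A B q.1 q.2.1 q.2.2.1 q.2.2.2) (c, h, e, f)

/-- The projection to the summand with outer edges `c`, `h` and inner edges `e`, `f`. -/
def comp (c h e f : Irr M) : TubeOn M A B →ₗ[ℂ] TubeComp M A B c h e f :=
  LinearMap.proj (R := ℂ) (φ := fun q : Irr M × Irr M × Irr M × Irr M =>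
    TubeComp M A B q.1 q.2.1 q.2.2.1 q.2.2.2) (c, h, e, f)

/-- The coefficient of the labels `(a, b, d, g)`. -/
def coeff (c h e f : Irr M) (t : A × B × Irr M × Irr M) :
    TubeComp M A B c h e f →ₗ[ℂ] Cell t.1.1.rep t.2.1.1.rep c.rep t.2.2.1.rep e.rep
      f.rep t.2.2.2.rep h.rep :=
  LinearMap.proj (R := ℂ) (φ := fun t : A × B × Irr M × Irr M =>
    Cell t.1.1.rep t.2.1.1.rep c.rep t.2.2.1.rep e.rep f.rep t.2.2.2.rep h.rep) t

/-- The inclusion of the vertex space with labels `(a, b, d, g)`. -/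
def cellEmb (c h e f : Irr M) (t : A × B × Irr M × Irr M) :
    Cell t.1.1.rep t.2.1.1.rep c.rep t.2.2.1.rep e.rep f.rep t.2.2.2.rep h.rep →ₗ[ℂ]
      TubeComp M A B c h e f :=
  LinearMap.single ℂ (fun t : A × B × Irr M × Irr M =>
    Cell t.1.1.rep t.2.1.1.rep c.rep t.2.2.1.rep e.rep f.rep t.2.2.2.rep h.rep) t

end

variable [IsFiniteSemisimple C] [IsFiniteSemisimple D] [IsFiniteSemisimple M]
variable (A : Finset (Irr C)) (B : Finset (Irr D))

/-- Rewrite a diagram with arbitrary `X`, `Y` on the arcs as a combination of basic tube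
diagrams: insert resolutions of the identity of `X` and of `Y` into simple objects (parallel
moves), then of `a ⊙ e` and of `a ⊙ f`. Terms with arc labels outside `A`, `B` are dropped; none
occur when `A`, `B` are closed under the fusions considered, as for all labels or unit labels. -/
def expand (X : C) (Y : D) (c h e f : Irr M) :
    Diag X Y c.rep e.rep f.rep h.rep →ₗ[ℂ] TubeComp M A B c h e f :=
  ∑ k : Fin (dec X).n, ∑ l : Fin (dec Y).n,
    if hkl : (dec X).s k ∈ A ∧ (dec Y).s l ∈ B then
      ∑ p : Fin (dec (((dec X).s k).rep ⊙ₗ e.rep)).n,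
      ∑ q : Fin (dec (((dec X).s k).rep ⊙ₗ f.rep)).n,
        cellEmb A B c h e f
          (⟨(dec X).s k, hkl.1⟩, ⟨(dec Y).s l, hkl.2⟩, (dec (((dec X).s k).rep ⊙ₗ e.rep)).s p,
            (dec (((dec X).s k).rep ⊙ₗ f.rep)).s q) ∘ₗ
        TensorProduct.map
          ((TensorProduct.mk ℂ _ _).flip ((dec (((dec X).s k).rep ⊙ₗ e.rep)).incl p) ∘ₗ
            Linear.rightComp ℂ c.rep
              (((dec X).proj k ⊵ₗ e.rep) ⊵ᵣ Y ≫
                (((dec X).s k).rep ⊙ₗ e.rep) ⊴ᵣ (dec Y).proj l ≫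
                (dec (((dec X).s k).rep ⊙ₗ e.rep)).proj p ⊵ᵣ ((dec Y).s l).rep))
          ((TensorProduct.mk ℂ _ _).flip ((dec (((dec X).s k).rep ⊙ₗ f.rep)).proj q) ∘ₗ
            Linear.leftComp ℂ h.rep
              ((dec (((dec X).s k).rep ⊙ₗ f.rep)).incl q ⊵ᵣ ((dec Y).s l).rep ≫
                (((dec X).s k).rep ⊙ₗ f.rep) ⊴ᵣ (dec Y).incl l ≫
                ((dec X).incl k ⊵ₗ f.rep) ⊵ᵣ Y))
    else 0

variable [LinearLeftAction C M] [LinearRightAction D M]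

/-- A tube diagram as a diagram with composed vertices. -/
def toDiag (c h e f : Irr M) (t : A × B × Irr M × Irr M) :
    TubeComp M A B c h e f →ₗ[ℂ] Diag t.1.1.rep t.2.1.1.rep c.rep e.rep f.rep h.rep :=
  assemble _ _ _ _ _ _ _ _ ∘ₗ coeff A B c h e f t

/-- The counit: zero unless `c = h`, `e = f`, `d = g`; then
`(μ ⊗ ν) ⊗ (γ ⊗ ζ)` goes to the product of the scalars of `μ ≫ γ` and `ν ≫ ζ`. -/
def tubeCounit : TubeOn M A B →ₗ[ℂ] ℂ :=
  ∑ c : Irr M, ∑ e : Irr M, ∑ a : A, ∑ b : B, ∑ d : Irr M,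
    LinearMap.mul' ℂ ℂ ∘ₗ
    TensorProduct.map
      (TensorProduct.lift (LinearMap.mk₂ ℂ
        (fun (μ : c.rep ⟶ d.rep ⊙ᵣ b.1.rep) (γ : d.rep ⊙ᵣ b.1.rep ⟶ c.rep) =>
          endScalar c.rep (μ ≫ γ))
        (by intros; simp) (by intros; simp) (by intros; simp) (by intros; simp)))
      (TensorProduct.lift (LinearMap.mk₂ ℂ
        (fun (ν : d.rep ⟶ a.1.rep ⊙ₗ e.rep) (ζ : a.1.rep ⊙ₗ e.rep ⟶ d.rep) =>
          endScalar d.rep (ν ≫ ζ))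
        (by intros; simp) (by intros; simp) (by intros; simp) (by intros; simp))) ∘ₗ
    (TensorProduct.tensorTensorTensorComm ℂ _ _ _ _).toLinearMap ∘ₗ
    coeff A B c c e e (a, b, d, d) ∘ₗ comp A B c c e e

/-- The coproduct of a tube diagram with labels `a, …, h` and vertices `μ, ν, γ, ζ`: the sum over
`i`, `j`, `k` and over dual bases `σ`, `σ'` of `j ⟶ a ⊙ i`, `a ⊙ i ⟶ j` and `ρ`, `ρ'` of
`k ⟶ j ⊙ b`, `j ⊙ b ⟶ k` of the diagram with edges `f, g, h; k, j, i` and vertices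
`ρ, σ; γ, ζ` tensor the diagram with edges `i, j, k; c, d, e` and vertices `μ, ν; ρ', σ'`. -/
def tubeComul : TubeOn M A B →ₗ[ℂ] TubeOn M A B ⊗[ℂ] TubeOn M A B :=
  ∑ c : Irr M, ∑ h : Irr M, ∑ e : Irr M, ∑ f : Irr M, ∑ t : A × B × Irr M × Irr M,
  ∑ i : Irr M,
  ∑ p : Fin (dec (t.1.1.rep ⊙ₗ i.rep)).n,
  ∑ q : Fin (dec (((dec (t.1.1.rep ⊙ₗ i.rep)).s p).rep ⊙ᵣ t.2.1.1.rep)).n,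
    TensorProduct.map
      (emb A B ((dec (((dec (t.1.1.rep ⊙ₗ i.rep)).s p).rep ⊙ᵣ t.2.1.1.rep)).s q) h i f ∘ₗ
        cellEmb A B ((dec (((dec (t.1.1.rep ⊙ₗ i.rep)).s p).rep ⊙ᵣ t.2.1.1.rep)).s q) h i f
          (t.1, t.2.1, (dec (t.1.1.rep ⊙ₗ i.rep)).s p, t.2.2.2) ∘ₗ
        TensorProduct.mk ℂ _ _
          ((dec (((dec (t.1.1.rep ⊙ₗ i.rep)).s p).rep ⊙ᵣ t.2.1.1.rep)).incl q ⊗ₜ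
            (dec (t.1.1.rep ⊙ₗ i.rep)).incl p))
      (emb A B c ((dec (((dec (t.1.1.rep ⊙ₗ i.rep)).s p).rep ⊙ᵣ t.2.1.1.rep)).s q) e i ∘ₗ
        cellEmb A B c ((dec (((dec (t.1.1.rep ⊙ₗ i.rep)).s p).rep ⊙ᵣ t.2.1.1.rep)).s q) e i
          (t.1, t.2.1, t.2.2.1, (dec (t.1.1.rep ⊙ₗ i.rep)).s p) ∘ₗ
        (TensorProduct.mk ℂ _ _).flip
          ((dec (((dec (t.1.1.rep ⊙ₗ i.rep)).s p).rep ⊙ᵣ t.2.1.1.rep)).proj q ⊗ₜ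
            (dec (t.1.1.rep ⊙ₗ i.rep)).proj p)) ∘ₗ
    (TensorProduct.comm ℂ _ _).toLinearMap ∘ₗ
    coeff A B c h e f t ∘ₗ comp A B c h e f

variable [BimoduleCategory C D M]

/-- The product of tube diagrams with matching edges `m`, `n`. -/
def mulComp (c h m n e f : Irr M) :
    TubeComp M A B c h m n →ₗ[ℂ] TubeComp M A B m n e f →ₗ[ℂ] TubeComp M A B c h e f :=
  ∑ t : A × B × Irr M × Irr M, ∑ t' : A × B × Irr M × Irr M,
    ((stack t.1.1.rep t'.1.1.rep t.2.1.1.rep t'.2.1.1.rep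
        c.rep m.rep n.rep h.rep e.rep f.rep).compl₁₂
      (toDiag A B c h m n t) (toDiag A B m n e f t')).compr₂
    (expand A B (t.1.1.rep ⊗ t'.1.1.rep) (t'.2.1.1.rep ⊗ t.2.1.1.rep) c h e f)

/-- The product: the first diagram is drawn around the second one when the inner edges of the
first are the outer edges of the second; otherwise it is zero. -/
def tubeMul : TubeOn M A B →ₗ[ℂ] TubeOn M A B →ₗ[ℂ] TubeOn M A B :=
  ∑ c : Irr M, ∑ h : Irr M, ∑ m : Irr M, ∑ n : Irr M, ∑ e : Irr M, ∑ f : Irr M,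
    ((mulComp A B c h m n e f).compl₁₂ (comp A B c h m n) (comp A B m n e f)).compr₂
      (emb A B c h e f)

/-- The unit: the sum over `c`, `h` of the pairs of strands `c`, `h` with dotted arcs. -/
def tubeOne : TubeOn M A B :=
  ∑ c : Irr M, ∑ h : Irr M, emb A B c h c h
    (expand A B (𝟙_ C) (𝟙_ D) c h c h
      (((λₗ[C] c.rep).inv ≫ (ρᵣ[D] (𝟙_ C ⊙ₗ c.rep)).inv) ⊗ₜ
        ((ρᵣ[D] (𝟙_ C ⊙ₗ h.rep)).hom ≫ (λₗ[C] h.rep).hom)))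

/-- The algebra and coalgebra structure on the span of tube diagrams with arcs in `A`, `B`. -/
def tubeData : BialgData (TubeOn M A B) where
  mul := tubeMul A B
  one := tubeOne A B
  comul := tubeComul A B
  counit := tubeCounit A B

end Tube

section Main

variable (C D M : Type*) [Category* C] [Category* D] [Category* M]
  [Preadditive C] [Linear ℂ C] [Preadditive D] [Linear ℂ D] [Preadditive M] [Linear ℂ M]
  [MonoidalCategory C] [MonoidalCategory D] [MonoidalLeftAction C M] [MonoidalRightAction D M]
  [IsFiniteSemisimple C] [IsFiniteSemisimple D] [IsFiniteSemisimple M]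

/-- The domain wall tube algebra `Tube(_C M_D)`: all labels. -/
abbrev Tube : Type _ := TubeOn M (allLabels C) (allLabels D)

/-- `R(M_D)`: tube diagrams with dotted left arc. -/
abbrev RTube : Type _ := TubeOn M (unitLabels C) (allLabels D)

/-- `L(_C M)`: tube diagrams with dotted right arc. -/
abbrev LTube : Type _ := TubeOn M (allLabels C) (unitLabels D)

/-- The summand of `R(M_D)` with outer edges `c`, `h` and inner edges `d`, `g`. -/
abbrev RComp (c h d g : Irr M) : Type _ :=
  TubeComp M (unitLabels C) (allLabels D) c h d g

/-- The summand of `L(_C M)` with outer edges `d`, `g` and inner edges `e`, `f`. -/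
abbrev LComp (d g e f : Irr M) : Type _ :=
  TubeComp M (allLabels C) (unitLabels D) d g e f

variable {C D M} in
/-- Extension by zero, from diagrams with arcs in `A`, `B` to all tube diagrams. -/
def inclTube (A : Finset (Irr C)) (B : Finset (Irr D)) : TubeOn M A B →ₗ[ℂ] Tube C D M :=
  ∑ c : Irr M, ∑ h : Irr M, ∑ e : Irr M, ∑ f : Irr M, ∑ t : A × B × Irr M × Irr M,
    emb (allLabels C) (allLabels D) c h e f ∘ₗ
    cellEmb (allLabels C) (allLabels D) c h e f
      (⟨t.1.1, Finset.mem_univ _⟩, ⟨t.2.1.1, Finset.mem_univ _⟩, t.2.2.1, t.2.2.2) ∘ₗ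
    coeff A B c h e f t ∘ₗ comp A B c h e f

/-- The underlying space of the crossed product `R(M_D) ⋈ L(_C M)`: it is spanned by the pairs
of a diagram in `R(M_D)` and a diagram in `L(_C M)` whose intermediate edges `d`, `g` match, i.e.
it is the tensor product of `R(M_D)` and `L(_C M)` over the algebra spanned by the pairs of
strands `d`, `g` with both arcs dotted. -/
def Crossed : Type _ :=
  (q : Irr M × Irr M × Irr M × Irr M × Irr M × Irr M) →
    RComp C D M q.1 q.2.1 q.2.2.1 q.2.2.2.1 ⊗[ℂ]
      LComp C D M q.2.2.1 q.2.2.2.1 q.2.2.2.2.1 q.2.2.2.2.2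

instance : AddCommGroup (Crossed C D M) :=
  inferInstanceAs (AddCommGroup ((q : Irr M × Irr M × Irr M × Irr M × Irr M × Irr M) →
    RComp C D M _ _ _ _ ⊗[ℂ] LComp C D M _ _ _ _))

instance : Module ℂ (Crossed C D M) :=
  inferInstanceAs (Module ℂ ((q : Irr M × Irr M × Irr M × Irr M × Irr M × Irr M) →
    RComp C D M _ _ _ _ ⊗[ℂ] LComp C D M _ _ _ _))

variable {M}

/-- The inclusion of the summand of the crossed product with edges `c, h; d, g; e, f`. -/
def crossedEmb (c h d g e f : Irr M) :
    RComp C D M c h d g ⊗[ℂ] LComp C D M d g e f →ₗ[ℂ] Crossed C D M :=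
  LinearMap.single ℂ (fun q : Irr M × Irr M × Irr M × Irr M × Irr M × Irr M =>
    RComp C D M q.1 q.2.1 q.2.2.1 q.2.2.2.1 ⊗[ℂ]
      LComp C D M q.2.2.1 q.2.2.2.1 q.2.2.2.2.1 q.2.2.2.2.2) (c, h, d, g, e, f)

/-- The projection to the summand of the crossed product with edges `c, h; d, g; e, f`. -/
def crossedComp (c h d g e f : Irr M) :
    Crossed C D M →ₗ[ℂ] RComp C D M c h d g ⊗[ℂ] LComp C D M d g e f :=
  LinearMap.proj (R := ℂ) (φ := fun q : Irr M × Irr M × Irr M × Irr M × Irr M × Irr M =>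
    RComp C D M q.1 q.2.1 q.2.2.1 q.2.2.2.1 ⊗[ℂ]
      LComp C D M q.2.2.1 q.2.2.2.1 q.2.2.2.2.1 q.2.2.2.2.2) (c, h, d, g, e, f)

/-- `(r, l) ↦ r ⋈ l`; on diagrams it vanishes unless the inner edges of `r` are the outer edges
of `l`. -/
def cross : RTube C D M →ₗ[ℂ] LTube C D M →ₗ[ℂ] Crossed C D M :=
  ∑ c : Irr M, ∑ h : Irr M, ∑ d : Irr M, ∑ g : Irr M, ∑ e : Irr M, ∑ f : Irr M,
    ((TensorProduct.mk ℂ (RComp C D M c h d g) (LComp C D M d g e f)).compl₁₂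
      (comp _ _ c h d g) (comp _ _ d g e f)).compr₂ (crossedEmb C D c h d g e f)

variable [LinearLeftAction C M] [LinearRightAction D M]

variable {C D}

/-- Remove the dotted left arc of a diagram in `R(M_D)`. -/
def stripR (c h d g : Irr M) (t : unitLabels C × (allLabels D) × Irr M × Irr M) :
    RComp C D M c h d g →ₗ[ℂ] HalfR t.2.1.1.rep c.rep d.rep g.rep h.rep :=
  TensorProduct.map
    (Linear.rightComp ℂ c.rep ((unitIncl t.1 ⊵ₗ d.rep ≫ (λₗ[C] d.rep).hom) ⊵ᵣ t.2.1.1.rep))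
    (Linear.leftComp ℂ h.rep (((λₗ[C] g.rep).inv ≫ unitProj t.1 ⊵ₗ g.rep) ⊵ᵣ t.2.1.1.rep)) ∘ₗ
  toDiag _ _ c h d g t

/-- Remove the dotted right arc of a diagram in `L(_C M)`. -/
def stripL (d g e f : Irr M) (t : (allLabels C) × unitLabels D × Irr M × Irr M) :
    LComp C D M d g e f →ₗ[ℂ] HalfL t.1.1.rep d.rep e.rep f.rep g.rep :=
  TensorProduct.map
    (Linear.rightComp ℂ d.rep
      ((t.1.1.rep ⊙ₗ e.rep) ⊴ᵣ unitIncl t.2.1 ≫ (ρᵣ[D] (t.1.1.rep ⊙ₗ e.rep)).hom))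
    (Linear.leftComp ℂ g.rep
      ((ρᵣ[D] (t.1.1.rep ⊙ₗ f.rep)).inv ≫ (t.1.1.rep ⊙ₗ f.rep) ⊴ᵣ unitProj t.2.1)) ∘ₗ
  toDiag _ _ d g e f t

variable (C D) in
/-- The gluing map `Φ : R(M_D) ⋈ L(_C M) ⟶ Tube(_C M_D)`: it sends
`[dotted; b] with c, d; g, h; μ, γ` crossed with `[a; dotted] with d, e; f, g; ν, ζ` to the basic
tube diagram with arcs `a`, `b`, edges `c, d, e; f, g, h` and vertices `μ, ν; γ, ζ`. -/
def gluing : Crossed C D M →ₗ[ℂ] Tube C D M :=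
  ∑ c : Irr M, ∑ h : Irr M, ∑ d : Irr M, ∑ g : Irr M, ∑ e : Irr M, ∑ f : Irr M,
  ∑ t : unitLabels C × (allLabels D) × Irr M × Irr M,
  ∑ t' : (allLabels C) × unitLabels D × Irr M × Irr M,
    emb (allLabels C) (allLabels D) c h e f ∘ₗ
    cellEmb (allLabels C) (allLabels D) c h e f
      (t'.1, t.2.1, d, g) ∘ₗ
    (TensorProduct.tensorTensorTensorComm ℂ _ _ _ _).toLinearMap ∘ₗ
    TensorProduct.map (stripR c h d g t) (stripL d g e f t') ∘ₗ
    crossedComp C D c h d g e f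

/-- Rewrite a diagram with arcs `a`, `b` as a combination of pairs of a diagram with right arc
`b` (outside) and a diagram with left arc `a` (inside), by decomposing `a ⊙ e` and `a ⊙ f`. -/
def split (a : C) (b : D) (c h e f : Irr M) :
    Diag a b c.rep e.rep f.rep h.rep →ₗ[ℂ]
      ((p : Irr M × Irr M) → RComp C D M c h p.1 p.2 ⊗[ℂ] LComp C D M p.1 p.2 e f) :=
  ∑ x : Fin (dec (a ⊙ₗ e.rep)).n, ∑ y : Fin (dec (a ⊙ₗ f.rep)).n,
    LinearMap.single ℂ
      (fun p : Irr M × Irr M => RComp C D M c h p.1 p.2 ⊗[ℂ] LComp C D M p.1 p.2 e f)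
      ((dec (a ⊙ₗ e.rep)).s x, (dec (a ⊙ₗ f.rep)).s y) ∘ₗ
    (TensorProduct.mk ℂ _ _).flip
      (expand (allLabels C) (unitLabels D) a (𝟙_ D)
        ((dec (a ⊙ₗ e.rep)).s x) ((dec (a ⊙ₗ f.rep)).s y) e f
        (((dec (a ⊙ₗ e.rep)).incl x ≫ (ρᵣ[D] (a ⊙ₗ e.rep)).inv) ⊗ₜ
          ((ρᵣ[D] (a ⊙ₗ f.rep)).hom ≫ (dec (a ⊙ₗ f.rep)).proj y))) ∘ₗ
    expand (unitLabels C) (allLabels D) (𝟙_ C) b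
        c h ((dec (a ⊙ₗ e.rep)).s x) ((dec (a ⊙ₗ f.rep)).s y) ∘ₗ
    TensorProduct.map
      (Linear.rightComp ℂ c.rep
        (((dec (a ⊙ₗ e.rep)).proj x ≫ (λₗ[C] ((dec (a ⊙ₗ e.rep)).s x).rep).inv) ⊵ᵣ b))
      (Linear.leftComp ℂ h.rep
        (((λₗ[C] ((dec (a ⊙ₗ f.rep)).s y).rep).hom ≫ (dec (a ⊙ₗ f.rep)).incl y) ⊵ᵣ b))

variable [BimoduleCategory C D M]

/-- The exchange rule of the crossed product: a left arc drawn around a right arc is moved inside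
with the associator of the bimodule category, and the result is written as a combination of
pairs with the right arc outside and the left arc inside. -/
def exchange (d g m n d' g' : Irr M) :
    LComp C D M d g m n →ₗ[ℂ] RComp C D M m n d' g' →ₗ[ℂ]
      ((p : Irr M × Irr M) → RComp C D M d g p.1 p.2 ⊗[ℂ] LComp C D M p.1 p.2 d' g') :=
  ∑ t : (allLabels C) × unitLabels D × Irr M × Irr M,
  ∑ t' : unitLabels C × (allLabels D) × Irr M × Irr M,
    ((slide t.1.1.rep t'.2.1.1.rep d.rep g.rep m.rep n.rep d'.rep g'.rep).compl₁₂
      (stripL d g m n t) (stripR m n d' g' t')).compr₂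
    (split t.1.1.rep t'.2.1.1.rep d g d' g')

/-- The product in the crossed product on summands with matching edges:
`(r ⋈ l)(r' ⋈ l') = ∑ (r r'') ⋈ (l'' l')` where `∑ r'' ⋈ l''` is the exchange of `l` and `r'`. -/
def crossedMulComp (c h d g m n d' g' e f : Irr M) :
    (RComp C D M c h d g ⊗[ℂ] LComp C D M d g m n) ⊗[ℂ]
      (RComp C D M m n d' g' ⊗[ℂ] LComp C D M d' g' e f) →ₗ[ℂ] Crossed C D M :=
  ∑ x : Irr M, ∑ y : Irr M,
    crossedEmb C D c h x y e f ∘ₗ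
    TensorProduct.map
      (TensorProduct.lift (mulComp (unitLabels C) (allLabels D) c h d g x y))
      (TensorProduct.lift (mulComp (allLabels C) (unitLabels D) x y d' g' e f)) ∘ₗ
    (TensorProduct.assoc ℂ (RComp C D M c h d g) (RComp C D M d g x y)
      (LComp C D M x y d' g' ⊗[ℂ] LComp C D M d' g' e f)).symm.toLinearMap ∘ₗ
    LinearMap.lTensor (RComp C D M c h d g)
      ((TensorProduct.assoc ℂ (RComp C D M d g x y) (LComp C D M x y d' g')
          (LComp C D M d' g' e f)).toLinearMap ∘ₗ
        LinearMap.rTensor (LComp C D M d' g' e f)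
          (LinearMap.proj (R := ℂ) (φ := fun p : Irr M × Irr M =>
              RComp C D M d g p.1 p.2 ⊗[ℂ] LComp C D M p.1 p.2 d' g') (x, y) ∘ₗ
            TensorProduct.lift (exchange d g m n d' g')) ∘ₗ
        (TensorProduct.assoc ℂ (LComp C D M d g m n) (RComp C D M m n d' g')
          (LComp C D M d' g' e f)).symm.toLinearMap) ∘ₗ
    (TensorProduct.assoc ℂ (RComp C D M c h d g) (LComp C D M d g m n)
      (RComp C D M m n d' g' ⊗[ℂ] LComp C D M d' g' e f)).toLinearMap

/-- The product of the crossed product. -/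
def crossedMul : Crossed C D M →ₗ[ℂ] Crossed C D M →ₗ[ℂ] Crossed C D M :=
  ∑ c : Irr M, ∑ h : Irr M, ∑ d : Irr M, ∑ g : Irr M, ∑ m : Irr M, ∑ n : Irr M,
  ∑ d' : Irr M, ∑ g' : Irr M, ∑ e : Irr M, ∑ f : Irr M,
    ((TensorProduct.mk ℂ _ _).compl₁₂ (crossedComp C D c h d g m n)
      (crossedComp C D m n d' g' e f)).compr₂ (crossedMulComp c h d g m n d' g' e f)

/-- The coproduct of the crossed product: `Δ(r ⋈ l) = Δ(r) ⋈ Δ(l)`. -/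
def crossedComul : Crossed C D M →ₗ[ℂ] Crossed C D M ⊗[ℂ] Crossed C D M :=
  ∑ c : Irr M, ∑ h : Irr M, ∑ d : Irr M, ∑ g : Irr M, ∑ e : Irr M, ∑ f : Irr M,
    TensorProduct.map (TensorProduct.lift (cross C D)) (TensorProduct.lift (cross C D)) ∘ₗ
    (TensorProduct.tensorTensorTensorComm ℂ (RTube C D M) (RTube C D M) (LTube C D M)
      (LTube C D M)).toLinearMap ∘ₗ
    TensorProduct.map (tubeComul (unitLabels C) (allLabels D) ∘ₗ emb _ _ c h d g)
      (tubeComul (allLabels C) (unitLabels D) ∘ₗ emb _ _ d g e f) ∘ₗ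
    crossedComp C D c h d g e f

/-- The counit of the crossed product: `ε(r ⋈ l) = ε(r) ε(l)` for diagrams `r`, `l` with matching
edges. -/
def crossedCounit : Crossed C D M →ₗ[ℂ] ℂ :=
  ∑ c : Irr M, ∑ h : Irr M, ∑ d : Irr M, ∑ g : Irr M, ∑ e : Irr M, ∑ f : Irr M,
    LinearMap.mul' ℂ ℂ ∘ₗ
    TensorProduct.map (tubeCounit (unitLabels C) (allLabels D) ∘ₗ emb _ _ c h d g)
      (tubeCounit (allLabels C) (unitLabels D) ∘ₗ emb _ _ d g e f) ∘ₗ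
    crossedComp C D c h d g e f

variable (C D M) in
/-- The crossed product `R(M_D) ⋈ L(_C M)`; its unit is `1 ⋈ 1`. -/
def crossedData : BialgData (Crossed C D M) where
  mul := crossedMul
  one := cross C D (tubeOne _ _) (tubeOne _ _)
  comul := crossedComul
  counit := crossedCounit

end Main

end

end DomainWall

/-! The tube space is a quotient of the space of all diagrams, with arbitrary objects on the arcs,
in which a morphism may slide along the arcs from the upper strand to the lower one. Evaluation
respects sliding (`expand_slide`) because, by Schur's lemma, a morphism can be carried across a sum
over simple summands (`SimpleDecomp.sum_slide`). It fixes basic diagrams (`expand_assemble`).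
Conversely, any family of linear maps that is compatible with sliding is recovered from its values
on basic diagrams (`SlideInvariant.sum_toDiag_expand`). So every operation defined by sums over
simple labels can be computed on diagrams `gen X Y` with arbitrary arcs, where the chosen
decompositions no longer appear.

In this form the product is stacking (`tubeMul_gen`), the coproduct cuts both arcs along one edge
(`tubeComul_gen`), and the counit is the scalar of the closed diagram (`tubeCounit_gen`).
Associativity and the unit laws hold because the two sides differ by an associator or unitor on the
arcs, which slides; the required coherence is `stackIso_assoc` and the unit identities for
`stackIso`. Extension by zero takes `gen` to `gen` (`inclTube_gen`), so it is multiplicative as soon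
as the allowed labels contain the summands of the unit and are closed under fusion. Summands of the
tensor unit have this property.

A dotted arc slides to an arc labelled by the tensor unit. Stacking a right arc around a left arc
then leaves the basic diagram with both arcs (`gen_stack_padR_padL`), which gives Φ(r ⋈ l) = r · l
and makes cutting between the arcs an inverse of Φ. Stacking in the other order leaves the middle
associator (`gen_stack_padL_padR`). The exchange rule is therefore the product l · r' rewritten
through Φ (`sum_gluing_exchange`), and (r ⋈ l)(r' ⋈ l') goes to r (l r') l'. Associativity and the
unit laws of the crossed product are pulled back along the injective map Φ.

For the coalgebra structure, Δ is multiplicative on diagrams with matching edges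
(`diagComul_stack`), so Δ(r · l) is the product of Δ(r) and Δ(l), as required by the definition on
the crossed product. The counit splits as ε(r) ε(l) because the inner closed diagram is a scalar
endomorphism of a simple strand (`endScalar_comp_comp_self`). -/

namespace DomainWall

noncomputable section

set_option linter.unusedSectionVars false

/-! ### Functoriality of the arcs and coherence of their rebracketing -/

section Coherence

variable {C D M : Type*} [Category* C] [Category* D] [Category* M]
  [MonoidalCategory C] [MonoidalCategory D] [MonoidalLeftAction C M] [MonoidalRightAction D M]

/-- The action of morphisms on the two arcs around a strand `m`. -/
def arcMap {X X' : C} {Y Y' : D} (φ : X ⟶ X') (ψ : Y ⟶ Y') (m : M) :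
    (X ⊙ₗ m) ⊙ᵣ Y ⟶ (X' ⊙ₗ m) ⊙ᵣ Y' :=
  (φ ⊵ₗ m) ⊵ᵣ Y ≫ (X' ⊙ₗ m) ⊴ᵣ ψ

@[simp]
lemma arcMap_id (X : C) (Y : D) (m : M) : arcMap (𝟙 X) (𝟙 Y) m = 𝟙 _ := by
  simp [arcMap]

lemma arcMap_comp {X X' X'' : C} {Y Y' Y'' : D} (φ : X ⟶ X') (φ' : X' ⟶ X'') (ψ : Y ⟶ Y')
    (ψ' : Y' ⟶ Y'') (m : M) :
    arcMap (φ ≫ φ') (ψ ≫ ψ') m = arcMap φ ψ m ≫ arcMap φ' ψ' m := by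
  simp only [arcMap, MonoidalLeftAction.comp_actionHomLeft,
    MonoidalRightAction.comp_actionHomLeft, MonoidalRightAction.actionHomRight_comp,
    Category.assoc, MonoidalRightAction.action_exchange_assoc]

lemma arcMap_naturality {X X' : C} {Y Y' : D} (φ : X ⟶ X') (ψ : Y ⟶ Y') {m m' : M}
    (g : m ⟶ m') :
    (X ⊴ₗ g) ⊵ᵣ Y ≫ arcMap φ ψ m' = arcMap φ ψ m ≫ (X' ⊴ₗ g) ⊵ᵣ Y' := by
  simp only [arcMap, Category.assoc, ← MonoidalRightAction.comp_actionHomLeft_assoc,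
    MonoidalLeftAction.action_exchange, MonoidalRightAction.action_exchange]

variable [BimoduleCategory C D M]

open BimoduleCategory

lemma midAssoc_inv_naturality_left {c c' : C} (f : c ⟶ c') (m : M) (d : D) :
    f ⊵ₗ (m ⊙ᵣ d) ≫ (midAssoc c' m d).inv = (midAssoc c m d).inv ≫ (f ⊵ₗ m) ⊵ᵣ d := by
  rw [Iso.comp_inv_eq, Category.assoc, Iso.eq_inv_comp]
  simpa using (midAssoc_naturality f (𝟙 m) (𝟙 d)).symm

lemma midAssoc_inv_naturality_mid (c : C) {m m' : M} (g : m ⟶ m') (d : D) :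
    c ⊴ₗ (g ⊵ᵣ d) ≫ (midAssoc c m' d).inv = (midAssoc c m d).inv ≫ (c ⊴ₗ g) ⊵ᵣ d := by
  rw [Iso.comp_inv_eq, Category.assoc, Iso.eq_inv_comp]
  simpa using (midAssoc_naturality (𝟙 c) g (𝟙 d)).symm

lemma midAssoc_inv_naturality_right (c : C) (m : M) {d d' : D} (h : d ⟶ d') :
    c ⊴ₗ (m ⊴ᵣ h) ≫ (midAssoc c m d').inv = (midAssoc c m d).inv ≫ (c ⊙ₗ m) ⊴ᵣ h := by
  rw [Iso.comp_inv_eq, Category.assoc, Iso.eq_inv_comp]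
  simpa using (midAssoc_naturality (𝟙 c) (𝟙 m) h).symm

/-- The rebracketing `X ⊙ ((X' ⊙ m) ⊙ Y') ⟶ ((X ⊗ X') ⊙ m) ⊙ Y'` for a left arc drawn around two
arcs. -/
def leftStack (X X' : C) (Y' : D) (m : M) :
    X ⊙ₗ ((X' ⊙ₗ m) ⊙ᵣ Y') ⟶ ((X ⊗ X') ⊙ₗ m) ⊙ᵣ Y' :=
  (midAssoc X (X' ⊙ₗ m) Y').inv ≫ (αₗ X X' m).inv ⊵ᵣ Y'

/-- The outer right arc enters only through the last associator of the right action. Coherence of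
`stackIso` thus splits into statements about `leftStack` and statements about the right action
alone. -/
lemma stackIso_hom_eq (X X' : C) (Y Y' : D) (m : M) :
    (stackIso X X' Y Y' m).hom = leftStack X X' Y' m ⊵ᵣ Y ≫ (αᵣ _ Y' Y).inv := by
  simp [stackIso, leftStack]

lemma leftStack_naturality_strand (X X' : C) (Y' : D) {m m' : M} (g : m ⟶ m') :
    X ⊴ₗ ((X' ⊴ₗ g) ⊵ᵣ Y') ≫ leftStack X X' Y' m' =
      leftStack X X' Y' m ≫ ((X ⊗ X') ⊴ₗ g) ⊵ᵣ Y' := by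
  simp only [leftStack, Category.assoc, reassoc_of% midAssoc_inv_naturality_mid,
    ← MonoidalRightAction.comp_actionHomLeft]
  simp

lemma leftStack_naturality_outer {X X'' : C} (φ : X ⟶ X'') (X' : C) (Y' : D) (m : M) :
    φ ⊵ₗ ((X' ⊙ₗ m) ⊙ᵣ Y') ≫ leftStack X'' X' Y' m =
      leftStack X X' Y' m ≫ ((φ ▷ X') ⊵ₗ m) ⊵ᵣ Y' := by
  simp only [leftStack, Category.assoc, reassoc_of% midAssoc_inv_naturality_left,
    ← MonoidalRightAction.comp_actionHomLeft]
  simp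

lemma leftStack_naturality_inner (X : C) {X' X'' : C} (φ : X' ⟶ X'') {Y' Y'' : D}
    (ψ : Y' ⟶ Y'') (m : M) :
    X ⊴ₗ arcMap φ ψ m ≫ leftStack X X'' Y'' m =
      leftStack X X' Y' m ≫ arcMap (X ◁ φ) ψ m := by
  have h : X ⊴ₗ (φ ⊵ₗ m) ≫ (αₗ X X'' m).inv = (αₗ X X' m).inv ≫ (X ◁ φ) ⊵ₗ m := by simp
  simp only [leftStack, arcMap, MonoidalLeftAction.actionHomRight_comp, Category.assoc,
    reassoc_of% midAssoc_inv_naturality_right, reassoc_of% midAssoc_inv_naturality_mid,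
    MonoidalRightAction.action_exchange, ← MonoidalRightAction.comp_actionHomLeft_assoc, h]

lemma actionAssoc_inv_left {m m' : M} (f : m ⟶ m') (Y Y' : D) :
    (f ⊵ᵣ Y) ⊵ᵣ Y' ≫ (αᵣ m' Y Y').inv = (αᵣ m Y Y').inv ≫ f ⊵ᵣ (Y ⊗ Y') := by
  simp

lemma actionAssoc_inv_mid (m : M) {Y Y'' : D} (ψ : Y ⟶ Y'') (Y' : D) :
    (m ⊴ᵣ ψ) ⊵ᵣ Y' ≫ (αᵣ m Y'' Y').inv = (αᵣ m Y Y').inv ≫ m ⊴ᵣ (ψ ▷ Y') := by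
  simp

lemma actionAssoc_inv_right (m : M) (Y : D) {Y' Y'' : D} (ψ : Y' ⟶ Y'') :
    (m ⊙ᵣ Y) ⊴ᵣ ψ ≫ (αᵣ m Y Y'').inv = (αᵣ m Y Y').inv ≫ m ⊴ᵣ (Y ◁ ψ) := by
  simp

lemma stackIso_naturality_strand (X X' : C) (Y Y' : D) {m m' : M} (g : m ⟶ m') :
    (X ⊴ₗ ((X' ⊴ₗ g) ⊵ᵣ Y')) ⊵ᵣ Y ≫ (stackIso X X' Y Y' m').hom =
      (stackIso X X' Y Y' m).hom ≫ ((X ⊗ X') ⊴ₗ g) ⊵ᵣ (Y' ⊗ Y) := by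
  rw [stackIso_hom_eq, stackIso_hom_eq, ← MonoidalRightAction.comp_actionHomLeft_assoc,
    leftStack_naturality_strand, MonoidalRightAction.comp_actionHomLeft_assoc,
    actionAssoc_inv_left, Category.assoc]

lemma stackIso_naturality_inner {X' X'' : C} {Y' Y'' : D} (X : C) (Y : D) (φ : X' ⟶ X'')
    (ψ : Y' ⟶ Y'') (m : M) :
    (X ⊴ₗ arcMap φ ψ m) ⊵ᵣ Y ≫ (stackIso X X'' Y Y'' m).hom =
      (stackIso X X' Y Y' m).hom ≫ arcMap (X ◁ φ) (ψ ▷ Y) m := by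
  rw [stackIso_hom_eq, stackIso_hom_eq, ← MonoidalRightAction.comp_actionHomLeft_assoc,
    leftStack_naturality_inner]
  simp only [arcMap, MonoidalRightAction.comp_actionHomLeft, Category.assoc,
    reassoc_of% actionAssoc_inv_left, actionAssoc_inv_mid]

lemma stackIso_naturality_outer {X X'' : C} {Y Y'' : D} (X' : C) (Y' : D) (φ : X ⟶ X'')
    (ψ : Y ⟶ Y'') (m : M) :
    arcMap φ ψ ((X' ⊙ₗ m) ⊙ᵣ Y') ≫ (stackIso X'' X' Y'' Y' m).hom =
      (stackIso X X' Y Y' m).hom ≫ arcMap (φ ▷ X') (Y' ◁ ψ) m := by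
  rw [stackIso_hom_eq, stackIso_hom_eq, arcMap, arcMap, Category.assoc,
    MonoidalRightAction.action_exchange_assoc, ← MonoidalRightAction.comp_actionHomLeft_assoc,
    leftStack_naturality_outer, MonoidalRightAction.comp_actionHomLeft_assoc,
    actionAssoc_inv_right, reassoc_of% actionAssoc_inv_left, Category.assoc]

/-- Three nested left arcs with one right arc: `pentagon_left` carries the right arc past two left
arcs, and the pentagon of the left action rebrackets what remains. -/
lemma leftStack_assoc_left (X X' X'' : C) (Y : D) (m : M) :
    (αₗ X X' ((X'' ⊙ₗ m) ⊙ᵣ Y)).inv ≫ leftStack (X ⊗ X') X'' Y m ≫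
        ((α_ X X' X'').hom ⊵ₗ m) ⊵ᵣ Y =
      X ⊴ₗ leftStack X' X'' Y m ≫ leftStack X (X' ⊗ X'') Y m := by
  -- The mixed pentagon `pentagon_left`, with the middle associators inverted.
  have h : X ⊴ₗ (midAssoc X' (X'' ⊙ₗ m) Y).inv ≫ (midAssoc X (X' ⊙ₗ X'' ⊙ₗ m) Y).inv =
      (αₗ X X' _).inv ≫ (midAssoc (X ⊗ X') (X'' ⊙ₗ m) Y).inv ≫
        (αₗ X X' (X'' ⊙ₗ m)).hom ⊵ᵣ Y := by
    rw [← cancel_mono (midAssoc X (X' ⊙ₗ X'' ⊙ₗ m) Y).hom,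
      ← cancel_mono (X ⊴ₗ (midAssoc X' (X'' ⊙ₗ m) Y).hom)]
    simp [pentagon_left]
  -- The pentagon of the left action, solved for the associator of the arcs.
  have h' : (αₗ X X' (X'' ⊙ₗ m)).hom ≫ X ⊴ₗ (αₗ X' X'' m).inv ≫ (αₗ X (X' ⊗ X'') m).inv =
      (αₗ (X ⊗ X') X'' m).inv ≫ (α_ X X' X'').hom ⊵ₗ m := by
    rw [Iso.eq_inv_comp, ← cancel_mono (αₗ X (X' ⊗ X'') m).hom,
      ← cancel_mono (X ⊴ₗ (αₗ X' X'' m).hom)]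
    simp
  simp only [leftStack, MonoidalLeftAction.actionHomRight_comp, Category.assoc,
    reassoc_of% midAssoc_inv_naturality_mid]
  rw [reassoc_of% h]
  simp only [← MonoidalRightAction.comp_actionHomLeft, h']

/-- This is `pentagon_right`: passing a left arc inside a fused pair of right arcs is passing it
inside each of them in turn. -/
lemma leftStack_assoc_right (X X' : C) (Y Y' : D) (m : M) :
    X ⊴ₗ (αᵣ (X' ⊙ₗ m) Y Y').inv ≫ leftStack X X' (Y ⊗ Y') m =
      (midAssoc X ((X' ⊙ₗ m) ⊙ᵣ Y) Y').inv ≫ leftStack X X' Y m ⊵ᵣ Y' ≫ (αᵣ _ Y Y').inv := by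
  have h : X ⊴ₗ (αᵣ (X' ⊙ₗ m) Y Y').inv ≫ (midAssoc X (X' ⊙ₗ m) (Y ⊗ Y')).inv =
      (midAssoc X ((X' ⊙ₗ m) ⊙ᵣ Y) Y').inv ≫ (midAssoc X (X' ⊙ₗ m) Y).inv ⊵ᵣ Y' ≫
        (αᵣ _ Y Y').inv := by
    rw [← cancel_mono (midAssoc X (X' ⊙ₗ m) (Y ⊗ Y')).hom,
      ← cancel_mono (X ⊴ₗ (αᵣ (X' ⊙ₗ m) Y Y').hom)]
    simp [pentagon_right]
  simp only [leftStack, reassoc_of% h, MonoidalRightAction.comp_actionHomLeft, Category.assoc,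
    actionAssoc_inv_left]

/-- The coherence behind associativity. All right-action associators are moved to the end, where
they agree by the pentagon `h`. The remaining comparison lies under the outermost right arc and is
`leftStack_assoc_right` followed by `leftStack_assoc_left`. Right arcs fuse in the reverse order,
hence the inverse associator on that side. -/
lemma stackIso_assoc (X X' X'' : C) (Y Y' Y'' : D) (m : M) :
    (stackIso X X' Y Y' ((X'' ⊙ₗ m) ⊙ᵣ Y'')).hom ≫ (stackIso (X ⊗ X') X'' (Y' ⊗ Y) Y'' m).hom ≫
        arcMap (α_ X X' X'').hom (α_ Y'' Y' Y).inv m =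
      (X ⊴ₗ (stackIso X' X'' Y' Y'' m).hom) ⊵ᵣ Y ≫
        (stackIso X (X' ⊗ X'') Y (Y'' ⊗ Y') m).hom := by
  have h (z : M) : (αᵣ (z ⊙ᵣ Y'') Y' Y).inv ≫ (αᵣ z Y'' (Y' ⊗ Y)).inv ≫ z ⊴ᵣ (α_ Y'' Y' Y).inv =
      (αᵣ z Y'' Y').inv ⊵ᵣ Y ≫ (αᵣ z (Y'' ⊗ Y') Y).inv := by
    rw [← IsIso.inv_eq_inv]
    simp
  simp only [stackIso_hom_eq, arcMap, Category.assoc]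
  rw [← reassoc_of% actionAssoc_inv_left, ← reassoc_of% actionAssoc_inv_left,
    ← reassoc_of% actionAssoc_inv_left, h]
  simp only [← MonoidalRightAction.comp_actionHomLeft_assoc,
    MonoidalLeftAction.actionHomRight_comp, Category.assoc, leftStack_assoc_right]
  congr 2
  simp only [← MonoidalRightAction.comp_actionHomLeft_assoc,
    reassoc_of% midAssoc_inv_naturality_mid, ← leftStack_assoc_left]
  simp only [leftStack, Category.assoc, MonoidalRightAction.comp_actionHomLeft]

lemma stackIso_arcMap {X X' X'' : C} {Y Y' Y'' : D} (φ : X ⊗ X' ⟶ X'') (ψ : Y' ⊗ Y ⟶ Y'') (m : M) :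
    (stackIso X X' Y Y' m).hom ≫ arcMap φ ψ m =
      (leftStack X X' Y' m ≫ (φ ⊵ₗ m) ⊵ᵣ Y') ⊵ᵣ Y ≫ (αᵣ _ Y' Y).inv ≫ (X'' ⊙ₗ m) ⊴ᵣ ψ := by
  rw [stackIso_hom_eq, arcMap, Category.assoc, ← reassoc_of% actionAssoc_inv_left,
    MonoidalRightAction.comp_actionHomLeft_assoc]

lemma leftStack_unit_left (X : C) (Y : D) (m : M) :
    leftStack (𝟙_ C) X Y m ≫ ((λ_ X).hom ⊵ₗ m) ⊵ᵣ Y = (λₗ[C] _).hom := by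
  simp only [leftStack, Category.assoc, ← MonoidalRightAction.comp_actionHomLeft,
    MonoidalLeftAction.leftUnitor_actionHom, Iso.inv_hom_id_assoc, ← triangle_left]

lemma leftStack_unit_right (X : C) (Y : D) (m : M) :
    leftStack X (𝟙_ C) Y m ≫ ((ρ_ X).hom ⊵ₗ m) ⊵ᵣ Y =
      X ⊴ₗ ((λₗ[C] m).hom ⊵ᵣ Y) ≫ (midAssoc X m Y).inv := by
  simp only [leftStack, Category.assoc, ← MonoidalRightAction.comp_actionHomLeft,
    MonoidalLeftAction.rightUnitor_actionHom, Iso.inv_hom_id_assoc, midAssoc_inv_naturality_mid]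

lemma actionAssoc_inv_rightUnitor (m : M) (Y : D) :
    (αᵣ m Y (𝟙_ D)).inv ≫ m ⊴ᵣ (ρ_ Y).hom = (ρᵣ[D] (m ⊙ᵣ Y)).hom := by
  simp

lemma actionAssoc_inv_leftUnitor (m : M) (Y : D) :
    (αᵣ m (𝟙_ D) Y).inv ≫ m ⊴ᵣ (λ_ Y).hom = (ρᵣ[D] m).hom ⊵ᵣ Y := by
  simp

lemma midAssoc_inv_unit_right (X : C) (m : M) :
    (midAssoc X m (𝟙_ D)).inv ≫ (ρᵣ[D] (X ⊙ₗ m)).hom = X ⊴ₗ (ρᵣ[D] m).hom := by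
  rw [← triangle_right, Iso.inv_hom_id_assoc]

lemma stackIso_unit_left (X : C) (Y : D) (m : M) :
    (stackIso (𝟙_ C) X (𝟙_ D) Y m).hom ≫ arcMap (λ_ X).hom (ρ_ Y).hom m =
      (ρᵣ[D] _).hom ≫ (λₗ[C] _).hom := by
  rw [stackIso_arcMap, leftStack_unit_left, actionAssoc_inv_rightUnitor,
    MonoidalRightAction.actionUnitIso_hom_naturality]

lemma stackIso_unit_right (X : C) (Y : D) (m : M) :
    (stackIso X (𝟙_ C) Y (𝟙_ D) m).hom ≫ arcMap (ρ_ X).hom (λ_ Y).hom m =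
      (X ⊴ₗ ((ρᵣ[D] _).hom ≫ (λₗ[C] m).hom)) ⊵ᵣ Y := by
  rw [stackIso_arcMap, leftStack_unit_right, actionAssoc_inv_leftUnitor,
    ← MonoidalRightAction.comp_actionHomLeft, Category.assoc, midAssoc_inv_unit_right,
    ← MonoidalLeftAction.actionHomRight_comp, MonoidalRightAction.actionUnitIso_hom_naturality]

/-- A right arc around a left arc, with unit arcs removed: the middle associator cancels by
`triangle_left`. This is why gluing gives basic tube diagrams without any correction. -/
lemma stackIso_right_left (X : C) (Y : D) (m : M) :
    (stackIso (𝟙_ C) X Y (𝟙_ D) m).hom ≫ arcMap (λ_ X).hom (λ_ Y).hom m =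
      ((λₗ[C] _).hom ≫ (ρᵣ[D] _).hom) ⊵ᵣ Y := by
  rw [stackIso_arcMap, leftStack_unit_left, actionAssoc_inv_leftUnitor,
    MonoidalRightAction.comp_actionHomLeft]

/-- In the opposite nesting the middle associator survives; it is the one in the exchange rule. -/
lemma stackIso_left_right (X : C) (Y : D) (m : M) :
    (stackIso X (𝟙_ C) (𝟙_ D) Y m).hom ≫ arcMap (ρ_ X).hom (ρ_ Y).hom m =
      (ρᵣ[D] _).hom ≫ X ⊴ₗ ((λₗ[C] m).hom ⊵ᵣ Y) ≫ (midAssoc X m Y).inv := by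
  rw [stackIso_arcMap, leftStack_unit_right, actionAssoc_inv_rightUnitor,
    MonoidalRightAction.actionUnitIso_hom_naturality]

end Coherence

/-! ### Sums over decompositions into simple objects -/

section Slide

variable {C : Type*} [Category* C] [Abelian C]

instance Irr.simple_rep (a : Irr C) : Simple a.rep := (Quotient.out a).2

lemma Irr.eq_of_iso {a b : Irr C} (i : a.rep ≅ b.rep) : a = b := by
  rw [← Quotient.out_eq a, ← Quotient.out_eq b]
  exact Quotient.sound ⟨i⟩

lemma Irr.hom_eq_zero {a b : Irr C} (h : a ≠ b) (f : a.rep ⟶ b.rep) : f = 0 := by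
  by_contra hf
  have := isIso_of_hom_simple hf
  exact h (Irr.eq_of_iso (asIso f))

/-- The decomposition of a chosen simple object with one summand. -/
def SimpleDecomp.ofRep (a : Irr C) : SimpleDecomp a.rep where
  n := 1
  s _ := a
  incl _ := 𝟙 _
  proj _ := 𝟙 _
  incl_proj_self _ := by simp
  incl_proj_ne k l h := (h (Subsingleton.elim k l)).elim
  sum_proj_incl := by simp

/-- All simple summands of `X` have their labels in `A`. -/
def LabelsIn (A : Finset (Irr C)) (X : C) : Prop :=
  ∀ (a : Irr C) (x : a.rep ⟶ X) (y : X ⟶ a.rep), x ≫ y = 𝟙 a.rep → a ∈ A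

lemma LabelsIn.of_retract {A : Finset (Irr C)} {X X' : C} (h : LabelsIn A X) (i : X' ⟶ X)
    (r : X ⟶ X')
    (hir : i ≫ r = 𝟙 X') : LabelsIn A X' :=
  fun a x y hxy => h a (x ≫ i) (r ≫ y) (by simp [reassoc_of% hir, hxy])

lemma labelsIn_rep {A : Finset (Irr C)} {a : Irr C} (ha : a ∈ A) : LabelsIn A a.rep := by
  intro b x y hxy
  by_cases h : b = a
  · exact h ▸ ha
  · rw [Irr.hom_eq_zero h x, Limits.zero_comp] at hxy
    exact (id_nonzero b.rep hxy.symm).elim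

variable [Linear ℂ C] [IsFiniteSemisimple C]

lemma labelsIn_univ (X : C) : LabelsIn (allLabels C) X := fun _ _ _ _ => Finset.mem_univ _

lemma Irr.exists_smul_id {a : Irr C} (f : a.rep ⟶ a.rep) : ∃ r : ℂ, f = r • 𝟙 a.rep := by
  have := IsFiniteSemisimple.finiteDimensional_hom a.rep a.rep
  obtain ⟨r, hr⟩ := endomorphism_simple_eq_smul_id ℂ f
  exact ⟨r, hr.symm⟩

variable {V : Type*} [AddCommGroup V] [Module ℂ V] {X X' : C}

/-- Morphisms between chosen simple objects can be moved across a family of bilinear maps. -/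
lemma slide_rep (G : ∀ a : Irr C, (X ⟶ a.rep) →ₗ[ℂ] (a.rep ⟶ X') →ₗ[ℂ] V) {a b : Irr C}
    (α : X ⟶ a.rep) (θ : a.rep ⟶ b.rep) (β : b.rep ⟶ X') :
    G a α (θ ≫ β) = G b (α ≫ θ) β := by
  by_cases h : a = b
  · subst h
    obtain ⟨r, rfl⟩ := Irr.exists_smul_id θ
    simp
  · simp [Irr.hom_eq_zero h θ]

/-- A morphism `φ` can be moved from one side of a sum over a decomposition of its source to the
other side of the sum over a decomposition of its target. -/
lemma SimpleDecomp.sum_slide (δ : SimpleDecomp X) (δ' : SimpleDecomp X') (φ : X ⟶ X')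
    (G : ∀ a : Irr C, (X ⟶ a.rep) →ₗ[ℂ] (a.rep ⟶ X') →ₗ[ℂ] V) :
    ∑ k, G (δ.s k) (δ.proj k) (δ.incl k ≫ φ) = ∑ k, G (δ'.s k) (φ ≫ δ'.proj k) (δ'.incl k) := by
  -- Both sides are written through the matrix entries of `φ` between simple summands. Each entry is
  -- a scalar or zero by Schur's lemma, so `slide_rep` can carry it across.
  have h₁ (k) : δ.incl k ≫ φ = ∑ l, (δ.incl k ≫ φ ≫ δ'.proj l) ≫ δ'.incl l := by
    simp only [Category.assoc, ← Preadditive.comp_sum, δ'.sum_proj_incl, Category.comp_id]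
  have h₂ (l) : φ ≫ δ'.proj l = ∑ k, δ.proj k ≫ (δ.incl k ≫ φ ≫ δ'.proj l) := by
    simp only [← Category.assoc (δ.proj _), ← Preadditive.sum_comp, δ.sum_proj_incl,
      Category.id_comp]
  calc
    _ = ∑ k, ∑ l, G (δ.s k) (δ.proj k) ((δ.incl k ≫ φ ≫ δ'.proj l) ≫ δ'.incl l) := by
      refine Finset.sum_congr rfl fun k _ => ?_
      rw [← map_sum, ← h₁]
    _ = ∑ k, ∑ l, G (δ'.s l) (δ.proj k ≫ (δ.incl k ≫ φ ≫ δ'.proj l)) (δ'.incl l) := by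
      simp only [slide_rep]
    _ = _ := by
      rw [Finset.sum_comm]
      refine Finset.sum_congr rfl fun l _ => ?_
      rw [← LinearMap.sum_apply, ← map_sum, ← h₂]

lemma sum_dec_slide (φ : X ⟶ X')
    (G : ∀ a : Irr C, (X ⟶ a.rep) →ₗ[ℂ] (a.rep ⟶ X') →ₗ[ℂ] V) :
    ∑ k, G ((dec X).s k) ((dec X).proj k) ((dec X).incl k ≫ φ) =
      ∑ k, G ((dec X').s k) (φ ≫ (dec X').proj k) ((dec X').incl k) :=
  SimpleDecomp.sum_slide _ _ _ _

/-- A simple source admits the decomposition with a single summand, so sliding `φ` to the other side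
leaves one term. -/
lemma sum_dec_of_rep_hom {a : Irr C} (φ : a.rep ⟶ X)
    (G : ∀ d : Irr C, (a.rep ⟶ d.rep) →ₗ[ℂ] (d.rep ⟶ X) →ₗ[ℂ] V) :
    ∑ k, G ((dec X).s k) (φ ≫ (dec X).proj k) ((dec X).incl k) = G a (𝟙 _) φ := by
  rw [← SimpleDecomp.sum_slide (SimpleDecomp.ofRep a) (dec X) φ G]
  exact (Fin.sum_univ_one fun _ : Fin 1 => G a (𝟙 _) (𝟙 _ ≫ φ)).trans (by simp)

lemma sum_dec_of_hom_rep {a : Irr C} (φ : X ⟶ a.rep)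
    (G : ∀ d : Irr C, (X ⟶ d.rep) →ₗ[ℂ] (d.rep ⟶ a.rep) →ₗ[ℂ] V) :
    ∑ k, G ((dec X).s k) ((dec X).proj k) ((dec X).incl k ≫ φ) = G a φ (𝟙 _) := by
  rw [SimpleDecomp.sum_slide (dec X) (SimpleDecomp.ofRep a) φ G]
  exact (Fin.sum_univ_one fun _ : Fin 1 => G a (φ ≫ 𝟙 _) (𝟙 _)).trans (by simp)

lemma sum_dec_rep {a : Irr C}
    (G : ∀ d : Irr C, (a.rep ⟶ d.rep) →ₗ[ℂ] (d.rep ⟶ a.rep) →ₗ[ℂ] V) :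
    ∑ k, G ((dec a.rep).s k) ((dec a.rep).proj k) ((dec a.rep).incl k) = G a (𝟙 _) (𝟙 _) := by
  simpa using sum_dec_of_rep_hom (𝟙 a.rep) G

lemma LabelsIn.mem {A : Finset (Irr C)} (h : LabelsIn A X) (k) : (dec X).s k ∈ A :=
  h _ _ _ ((dec X).incl_proj_self k)

variable [MonoidalCategory C]

lemma unitIncl_unitProj (i : unitLabels C) : unitIncl i ≫ unitProj i = 𝟙 i.1.rep :=
  (unitLabels_spec i).choose_spec.choose_spec

lemma labelsIn_unit : LabelsIn (unitLabels C) (𝟙_ C) := fun a x y h => by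
  classical
  simp only [unitLabels, Finset.mem_filter]
  exact ⟨Finset.mem_univ _, x, y, h⟩

/-- Sets of labels that contain the summands of the unit and are closed under fusion. -/
structure FusionClosed (A : Finset (Irr C)) : Prop where
  unit : LabelsIn A (𝟙_ C)
  tensor : ∀ a ∈ A, ∀ b ∈ A, LabelsIn A (a.rep ⊗ b.rep)

variable (C) in
lemma fusionClosed_allLabels : FusionClosed (allLabels C) :=
  ⟨labelsIn_univ _, fun _ _ _ _ => labelsIn_univ _⟩

variable (C) in
-- If two objects are retracts of the tensor unit, their tensor product is a retract of `𝟙 ⊗ 𝟙 ≅ 𝟙`.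
lemma fusionClosed_unitLabels : FusionClosed (unitLabels C) := by
  refine ⟨labelsIn_unit, fun a ha b hb => ?_⟩
  refine labelsIn_unit.of_retract
    ((unitIncl ⟨a, ha⟩ ⊗ₘ unitIncl ⟨b, hb⟩) ≫ (λ_ _).hom)
    ((λ_ _).inv ≫ (unitProj ⟨a, ha⟩ ⊗ₘ unitProj ⟨b, hb⟩)) ?_
  simp [MonoidalCategory.tensorHom_comp_tensorHom, unitIncl_unitProj]

end Slide

/-! ### Expansion of diagrams into basic tube diagrams -/

section Expand

variable {C D M : Type*} [Category* C] [Abelian C] [Linear ℂ C] [MonoidalCategory C]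
  [Category* D] [Abelian D] [Linear ℂ D] [MonoidalCategory D]
  [Category* M] [Abelian M] [Linear ℂ M]
  [MonoidalLeftAction C M] [MonoidalRightAction D M]
  [LinearLeftAction C M] [LinearRightAction D M]

section Linearity

variable {X X' : C} {Y Y' : D} (m : M)

@[simp]
lemma arcMap_add_left (φ φ' : X ⟶ X') (ψ : Y ⟶ Y') :
    arcMap (φ + φ') ψ m = arcMap φ ψ m + arcMap φ' ψ m := by
  simp [arcMap, LinearLeftAction.add_actionHomLeft, LinearRightAction.add_actionHomLeft]

@[simp]
lemma arcMap_smul_left (r : ℂ) (φ : X ⟶ X') (ψ : Y ⟶ Y') :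
    arcMap (r • φ) ψ m = r • arcMap φ ψ m := by
  simp [arcMap, LinearLeftAction.smul_actionHomLeft, LinearRightAction.smul_actionHomLeft]

@[simp]
lemma arcMap_add_right (φ : X ⟶ X') (ψ ψ' : Y ⟶ Y') :
    arcMap φ (ψ + ψ') m = arcMap φ ψ m + arcMap φ ψ' m := by
  simp [arcMap, LinearRightAction.actionHomRight_add]

@[simp]
lemma arcMap_smul_right (r : ℂ) (φ : X ⟶ X') (ψ : Y ⟶ Y') :
    arcMap φ (r • ψ) m = r • arcMap φ ψ m := by
  simp [arcMap, LinearRightAction.actionHomRight_smul]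

lemma arcMap_sum_left {ι : Type*} (s : Finset ι) (φ : ι → (X ⟶ X')) (ψ : Y ⟶ Y') :
    arcMap (∑ i ∈ s, φ i) ψ m = ∑ i ∈ s, arcMap (φ i) ψ m :=
  map_sum (IsLinearMap.mk' (R := ℂ) (fun φ => arcMap φ ψ m)
    ⟨fun φ φ' => arcMap_add_left m φ φ' ψ, fun r φ => arcMap_smul_left m r φ ψ⟩) φ s

lemma arcMap_sum_right {ι : Type*} (s : Finset ι) (φ : X ⟶ X') (ψ : ι → (Y ⟶ Y')) :
    arcMap φ (∑ i ∈ s, ψ i) m = ∑ i ∈ s, arcMap φ (ψ i) m :=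
  map_sum (IsLinearMap.mk' (R := ℂ) (fun ψ => arcMap φ ψ m)
    ⟨fun ψ ψ' => arcMap_add_right m φ ψ ψ', fun r ψ => arcMap_smul_right m r φ ψ⟩) ψ s

lemma whisker_sum {ι : Type*} (s : Finset ι) {m m' : M} (g : ι → (m ⟶ m')) (Y : D) :
    (∑ i ∈ s, g i) ⊵ᵣ Y = ∑ i ∈ s, g i ⊵ᵣ Y :=
  map_sum (IsLinearMap.mk' (R := ℂ) (fun g : m ⟶ m' => g ⊵ᵣ Y)
    ⟨fun g g' => LinearRightAction.add_actionHomLeft g g' Y,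
      fun r g => LinearRightAction.smul_actionHomLeft r g Y⟩) g s

end Linearity

@[simp]
lemma assemble_tmul (a : C) (b : D) {c d e f g h : M} (μ : c ⟶ d ⊙ᵣ b) (ν : d ⟶ a ⊙ₗ e)
    (γ : g ⊙ᵣ b ⟶ h) (ζ : a ⊙ₗ f ⟶ g) :
    assemble a b c d e f g h ((μ ⊗ₜ ν) ⊗ₜ (γ ⊗ₜ ζ)) = (μ ≫ ν ⊵ᵣ b) ⊗ₜ (ζ ⊵ᵣ b ≫ γ) := rfl

variable [IsFiniteSemisimple C] [IsFiniteSemisimple D] [IsFiniteSemisimple M]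
variable (A : Finset (Irr C)) (B : Finset (Irr D))

/-- The expansion of a diagram with simple objects on the arcs, which decomposes only `a ⊙ e` and
`a ⊙ f`. -/
def expandSimple (a : Irr C) (b : Irr D) (c h e f : Irr M) :
    Diag a.rep b.rep c.rep e.rep f.rep h.rep →ₗ[ℂ] TubeComp M A B c h e f :=
  if hab : a ∈ A ∧ b ∈ B then
    ∑ p : Fin (dec (a.rep ⊙ₗ e.rep)).n, ∑ q : Fin (dec (a.rep ⊙ₗ f.rep)).n,
      cellEmb A B c h e f (⟨a, hab.1⟩, ⟨b, hab.2⟩, (dec (a.rep ⊙ₗ e.rep)).s p,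
          (dec (a.rep ⊙ₗ f.rep)).s q) ∘ₗ
        TensorProduct.map
          ((TensorProduct.mk ℂ _ _).flip ((dec (a.rep ⊙ₗ e.rep)).incl p) ∘ₗ
            Linear.rightComp ℂ c.rep ((dec (a.rep ⊙ₗ e.rep)).proj p ⊵ᵣ b.rep))
          ((TensorProduct.mk ℂ _ _).flip ((dec (a.rep ⊙ₗ f.rep)).proj q) ∘ₗ
            Linear.leftComp ℂ h.rep ((dec (a.rep ⊙ₗ f.rep)).incl q ⊵ᵣ b.rep))
  else 0

variable {A B}

lemma expandSimple_tmul {a : Irr C} {b : Irr D} (ha : a ∈ A) (hb : b ∈ B) {c h e f : Irr M}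
    (u : c.rep ⟶ (a.rep ⊙ₗ e.rep) ⊙ᵣ b.rep) (v : (a.rep ⊙ₗ f.rep) ⊙ᵣ b.rep ⟶ h.rep) :
    expandSimple A B a b c h e f (u ⊗ₜ v) =
      ∑ p, ∑ q, cellEmb A B c h e f (⟨a, ha⟩, ⟨b, hb⟩, (dec (a.rep ⊙ₗ e.rep)).s p,
          (dec (a.rep ⊙ₗ f.rep)).s q)
        (((u ≫ (dec (a.rep ⊙ₗ e.rep)).proj p ⊵ᵣ b.rep) ⊗ₜ (dec (a.rep ⊙ₗ e.rep)).incl p) ⊗ₜ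
          (((dec (a.rep ⊙ₗ f.rep)).incl q ⊵ᵣ b.rep ≫ v) ⊗ₜ (dec (a.rep ⊙ₗ f.rep)).proj q)) := by
  rw [expandSimple, dif_pos ⟨ha, hb⟩]
  simp only [LinearMap.sum_apply]
  rfl

variable (A B) in
-- Separates the resolution of the arcs, which is expressed by `arcMap` and is the only part
-- affected by sliding, from the resolution of the strands.
lemma expand_tmul (X : C) (Y : D) {c h e f : Irr M}
    (u : c.rep ⟶ (X ⊙ₗ e.rep) ⊙ᵣ Y) (v : (X ⊙ₗ f.rep) ⊙ᵣ Y ⟶ h.rep) :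
    expand A B X Y c h e f (u ⊗ₜ v) =
      ∑ k, ∑ l, expandSimple A B ((dec X).s k) ((dec Y).s l) c h e f
        ((u ≫ arcMap ((dec X).proj k) ((dec Y).proj l) e.rep) ⊗ₜ
          (arcMap ((dec X).incl k) ((dec Y).incl l) f.rep ≫ v)) := by
  simp only [expand, LinearMap.sum_apply]
  refine Finset.sum_congr rfl fun k _ => Finset.sum_congr rfl fun l _ => ?_
  by_cases hkl : (dec X).s k ∈ A ∧ (dec Y).s l ∈ B
  · rw [dif_pos hkl, expandSimple_tmul hkl.1 hkl.2]
    simp only [LinearMap.sum_apply]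
    refine Finset.sum_congr rfl fun p _ => Finset.sum_congr rfl fun q _ => ?_
    simp only [LinearMap.comp_apply, TensorProduct.map_tmul, LinearMap.flip_apply,
      TensorProduct.mk_apply, Linear.rightComp_apply, Linear.leftComp_apply, Category.assoc,
      arcMap]
    rw [MonoidalRightAction.action_exchange_assoc (f := (dec X).incl k ⊵ₗ f.rep)]
  · rw [dif_neg hkl, expandSimple, dif_neg hkl, LinearMap.zero_apply, LinearMap.zero_apply]

variable (A B) in
/-- Morphisms can be moved along the arcs from the upper strand to the lower strand. -/
lemma expand_slide {X X' : C} {Y Y' : D} (φ : X ⟶ X') (ψ : Y ⟶ Y') {c h e f : Irr M}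
    (u : c.rep ⟶ (X ⊙ₗ e.rep) ⊙ᵣ Y) (v : (X' ⊙ₗ f.rep) ⊙ᵣ Y' ⟶ h.rep) :
    expand A B X Y c h e f (u ⊗ₜ (arcMap φ ψ f.rep ≫ v)) =
      expand A B X' Y' c h e f ((u ≫ arcMap φ ψ e.rep) ⊗ₜ v) := by
  simp only [expand_tmul, Category.assoc, ← arcMap_comp, ← reassoc_of% arcMap_comp]
  -- The left arc is treated first, with the whole sum over the right arc as the bilinear family;
  -- the right arc follows with the left label fixed.
  have h₁ := sum_dec_slide (V := TubeComp M A B c h e f) φ fun a => LinearMap.mk₂ ℂ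
    (fun (α : X ⟶ a.rep) (β : a.rep ⟶ X') =>
      ∑ l, expandSimple A B a ((dec Y).s l) c h e f
        ((u ≫ arcMap α ((dec Y).proj l) e.rep) ⊗ₜ
          (arcMap β ((dec Y).incl l ≫ ψ) f.rep ≫ v)))
    (by intros; simp [add_tmul, Finset.sum_add_distrib])
    (by intros; simp [← smul_tmul', Finset.smul_sum])
    (by intros; simp [tmul_add, Finset.sum_add_distrib])
    (by intros; simp [tmul_smul, Finset.smul_sum])
  simp only [LinearMap.mk₂_apply] at h₁
  rw [h₁]
  refine Finset.sum_congr rfl fun k _ => ?_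
  exact sum_dec_slide (V := TubeComp M A B c h e f) ψ fun b => LinearMap.mk₂ ℂ
    (fun (α : Y ⟶ b.rep) (β : b.rep ⟶ Y') =>
      expandSimple A B ((dec X').s k) b c h e f
        ((u ≫ arcMap (φ ≫ (dec X').proj k) α e.rep) ⊗ₜ
          (arcMap ((dec X').incl k) β f.rep ≫ v)))
    (by intros; simp [add_tmul]) (by intros; simp [← smul_tmul'])
    (by intros; simp [tmul_add]) (by intros; simp [tmul_smul])

/-- The decomposition chosen for a simple object need not be the trivial one, but the sums do not
depend on the choice. -/
lemma expand_rep (a : Irr C) (b : Irr D) {c h e f : Irr M}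
    (x : Diag a.rep b.rep c.rep e.rep f.rep h.rep) :
    expand A B a.rep b.rep c h e f x = expandSimple A B a b c h e f x := by
  induction x using TensorProduct.induction_on with
  | zero => simp
  | add x y hx hy => simp [hx, hy]
  | tmul u v =>
    rw [expand_tmul]
    have h₁ := sum_dec_rep (V := TubeComp M A B c h e f) (a := a) fun a' => LinearMap.mk₂ ℂ
      (fun (α : a.rep ⟶ a'.rep) (β : a'.rep ⟶ a.rep) =>
        ∑ l, expandSimple A B a' ((dec b.rep).s l) c h e f
          ((u ≫ arcMap α ((dec b.rep).proj l) e.rep) ⊗ₜ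
            (arcMap β ((dec b.rep).incl l) f.rep ≫ v)))
      (by intros; simp [add_tmul, Finset.sum_add_distrib])
      (by intros; simp [← smul_tmul', Finset.smul_sum])
      (by intros; simp [tmul_add, Finset.sum_add_distrib])
      (by intros; simp [tmul_smul, Finset.smul_sum])
    have h₂ := sum_dec_rep (V := TubeComp M A B c h e f) (a := b) fun b' => LinearMap.mk₂ ℂ
      (fun (α : b.rep ⟶ b'.rep) (β : b'.rep ⟶ b.rep) =>
        expandSimple A B a b' c h e f
          ((u ≫ arcMap (𝟙 a.rep) α e.rep) ⊗ₜ (arcMap (𝟙 a.rep) β f.rep ≫ v)))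
      (by intros; simp [add_tmul]) (by intros; simp [← smul_tmul'])
      (by intros; simp [tmul_add]) (by intros; simp [tmul_smul])
    simp only [LinearMap.mk₂_apply] at h₁ h₂
    rw [h₁, h₂]
    simp

/-- The arcs are already simple, so only the strands are decomposed. The vertex `ν` starts at a
simple object and `ζ` ends at one, so each sum over summands collapses to the original intermediate
edge. -/
lemma expand_assemble {c h e f : Irr M} (t : A × B × Irr M × Irr M)
    (z : Cell t.1.1.rep t.2.1.1.rep c.rep t.2.2.1.rep e.rep f.rep t.2.2.2.rep h.rep) :
    expand A B t.1.1.rep t.2.1.1.rep c h e f (assemble _ _ _ _ _ _ _ _ z) =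
      cellEmb A B c h e f t z := by
  obtain ⟨⟨a, ha⟩, ⟨b, hb⟩, d, g⟩ := t
  induction z using TensorProduct.induction_on with
  | zero => simp
  | add x y hx hy => rw [map_add, map_add, map_add, hx, hy]
  | tmul x y =>
    induction x using TensorProduct.induction_on with
    | zero => simp
    | add x x' hx hx' => rw [add_tmul, map_add, map_add, map_add, hx, hx']
    | tmul μ ν =>
      induction y using TensorProduct.induction_on with
      | zero => simp
      | add x x' hx hx' => rw [tmul_add, map_add, map_add, map_add, hx, hx']
      | tmul γ ζ =>
        rw [assemble_tmul, expand_rep, expandSimple_tmul ha hb]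
        simp only [Category.assoc, ← MonoidalRightAction.comp_actionHomLeft,
          ← MonoidalRightAction.comp_actionHomLeft_assoc]
        have h₁ := sum_dec_of_rep_hom (V := TubeComp M A B c h e f) ν fun d' => LinearMap.mk₂ ℂ
          (fun (α : d.rep ⟶ d'.rep) (β : d'.rep ⟶ a.rep ⊙ₗ e.rep) =>
            ∑ q, cellEmb A B c h e f (⟨a, ha⟩, ⟨b, hb⟩, d', (dec (a.rep ⊙ₗ f.rep)).s q)
              (((μ ≫ α ⊵ᵣ b.rep) ⊗ₜ β) ⊗ₜ
                ((((dec (a.rep ⊙ₗ f.rep)).incl q ≫ ζ) ⊵ᵣ b.rep ≫ γ) ⊗ₜ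
                  (dec (a.rep ⊙ₗ f.rep)).proj q)))
          (by intros; simp [LinearRightAction.add_actionHomLeft, add_tmul, Finset.sum_add_distrib])
          (by intros; simp [LinearRightAction.smul_actionHomLeft, ← smul_tmul', Finset.smul_sum])
          (by intros; simp [tmul_add, add_tmul, Finset.sum_add_distrib])
          (by intros; simp only [tmul_smul, ← smul_tmul', map_smul, Finset.smul_sum])
        have h₂ := sum_dec_of_hom_rep (V := TubeComp M A B c h e f) ζ fun g' => LinearMap.mk₂ ℂ
          (fun (α : a.rep ⊙ₗ f.rep ⟶ g'.rep) (β : g'.rep ⟶ g.rep) =>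
            cellEmb A B c h e f (⟨a, ha⟩, ⟨b, hb⟩, d, g')
              ((μ ⊗ₜ ν) ⊗ₜ ((β ⊵ᵣ b.rep ≫ γ) ⊗ₜ α)))
          (by intros; simp only [tmul_add, map_add])
          (by intros; simp only [tmul_smul, map_smul])
          (by intros; simp only [LinearRightAction.add_actionHomLeft, Preadditive.add_comp,
                add_tmul, tmul_add, map_add])
          (by intros; simp only [LinearRightAction.smul_actionHomLeft, Linear.smul_comp,
                ← smul_tmul', tmul_smul, map_smul])
        simp only [LinearMap.mk₂_apply, MonoidalRightAction.id_actionHomLeft, Category.comp_id,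
          Category.id_comp] at h₁ h₂
        rw [h₁, h₂]

end Expand

/-! ### Generators of the span of tube diagrams -/

section Generators

variable {C D M : Type*} [Category* C] [Category* D] [Category* M]
  [Preadditive C] [Linear ℂ C] [Preadditive D] [Linear ℂ D] [Preadditive M] [Linear ℂ M]
  [MonoidalCategory C] [MonoidalCategory D] [MonoidalLeftAction C M] [MonoidalRightAction D M]
  {A : Finset (Irr C)} {B : Finset (Irr D)} {V : Type*} [AddCommMonoid V]

lemma coeff_cellEmb_self {c h e f : Irr M} (t : A × B × Irr M × Irr M)
    (z : Cell t.1.1.rep t.2.1.1.rep c.rep t.2.2.1.rep e.rep f.rep t.2.2.2.rep h.rep) :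
    coeff A B c h e f t (cellEmb A B c h e f t z) = z :=
  Pi.single_eq_same _ _

lemma coeff_cellEmb_of_ne {c h e f : Irr M} {t t' : A × B × Irr M × Irr M} (ht : t ≠ t')
    (z : Cell t'.1.1.rep t'.2.1.1.rep c.rep t'.2.2.1.rep e.rep f.rep t'.2.2.2.rep h.rep) :
    coeff A B c h e f t (cellEmb A B c h e f t' z) = 0 :=
  Pi.single_eq_of_ne ht _

lemma comp_emb_self {c h e f : Irr M} (x : TubeComp M A B c h e f) :
    comp A B c h e f (emb A B c h e f x) = x :=
  Pi.single_eq_same (M := fun q : Irr M × Irr M × Irr M × Irr M =>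
    TubeComp M A B q.1 q.2.1 q.2.2.1 q.2.2.2) (c, h, e, f) x

lemma comp_emb_of_ne {c h e f c' h' e' f' : Irr M} (hq : (c, h, e, f) ≠ (c', h', e', f'))
    (x : TubeComp M A B c' h' e' f') :
    comp A B c h e f (emb A B c' h' e' f' x) = 0 :=
  Pi.single_eq_of_ne (M := fun q : Irr M × Irr M × Irr M × Irr M =>
    TubeComp M A B q.1 q.2.1 q.2.2.1 q.2.2.2) hq x

variable [IsFiniteSemisimple M]

/-- Evaluates a sum over all labels on a single summand. Only `F t 0 = 0` is required, so it serves
for all the structure maps, whatever their shape. -/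
lemma sum_coeff_cellEmb {c h e f : Irr M}
    (F : ∀ t : A × B × Irr M × Irr M,
      Cell t.1.1.rep t.2.1.1.rep c.rep t.2.2.1.rep e.rep f.rep t.2.2.2.rep h.rep → V)
    (hF : ∀ t, F t 0 = 0) (t : A × B × Irr M × Irr M)
    (z : Cell t.1.1.rep t.2.1.1.rep c.rep t.2.2.1.rep e.rep f.rep t.2.2.2.rep h.rep) :
    ∑ t', F t' (coeff A B c h e f t' (cellEmb A B c h e f t z)) = F t z := by
  rw [Finset.sum_eq_single t, coeff_cellEmb_self]
  · intro t' _ ht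
    rw [coeff_cellEmb_of_ne ht, hF]
  · simp

lemma sum_cellEmb_coeff {c h e f : Irr M} (x : TubeComp M A B c h e f) :
    ∑ t, cellEmb A B c h e f t (coeff A B c h e f t x) = x :=
  Finset.univ_sum_single (M := fun t : A × B × Irr M × Irr M =>
    Cell t.1.1.rep t.2.1.1.rep c.rep t.2.2.1.rep e.rep f.rep t.2.2.2.rep h.rep) x

lemma sum_comp_emb
    (F : ∀ c h e f : Irr M, TubeComp M A B c h e f → V)
    (hF : ∀ c h e f, F c h e f 0 = 0) {c h e f : Irr M} (x : TubeComp M A B c h e f) :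
    ∑ c', ∑ h', ∑ e', ∑ f', F c' h' e' f' (comp A B c' h' e' f' (emb A B c h e f x)) =
      F c h e f x := by
  rw [Finset.sum_eq_single c, Finset.sum_eq_single h, Finset.sum_eq_single e,
    Finset.sum_eq_single f, comp_emb_self]
  any_goals simp
  · intro f' hf
    rw [comp_emb_of_ne (by simp [hf]), hF]
  · intro e' he
    refine Finset.sum_eq_zero fun f' _ => ?_
    rw [comp_emb_of_ne (by simp [he]), hF]
  · intro h' hh
    refine Finset.sum_eq_zero fun e' _ => Finset.sum_eq_zero fun f' _ => ?_
    rw [comp_emb_of_ne (by simp [hh]), hF]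
  · intro c' hc
    refine Finset.sum_eq_zero fun h' _ => Finset.sum_eq_zero fun e' _ =>
      Finset.sum_eq_zero fun f' _ => ?_
    rw [comp_emb_of_ne (by simp [hc]), hF]

lemma sum_emb_comp (x : TubeOn M A B) :
    ∑ c, ∑ h, ∑ e, ∑ f, emb A B c h e f (comp A B c h e f x) = x := by
  have h := Finset.univ_sum_single (M := fun q : Irr M × Irr M × Irr M × Irr M =>
    TubeComp M A B q.1 q.2.1 q.2.2.1 q.2.2.2) x
  simp only [Fintype.sum_prod_type] at h
  exact h

end Generators

/-! ### Slide-invariant families and diagrams with arbitrary arcs -/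

section Expansion

variable {C D M : Type*} [Category* C] [Abelian C] [Linear ℂ C] [MonoidalCategory C]
  [Category* D] [Abelian D] [Linear ℂ D] [MonoidalCategory D]
  [Category* M] [Abelian M] [Linear ℂ M]
  [MonoidalLeftAction C M] [MonoidalRightAction D M]
  [LinearLeftAction C M] [LinearRightAction D M]
  [IsFiniteSemisimple C] [IsFiniteSemisimple D] [IsFiniteSemisimple M]
  {A : Finset (Irr C)} {B : Finset (Irr D)}

lemma sum_expand_toDiag {c h e f : Irr M} (x : TubeComp M A B c h e f) :
    ∑ t : A × B × Irr M × Irr M, expand A B t.1.1.rep t.2.1.1.rep c h e f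
      (toDiag A B c h e f t x) = x := by
  simp only [toDiag, LinearMap.comp_apply, expand_assemble, sum_cellEmb_coeff]

/-- A family of linear maps on the spaces of diagrams with arbitrary arcs for which morphisms can
be moved along the arcs from the upper to the lower strand. -/
structure SlideInvariant {c e f h : M} {V : Type*} [AddCommGroup V] [Module ℂ V]
    (T : ∀ (X : C) (Y : D), Diag X Y c e f h →ₗ[ℂ] V) : Prop where
  slide : ∀ {X X' : C} {Y Y' : D} (φ : X ⟶ X') (ψ : Y ⟶ Y') (u : c ⟶ (X ⊙ₗ e) ⊙ᵣ Y)
    (v : (X' ⊙ₗ f) ⊙ᵣ Y' ⟶ h),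
    T X Y (u ⊗ₜ (arcMap φ ψ f ≫ v)) = T X' Y' ((u ≫ arcMap φ ψ e) ⊗ₜ v)

variable (A B) in
lemma slideInvariant_expand (c h e f : Irr M) :
    SlideInvariant fun (X : C) (Y : D) => expand A B X Y c h e f :=
  ⟨fun φ ψ u v => expand_slide A B φ ψ u v⟩

section

variable {c h e f : Irr M} {V : Type*} [AddCommGroup V] [Module ℂ V]

/-- With simple arcs, expanding and recomposing inserts only the identities of `a ⊙ e` and `a ⊙ f`;
no invariance of `T` is needed yet. -/
lemma sum_toDiag_expandSimple
    (T : ∀ (X : C) (Y : D), Diag X Y c.rep e.rep f.rep h.rep →ₗ[ℂ] V) {a : Irr C} {b : Irr D}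
    (ha : a ∈ A) (hb : b ∈ B) (u : c.rep ⟶ (a.rep ⊙ₗ e.rep) ⊙ᵣ b.rep)
    (v : (a.rep ⊙ₗ f.rep) ⊙ᵣ b.rep ⟶ h.rep) :
    ∑ t, T _ _ (toDiag A B c h e f t (expandSimple A B a b c h e f (u ⊗ₜ v))) =
      T a.rep b.rep (u ⊗ₜ v) := by
  have H (p q) := sum_coeff_cellEmb (A := A) (B := B) (c := c) (h := h) (e := e) (f := f)
    (fun t z => T _ _ (assemble _ _ _ _ _ _ _ _ z)) (fun t => by simp)
    (⟨a, ha⟩, ⟨b, hb⟩, (dec (a.rep ⊙ₗ e.rep)).s p, (dec (a.rep ⊙ₗ f.rep)).s q)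
    (((u ≫ (dec (a.rep ⊙ₗ e.rep)).proj p ⊵ᵣ b.rep) ⊗ₜ (dec (a.rep ⊙ₗ e.rep)).incl p) ⊗ₜ
      (((dec (a.rep ⊙ₗ f.rep)).incl q ⊵ᵣ b.rep ≫ v) ⊗ₜ (dec (a.rep ⊙ₗ f.rep)).proj q))
  simp only [expandSimple_tmul ha hb, toDiag, LinearMap.comp_apply, map_sum]
  rw [Finset.sum_comm]
  refine (Finset.sum_congr rfl fun p _ =>
    Finset.sum_comm.trans (Finset.sum_congr rfl fun q _ => H p q)).trans ?_
  change ∑ p, ∑ q, T a.rep b.rep (((u ≫ (dec (a.rep ⊙ₗ e.rep)).proj p ⊵ᵣ b.rep) ≫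
      (dec (a.rep ⊙ₗ e.rep)).incl p ⊵ᵣ b.rep) ⊗ₜ ((dec (a.rep ⊙ₗ f.rep)).proj q ⊵ᵣ b.rep ≫
      (dec (a.rep ⊙ₗ f.rep)).incl q ⊵ᵣ b.rep ≫ v)) = _
  simp only [Category.assoc, ← MonoidalRightAction.comp_actionHomLeft,
    ← MonoidalRightAction.comp_actionHomLeft_assoc]
  simp only [← map_sum, ← tmul_sum, ← sum_tmul, ← Preadditive.comp_sum, ← Preadditive.sum_comp,
    ← whisker_sum, SimpleDecomp.sum_proj_incl, MonoidalRightAction.id_actionHomLeft,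
    Category.comp_id, Category.id_comp]

/-- A slide-invariant family is determined by its values on basic tube diagrams. -/
theorem SlideInvariant.sum_toDiag_expand
    {T : ∀ (X : C) (Y : D), Diag X Y c.rep e.rep f.rep h.rep →ₗ[ℂ] V} (hT : SlideInvariant T)
    {X : C} {Y : D} (hX : LabelsIn A X) (hY : LabelsIn B Y)
    (x : Diag X Y c.rep e.rep f.rep h.rep) :
    ∑ t, T _ _ (toDiag A B c h e f t (expand A B X Y c h e f x)) = T X Y x := by
  induction x using TensorProduct.induction_on with
  | zero => simp
  | add x y hx hy => simp only [map_add, Finset.sum_add_distrib, hx, hy]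
  | tmul u v =>
    simp only [expand_tmul, map_sum]
    rw [Finset.sum_comm]
    -- The label hypotheses ensure that no term of the expansion was dropped. Invariance then brings
    -- the inclusions of the arc summands from the upper strand next to the projections on the lower
    -- one, where they sum to the identity.
    refine (Finset.sum_congr rfl fun k _ => Finset.sum_comm.trans (Finset.sum_congr rfl fun l _ =>
      (sum_toDiag_expandSimple T (hX.mem k) (hY.mem l) _ _).trans (hT.slide _ _ _ _).symm)).trans ?_
    simp only [← reassoc_of% arcMap_comp]
    simp only [← map_sum, ← tmul_sum, ← Preadditive.sum_comp, ← arcMap_sum_right,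
      ← arcMap_sum_left, SimpleDecomp.sum_proj_incl, arcMap_id, Category.id_comp]

end

variable (A B) in
/-- The element of the span of tube diagrams represented by a diagram with arbitrary arcs. -/
def gen (X : C) (Y : D) (c h e f : Irr M) :
    Diag X Y c.rep e.rep f.rep h.rep →ₗ[ℂ] TubeOn M A B :=
  emb A B c h e f ∘ₗ expand A B X Y c h e f

lemma slideInvariant_gen (c h e f : Irr M) :
    SlideInvariant fun (X : C) (Y : D) => gen A B X Y c h e f where
  slide φ ψ u v := by simp only [gen, LinearMap.comp_apply, expand_slide]

lemma emb_eq_sum_gen {c h e f : Irr M} (x : TubeComp M A B c h e f) :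
    emb A B c h e f x = ∑ t : A × B × Irr M × Irr M, gen A B t.1.1.rep t.2.1.1.rep c h e f
      (toDiag A B c h e f t x) := by
  conv_lhs => rw [← sum_expand_toDiag x, map_sum]
  rfl

/-- The diagrams with simple arcs span. -/
lemma tubeOn_induction {P : TubeOn M A B → Prop} (zero : P 0) (add : ∀ x y, P x → P y → P (x + y))
    (gen : ∀ a ∈ A, ∀ b ∈ B, ∀ (c h e f : Irr M) (u : c.rep ⟶ (a.rep ⊙ₗ e.rep) ⊙ᵣ b.rep)
      (v : (a.rep ⊙ₗ f.rep) ⊙ᵣ b.rep ⟶ h.rep), P (gen A B a.rep b.rep c h e f (u ⊗ₜ v)))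
    (x : TubeOn M A B) : P x := by
  rw [← sum_emb_comp x]
  refine Finset.sum_induction _ _ add zero fun c _ => Finset.sum_induction _ _ add zero fun h _ =>
    Finset.sum_induction _ _ add zero fun e _ => Finset.sum_induction _ _ add zero fun f _ => ?_
  rw [emb_eq_sum_gen]
  refine Finset.sum_induction _ _ add zero fun t _ => ?_
  generalize toDiag A B c h e f t (comp A B c h e f x) = z
  induction z using TensorProduct.induction_on with
  | zero => simpa using zero
  | add y z hy hz => rw [map_add]; exact add _ _ hy hz
  | tmul u v => exact gen _ t.1.2 _ t.2.1.2 _ _ _ _ u v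

/-! ### Extension by zero -/

lemma inclTube_emb {c h e f : Irr M} (x : TubeComp M A B c h e f) :
    inclTube A B (emb A B c h e f x) =
      ∑ t : A × B × Irr M × Irr M, emb (allLabels C) (allLabels D) c h e f
        (cellEmb (allLabels C) (allLabels D) c h e f
          (⟨t.1.1, Finset.mem_univ _⟩, ⟨t.2.1.1, Finset.mem_univ _⟩, t.2.2.1, t.2.2.2)
          (coeff A B c h e f t x)) := by
  simp only [inclTube, LinearMap.sum_apply, LinearMap.comp_apply]
  exact sum_comp_emb (fun c h e f x => ∑ t : A × B × Irr M × Irr M,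
    emb (allLabels C) (allLabels D) c h e f (cellEmb (allLabels C) (allLabels D) c h e f
      (⟨t.1.1, Finset.mem_univ _⟩, ⟨t.2.1.1, Finset.mem_univ _⟩, t.2.2.1, t.2.2.2)
      (coeff A B c h e f t x))) (fun c h e f => by simp) x

lemma inclTube_emb_cellEmb {c h e f : Irr M} (t : A × B × Irr M × Irr M)
    (z : Cell t.1.1.rep t.2.1.1.rep c.rep t.2.2.1.rep e.rep f.rep t.2.2.2.rep h.rep) :
    inclTube A B (emb A B c h e f (cellEmb A B c h e f t z)) =
      emb (allLabels C) (allLabels D) c h e f (cellEmb (allLabels C) (allLabels D) c h e f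
        (⟨t.1.1, Finset.mem_univ _⟩, ⟨t.2.1.1, Finset.mem_univ _⟩, t.2.2.1, t.2.2.2) z) := by
  rw [inclTube_emb]
  exact sum_coeff_cellEmb (A := A) (B := B) (fun t z => emb (allLabels C) (allLabels D) c h e f
    (cellEmb (allLabels C) (allLabels D) c h e f
      (⟨t.1.1, Finset.mem_univ _⟩, ⟨t.2.1.1, Finset.mem_univ _⟩, t.2.2.1, t.2.2.2) z))
    (fun t => by simp) t z

/-- Evaluation with all labels is itself slide-invariant, so it can be computed through the
expansion with labels in `A` and `B`, which is complete for these arcs. -/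
lemma inclTube_gen {X : C} {Y : D} (hX : LabelsIn A X) (hY : LabelsIn B Y) {c h e f : Irr M}
    (x : Diag X Y c.rep e.rep f.rep h.rep) :
    inclTube A B (gen A B X Y c h e f x) = gen (allLabels C) (allLabels D) X Y c h e f x := by
  rw [gen, LinearMap.comp_apply, inclTube_emb]
  have H := (slideInvariant_gen (A := allLabels C) (B := allLabels D) c h e f).sum_toDiag_expand
    hX hY x
  rw [← H]
  refine Finset.sum_congr rfl fun t _ => ?_
  rw [gen, LinearMap.comp_apply, toDiag, LinearMap.comp_apply]
  exact congrArg _ (expand_assemble (A := allLabels C) (B := allLabels D)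
    (⟨t.1.1, Finset.mem_univ _⟩, ⟨t.2.1.1, Finset.mem_univ _⟩, t.2.2.1, t.2.2.2) _).symm

lemma comp_inclTube {c h e f : Irr M} (x : TubeOn M A B) :
    comp _ _ c h e f (inclTube A B x) =
      ∑ t : A × B × Irr M × Irr M, cellEmb (allLabels C) (allLabels D) c h e f
        (⟨t.1.1, Finset.mem_univ _⟩, ⟨t.2.1.1, Finset.mem_univ _⟩, t.2.2.1, t.2.2.2)
        (coeff A B c h e f t (comp _ _ c h e f x)) := by
  rw [← sum_emb_comp x]
  simp only [map_sum]
  simp_rw [Finset.sum_comm (s := Finset.univ (α := A × B × Irr M × Irr M)), inclTube_emb, map_sum]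
  refine Finset.sum_congr rfl fun c' _ => Finset.sum_congr rfl fun h' _ =>
    Finset.sum_congr rfl fun e' _ => Finset.sum_congr rfl fun f' _ =>
    Finset.sum_congr rfl fun t _ => ?_
  by_cases hq : (c, h, e, f) = (c', h', e', f')
  · simp only [Prod.mk.injEq] at hq
    obtain ⟨rfl, rfl, rfl, rfl⟩ := hq
    rw [comp_emb_self, comp_emb_self]
  · rw [comp_emb_of_ne hq, comp_emb_of_ne hq, map_zero, map_zero]

lemma coeff_comp_inclTube {c h e f : Irr M} (x : TubeOn M A B) (t : A × B × Irr M × Irr M) :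
    coeff (allLabels C) (allLabels D) c h e f
      (⟨t.1.1, Finset.mem_univ _⟩, ⟨t.2.1.1, Finset.mem_univ _⟩, t.2.2.1, t.2.2.2)
      (comp _ _ c h e f (inclTube A B x)) = coeff A B c h e f t (comp _ _ c h e f x) := by
  rw [comp_inclTube, map_sum, Finset.sum_eq_single t]
  · exact coeff_cellEmb_self (A := allLabels C) (B := allLabels D) (_, _, _, _) _
  · rintro t' - ht
    refine coeff_cellEmb_of_ne (A := allLabels C) (B := allLabels D) (fun H => ht ?_) _
    simp only [Prod.mk.injEq, Subtype.mk.injEq] at H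
    exact Prod.ext (Subtype.ext H.1.symm) (Prod.ext (Subtype.ext H.2.1.symm)
      (Prod.ext H.2.2.1.symm H.2.2.2.symm))
  · simp

lemma inclTube_injective : Function.Injective (inclTube A B : TubeOn M A B →ₗ[ℂ] Tube C D M) := by
  intro x y hxy
  funext ⟨c, h, e, f⟩
  funext t
  have H := coeff_comp_inclTube (c := c) (h := h) (e := e) (f := f) x t
  rw [hxy, coeff_comp_inclTube] at H
  exact H.symm

end Expansion

/-! ### The product of tube diagrams -/

section Product

variable {C D M : Type*} [Category* C] [Abelian C] [Linear ℂ C] [MonoidalCategory C]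
  [Category* D] [Abelian D] [Linear ℂ D] [MonoidalCategory D]
  [Category* M] [Abelian M] [Linear ℂ M]
  [MonoidalLeftAction C M] [MonoidalRightAction D M]
  [LinearLeftAction C M] [LinearRightAction D M] [BimoduleCategory C D M]

@[simp]
lemma stack_tmul (X X' : C) (Y Y' : D) {c m n h e f : M}
    (u : c ⟶ (X ⊙ₗ m) ⊙ᵣ Y) (v : (X ⊙ₗ n) ⊙ᵣ Y ⟶ h)
    (u' : m ⟶ (X' ⊙ₗ e) ⊙ᵣ Y') (v' : (X' ⊙ₗ f) ⊙ᵣ Y' ⟶ n) :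
    stack X X' Y Y' c m n h e f (u ⊗ₜ v) (u' ⊗ₜ v') =
      (u ≫ (X ⊴ₗ u') ⊵ᵣ Y ≫ (stackIso X X' Y Y' e).hom) ⊗ₜ
        ((stackIso X X' Y Y' f).inv ≫ (X ⊴ₗ v') ⊵ᵣ Y ≫ v) := rfl

lemma stackIso_inv_naturality_outer {X X'' : C} {Y Y'' : D} (X' : C) (Y' : D) (φ : X ⟶ X'')
    (ψ : Y ⟶ Y'') (m : M) :
    (stackIso X X' Y Y' m).inv ≫ arcMap φ ψ ((X' ⊙ₗ m) ⊙ᵣ Y') =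
      arcMap (φ ▷ X') (Y' ◁ ψ) m ≫ (stackIso X'' X' Y'' Y' m).inv := by
  rw [Iso.inv_comp_eq, ← reassoc_of% stackIso_naturality_outer, Iso.hom_inv_id, Category.comp_id]

lemma stackIso_inv_naturality_strand (X X' : C) (Y Y' : D) {m m' : M} (g : m ⟶ m') :
    ((X ⊗ X') ⊴ₗ g) ⊵ᵣ (Y' ⊗ Y) ≫ (stackIso X X' Y Y' m').inv =
      (stackIso X X' Y Y' m).inv ≫ (X ⊴ₗ ((X' ⊴ₗ g) ⊵ᵣ Y')) ⊵ᵣ Y := by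
  rw [Iso.comp_inv_eq, Category.assoc, stackIso_naturality_strand, Iso.inv_hom_id_assoc]

lemma stackIso_inv_naturality_inner {X' X'' : C} {Y' Y'' : D} (X : C) (Y : D) (φ : X' ⟶ X'')
    (ψ : Y' ⟶ Y'') (m : M) :
    (stackIso X X' Y Y' m).inv ≫ (X ⊴ₗ arcMap φ ψ m) ⊵ᵣ Y =
      arcMap (X ◁ φ) (ψ ▷ Y) m ≫ (stackIso X X'' Y Y'' m).inv := by
  rw [Iso.inv_comp_eq, ← reassoc_of% stackIso_naturality_inner, Iso.hom_inv_id, Category.comp_id]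

variable [IsFiniteSemisimple C] [IsFiniteSemisimple D] [IsFiniteSemisimple M]
  {A : Finset (Irr C)} {B : Finset (Irr D)}

section

variable {c m n h e f : Irr M}

/-- Naturality of `stackIso` turns a morphism on the outer arcs into a whiskered morphism on the
fused arcs, where `expand_slide` applies. The same holds for the inner arcs, so stacking descends to
the tube space in both arguments. -/
lemma slideInvariant_stack_left {X' : C} {Y' : D} (x' : Diag X' Y' m.rep e.rep f.rep n.rep) :
    SlideInvariant fun (X : C) (Y : D) => expand A B (X ⊗ X') (Y' ⊗ Y) c h e f ∘ₗ
      (stack X X' Y Y' c.rep m.rep n.rep h.rep e.rep f.rep).flip x' where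
  slide {X X₁ Y Y₁} φ ψ u v := by
    simp only [LinearMap.comp_apply, LinearMap.flip_apply]
    induction x' using TensorProduct.induction_on with
    | zero => simp
    | add x y hx hy => simp only [map_add, hx, hy]
    | tmul u' v' =>
      simp only [stack_tmul, Category.assoc]
      rw [reassoc_of% arcMap_naturality, ← Category.assoc (stackIso _ _ _ _ _).inv,
        stackIso_inv_naturality_outer, Category.assoc, expand_slide]
      simp only [Category.assoc, ← stackIso_naturality_outer, reassoc_of% arcMap_naturality]

lemma slideInvariant_stack_right {X : C} {Y : D} (x : Diag X Y c.rep m.rep n.rep h.rep) :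
    SlideInvariant fun (X' : C) (Y' : D) => expand A B (X ⊗ X') (Y' ⊗ Y) c h e f ∘ₗ
      stack X X' Y Y' c.rep m.rep n.rep h.rep e.rep f.rep x where
  slide {X' X₁ Y' Y₁} φ ψ u' v' := by
    simp only [LinearMap.comp_apply]
    induction x using TensorProduct.induction_on with
    | zero => simp
    | add x y hx hy => simp only [map_add, LinearMap.add_apply, hx, hy]
    | tmul u v =>
      simp only [stack_tmul, Category.assoc, MonoidalLeftAction.actionHomRight_comp,
        MonoidalRightAction.comp_actionHomLeft, stackIso_naturality_inner]
      rw [← Category.assoc (stackIso _ _ _ _ _).inv, stackIso_inv_naturality_inner,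
        Category.assoc, expand_slide]
      simp only [Category.assoc]

lemma mulComp_apply (x : TubeComp M A B c h m n) (y : TubeComp M A B m n e f) :
    mulComp A B c h m n e f x y = ∑ t : A × B × Irr M × Irr M, ∑ t' : A × B × Irr M × Irr M,
      expand A B (t.1.1.rep ⊗ t'.1.1.rep) (t'.2.1.1.rep ⊗ t.2.1.1.rep) c h e f
        (stack t.1.1.rep t'.1.1.rep t.2.1.1.rep t'.2.1.1.rep _ _ _ _ _ _
          (toDiag A B c h m n t x) (toDiag A B m n e f t' y)) := by
  simp only [mulComp, LinearMap.sum_apply]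
  rfl

/-- The product is defined by recomposing basic diagrams before stacking. Invariance in each
argument shows that expanding beforehand changes nothing. -/
lemma mulComp_expand {X X' : C} {Y Y' : D} (hX : LabelsIn A X) (hY : LabelsIn B Y)
    (hX' : LabelsIn A X') (hY' : LabelsIn B Y') (x : Diag X Y c.rep m.rep n.rep h.rep)
    (x' : Diag X' Y' m.rep e.rep f.rep n.rep) :
    mulComp A B c h m n e f (expand A B X Y c h m n x) (expand A B X' Y' m n e f x') =
      expand A B (X ⊗ X') (Y' ⊗ Y) c h e f (stack X X' Y Y' _ _ _ _ _ _ x x') := by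
  rw [mulComp_apply]
  refine (Finset.sum_congr rfl fun t _ =>
    (slideInvariant_stack_right (A := A) (B := B) _).sum_toDiag_expand hX' hY' x').trans ?_
  exact (slideInvariant_stack_left (A := A) (B := B) x').sum_toDiag_expand hX hY x

end

lemma tubeMul_apply (x y : TubeOn M A B) :
    tubeMul A B x y = ∑ c, ∑ h, ∑ m, ∑ n, ∑ e, ∑ f,
      emb A B c h e f (mulComp A B c h m n e f (comp A B c h m n x) (comp A B m n e f y)) := by
  simp only [tubeMul, LinearMap.sum_apply]
  rfl

lemma tubeMul_emb_left {c h m n : Irr M} (x : TubeComp M A B c h m n) (y : TubeOn M A B) :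
    tubeMul A B (emb A B c h m n x) y =
      ∑ e, ∑ f, emb A B c h e f (mulComp A B c h m n e f x (comp A B m n e f y)) := by
  rw [tubeMul_apply]
  exact sum_comp_emb (fun c h m n x =>
    ∑ e, ∑ f, emb A B c h e f (mulComp A B c h m n e f x (comp A B m n e f y)))
    (fun c h m n => by simp) x

lemma tubeMul_emb {c h m n e f : Irr M} (x : TubeComp M A B c h m n)
    (y : TubeComp M A B m n e f) :
    tubeMul A B (emb A B c h m n x) (emb A B m n e f y) =
      emb A B c h e f (mulComp A B c h m n e f x y) := by
  rw [tubeMul_emb_left, Finset.sum_eq_single e, Finset.sum_eq_single f, comp_emb_self]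
  any_goals simp
  · intro f' hf
    rw [comp_emb_of_ne (by simp [hf]), map_zero, map_zero]
  · intro e' he
    refine Finset.sum_eq_zero fun f' _ => ?_
    rw [comp_emb_of_ne (by simp [he]), map_zero, map_zero]

lemma tubeMul_emb_of_ne {c h m n m' n' e f : Irr M} (hmn : (m, n) ≠ (m', n'))
    (x : TubeComp M A B c h m n) (y : TubeComp M A B m' n' e f) :
    tubeMul A B (emb A B c h m n x) (emb A B m' n' e f y) = 0 := by
  rw [tubeMul_emb_left]
  refine Finset.sum_eq_zero fun e' _ => Finset.sum_eq_zero fun f' _ => ?_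
  rw [comp_emb_of_ne (fun H => hmn (by simp_all)), map_zero, map_zero]

lemma tubeMul_gen {c h m n e f : Irr M} {X X' : C} {Y Y' : D}
    (hX : LabelsIn A X) (hY : LabelsIn B Y)
    (hX' : LabelsIn A X') (hY' : LabelsIn B Y') (x : Diag X Y c.rep m.rep n.rep h.rep)
    (x' : Diag X' Y' m.rep e.rep f.rep n.rep) :
    tubeMul A B (gen A B X Y c h m n x) (gen A B X' Y' m n e f x') =
      gen A B (X ⊗ X') (Y' ⊗ Y) c h e f (stack X X' Y Y' _ _ _ _ _ _ x x') := by
  simp only [gen, LinearMap.comp_apply, tubeMul_emb, mulComp_expand hX hY hX' hY']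

lemma tubeMul_gen_all {c h m n e f : Irr M} {X X' : C} {Y Y' : D}
    (x : Diag X Y c.rep m.rep n.rep h.rep) (x' : Diag X' Y' m.rep e.rep f.rep n.rep) :
    tubeMul (allLabels C) (allLabels D) (gen _ _ X Y c h m n x) (gen _ _ X' Y' m n e f x') =
      gen _ _ (X ⊗ X') (Y' ⊗ Y) c h e f (stack X X' Y Y' _ _ _ _ _ _ x x') :=
  tubeMul_gen (labelsIn_univ _) (labelsIn_univ _) (labelsIn_univ _) (labelsIn_univ _) x x'

lemma tubeMul_gen_of_ne {c h m n m' n' e f : Irr M} (hmn : (m, n) ≠ (m', n'))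
    {X X' : C} {Y Y' : D} (x : Diag X Y c.rep m.rep n.rep h.rep)
    (x' : Diag X' Y' m'.rep e.rep f.rep n'.rep) :
    tubeMul A B (gen A B X Y c h m n x) (gen A B X' Y' m' n' e f x') = 0 :=
  tubeMul_emb_of_ne hmn _ _

/-! ### Associativity and unitality -/

/-- The two nestings have arcs bracketed differently, so they lie in different diagram spaces and
agree only after evaluation: the associators slide from the upper strand to the lower one. -/
lemma gen_stack_assoc {c h m n p q e f : Irr M} {X X' X'' : C} {Y Y' Y'' : D}
    (u : c.rep ⟶ (X ⊙ₗ m.rep) ⊙ᵣ Y) (v : (X ⊙ₗ n.rep) ⊙ᵣ Y ⟶ h.rep)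
    (u' : m.rep ⟶ (X' ⊙ₗ p.rep) ⊙ᵣ Y') (v' : (X' ⊙ₗ q.rep) ⊙ᵣ Y' ⟶ n.rep)
    (u'' : p.rep ⟶ (X'' ⊙ₗ e.rep) ⊙ᵣ Y'') (v'' : (X'' ⊙ₗ f.rep) ⊙ᵣ Y'' ⟶ q.rep) :
    gen A B _ _ c h e f (stack _ _ _ _ _ _ _ _ _ _
        (stack _ _ _ _ _ _ _ _ _ _ (u ⊗ₜ v) (u' ⊗ₜ v')) (u'' ⊗ₜ v'')) =
      gen A B _ _ c h e f (stack _ _ _ _ _ _ _ _ _ _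
        (u ⊗ₜ v) (stack _ _ _ _ _ _ _ _ _ _ (u' ⊗ₜ v') (u'' ⊗ₜ v''))) := by
  have H := (slideInvariant_gen (A := A) (B := B) c h e f).slide
    (α_ X X' X'').hom (α_ Y'' Y' Y).inv
  -- `stackIso_assoc` inverted, so that the associators stand at the start of the upper strand,
  -- ready to slide.
  have Hinv : (stackIso (X ⊗ X') X'' (Y' ⊗ Y) Y'' f.rep).inv ≫
      (stackIso X X' Y Y' ((X'' ⊙ₗ f.rep) ⊙ᵣ Y'')).inv =
      arcMap (α_ X X' X'').hom (α_ Y'' Y' Y).inv f.rep ≫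
        (stackIso X (X' ⊗ X'') Y (Y'' ⊗ Y') f.rep).inv ≫
        (X ⊴ₗ (stackIso X' X'' Y' Y'' f.rep).inv) ⊵ᵣ Y := by
    rw [Iso.inv_comp_eq, ← cancel_epi (stackIso X X' Y Y' ((X'' ⊙ₗ f.rep) ⊙ᵣ Y'')).hom,
      reassoc_of% stackIso_assoc]
    simp [← MonoidalRightAction.comp_actionHomLeft, ← MonoidalLeftAction.actionHomRight_comp]
  simp only [stack_tmul, Category.assoc, MonoidalLeftAction.actionHomRight_comp,
    MonoidalRightAction.comp_actionHomLeft, ← reassoc_of% stackIso_naturality_strand,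
    reassoc_of% stackIso_inv_naturality_strand, reassoc_of% Hinv, H, stackIso_assoc]

theorem tubeMul_assoc (x y z : Tube C D M) :
    tubeMul (allLabels C) (allLabels D) (tubeMul (allLabels C) (allLabels D) x y) z =
      tubeMul (allLabels C) (allLabels D) x (tubeMul (allLabels C) (allLabels D) y z) := by
  induction x using tubeOn_induction with
  | zero => simp
  | add x x' hx hx' => simp only [map_add, LinearMap.add_apply, hx, hx']
  | gen a _ b _ c h m n u v =>
  induction y using tubeOn_induction with
  | zero => simp
  | add x x' hx hx' => simp only [map_add, LinearMap.add_apply, hx, hx']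
  | gen a' _ b' _ m' n' p q u' v' =>
  induction z using tubeOn_induction with
  | zero => simp
  | add x x' hx hx' => simp only [map_add, hx, hx']
  | gen a'' _ b'' _ p' q' e f u'' v'' =>
  by_cases hmn : (m, n) = (m', n')
  · simp only [Prod.mk.injEq] at hmn
    obtain ⟨rfl, rfl⟩ := hmn
    by_cases hpq : (p, q) = (p', q')
    · simp only [Prod.mk.injEq] at hpq
      obtain ⟨rfl, rfl⟩ := hpq
      simp only [tubeMul_gen_all, gen_stack_assoc]
    · rw [tubeMul_gen_all, tubeMul_gen_of_ne hpq, tubeMul_gen_of_ne hpq, map_zero]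
  · rw [tubeMul_gen_of_ne hmn]
    by_cases hpq : (p, q) = (p', q')
    · simp only [Prod.mk.injEq] at hpq
      obtain ⟨rfl, rfl⟩ := hpq
      rw [tubeMul_gen_all, tubeMul_gen_of_ne hmn, map_zero, LinearMap.zero_apply]
    · rw [tubeMul_gen_of_ne hpq, map_zero, map_zero, LinearMap.zero_apply]

variable (C D) in
/-- The pair of strands `c`, `h` with dotted arcs. -/
def unitDiag (c h : M) : Diag (𝟙_ C) (𝟙_ D) c c h h :=
  ((λₗ[C] c).inv ≫ (ρᵣ[D] (𝟙_ C ⊙ₗ c)).inv) ⊗ₜ ((ρᵣ[D] (𝟙_ C ⊙ₗ h)).hom ≫ (λₗ[C] h).hom)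

lemma tubeOne_eq : tubeOne A B = ∑ c : Irr M, ∑ h : Irr M,
    gen A B (𝟙_ C) (𝟙_ D) c h c h (unitDiag C D c.rep h.rep) := rfl

/-- On the upper strand `stackIso_unit_left` exposes the unitors of the arcs; slid to the lower
strand, they cancel the rebracketing there. -/
lemma gen_stack_unitDiag_left {X : C} {Y : D} {c h e f : Irr M}
    (u : c.rep ⟶ (X ⊙ₗ e.rep) ⊙ᵣ Y) (v : (X ⊙ₗ f.rep) ⊙ᵣ Y ⟶ h.rep) :
    gen A B _ _ c h e f (stack _ _ _ _ _ _ _ _ _ _ (unitDiag C D c.rep h.rep) (u ⊗ₜ v)) =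
      gen A B X Y c h e f (u ⊗ₜ v) := by
  have H := (slideInvariant_gen (A := A) (B := B) c h e f).slide (λ_ X).hom (ρ_ Y).hom
  have h₁ {m m' : M} (g : m ⟶ m') :
      (𝟙_ C ⊴ₗ g) ⊵ᵣ 𝟙_ D ≫ (ρᵣ[D] _).hom ≫ (λₗ[C] _).hom =
        (ρᵣ[D] _).hom ≫ (λₗ[C] _).hom ≫ g := by
    rw [← MonoidalRightAction.actionUnitIso_hom_naturality_assoc,
      MonoidalLeftAction.actionUnitIso_hom_naturality]
  simp only [unitDiag, stack_tmul, Category.assoc, h₁]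
  rw [← Category.assoc (ρᵣ[D] _).hom, ← stackIso_unit_left, Category.assoc,
    Iso.inv_hom_id_assoc, H]
  simp only [Category.assoc, stackIso_unit_left, h₁, Iso.inv_hom_id_assoc]

lemma gen_stack_unitDiag_right {X : C} {Y : D} {c h e f : Irr M}
    (u : c.rep ⟶ (X ⊙ₗ e.rep) ⊙ᵣ Y) (v : (X ⊙ₗ f.rep) ⊙ᵣ Y ⟶ h.rep) :
    gen A B _ _ c h e f (stack _ _ _ _ _ _ _ _ _ _ (u ⊗ₜ v) (unitDiag C D e.rep f.rep)) =
      gen A B X Y c h e f (u ⊗ₜ v) := by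
  have H := (slideInvariant_gen (A := A) (B := B) c h e f).slide (ρ_ X).hom (λ_ Y).hom
  simp only [unitDiag, stack_tmul]
  rw [← stackIso_unit_right, Category.assoc, Iso.inv_hom_id_assoc, H]
  simp only [Category.assoc, stackIso_unit_right, ← MonoidalRightAction.comp_actionHomLeft,
    ← MonoidalLeftAction.actionHomRight_comp, Iso.inv_hom_id_assoc, Iso.inv_hom_id]
  simp

theorem tubeOne_mul (x : Tube C D M) :
    tubeMul (allLabels C) (allLabels D) (tubeOne (allLabels C) (allLabels D)) x = x := by
  induction x using tubeOn_induction with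
  | zero => simp
  | add x x' hx hx' => simp only [map_add, hx, hx']
  | gen a _ b _ c h e f u v =>
  simp only [tubeOne_eq, map_sum, LinearMap.sum_apply]
  rw [Finset.sum_eq_single c, Finset.sum_eq_single h, tubeMul_gen_all, gen_stack_unitDiag_left]
  any_goals simp
  · exact fun h' hh => tubeMul_gen_of_ne (by simp [hh]) _ _
  · exact fun c' hc => Finset.sum_eq_zero fun h' _ => tubeMul_gen_of_ne (by simp [hc]) _ _

theorem tubeMul_one (x : Tube C D M) :
    tubeMul (allLabels C) (allLabels D) x (tubeOne (allLabels C) (allLabels D)) = x := by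
  induction x using tubeOn_induction with
  | zero => simp
  | add x x' hx hx' => simp only [map_add, LinearMap.add_apply, hx, hx']
  | gen a _ b _ c h e f u v =>
  simp only [tubeOne_eq, map_sum]
  rw [Finset.sum_eq_single e, Finset.sum_eq_single f, tubeMul_gen_all, gen_stack_unitDiag_right]
  any_goals simp
  · exact fun h' hh => tubeMul_gen_of_ne (by simp [Ne.symm hh]) _ _
  · exact fun c' hc => Finset.sum_eq_zero fun h' _ => tubeMul_gen_of_ne (by simp [Ne.symm hc]) _ _

/-! ### Sets of labels closed under fusion -/

/-- Closure under fusion is what makes the truncated product lose nothing: the arcs `a ⊗ a'` and `b'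
⊗ b` have all their summands among the allowed labels. -/
theorem inclTube_mul (hA : FusionClosed A) (hB : FusionClosed B) (x y : TubeOn M A B) :
    inclTube A B (tubeMul A B x y) =
      tubeMul (allLabels C) (allLabels D) (inclTube A B x) (inclTube A B y) := by
  induction x using tubeOn_induction with
  | zero => simp
  | add x x' hx hx' => simp only [map_add, LinearMap.add_apply, hx, hx']
  | gen a ha b hb c h m n u v =>
  induction y using tubeOn_induction with
  | zero => simp
  | add x x' hx hx' => simp only [map_add, hx, hx']
  | gen a' ha' b' hb' m' n' e f u' v' =>
  rw [inclTube_gen (labelsIn_rep ha) (labelsIn_rep hb),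
    inclTube_gen (labelsIn_rep ha') (labelsIn_rep hb')]
  by_cases hmn : (m, n) = (m', n')
  · simp only [Prod.mk.injEq] at hmn
    obtain ⟨rfl, rfl⟩ := hmn
    rw [tubeMul_gen (labelsIn_rep ha) (labelsIn_rep hb) (labelsIn_rep ha') (labelsIn_rep hb'),
      tubeMul_gen_all, inclTube_gen (hA.tensor _ ha _ ha') (hB.tensor _ hb' _ hb)]
  · rw [tubeMul_gen_of_ne hmn, tubeMul_gen_of_ne hmn, map_zero]

theorem inclTube_one (hA : FusionClosed A) (hB : FusionClosed B) :
    inclTube A B (tubeOne A B : TubeOn M A B) = tubeOne (allLabels C) (allLabels D) := by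
  simp only [tubeOne_eq, map_sum, inclTube_gen hA.unit hB.unit]

end Product

/-! ### The coproduct of tube diagrams -/

section Coproduct

variable {C D M : Type*} [Category* C] [Abelian C] [Linear ℂ C] [MonoidalCategory C]
  [Category* D] [Abelian D] [Linear ℂ D] [MonoidalCategory D]
  [Category* M] [Abelian M] [Linear ℂ M]
  [MonoidalLeftAction C M] [MonoidalRightAction D M]
  [IsFiniteSemisimple C] [IsFiniteSemisimple D] [IsFiniteSemisimple M]
  {A : Finset (Irr C)} {B : Finset (Irr D)}

/-- The coproduct on a single vertex space. -/
def cellComul (c h e f : Irr M) (t : A × B × Irr M × Irr M) :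
    Cell t.1.1.rep t.2.1.1.rep c.rep t.2.2.1.rep e.rep f.rep t.2.2.2.rep h.rep →ₗ[ℂ]
      TubeOn M A B ⊗[ℂ] TubeOn M A B :=
  ∑ i : Irr M,
  ∑ p : Fin (dec (t.1.1.rep ⊙ₗ i.rep)).n,
  ∑ q : Fin (dec (((dec (t.1.1.rep ⊙ₗ i.rep)).s p).rep ⊙ᵣ t.2.1.1.rep)).n,
    TensorProduct.map
      (emb A B ((dec (((dec (t.1.1.rep ⊙ₗ i.rep)).s p).rep ⊙ᵣ t.2.1.1.rep)).s q) h i f ∘ₗ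
        cellEmb A B ((dec (((dec (t.1.1.rep ⊙ₗ i.rep)).s p).rep ⊙ᵣ t.2.1.1.rep)).s q) h i f
          (t.1, t.2.1, (dec (t.1.1.rep ⊙ₗ i.rep)).s p, t.2.2.2) ∘ₗ
        TensorProduct.mk ℂ _ _
          ((dec (((dec (t.1.1.rep ⊙ₗ i.rep)).s p).rep ⊙ᵣ t.2.1.1.rep)).incl q ⊗ₜ
            (dec (t.1.1.rep ⊙ₗ i.rep)).incl p))
      (emb A B c ((dec (((dec (t.1.1.rep ⊙ₗ i.rep)).s p).rep ⊙ᵣ t.2.1.1.rep)).s q) e i ∘ₗ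
        cellEmb A B c ((dec (((dec (t.1.1.rep ⊙ₗ i.rep)).s p).rep ⊙ᵣ t.2.1.1.rep)).s q) e i
          (t.1, t.2.1, t.2.2.1, (dec (t.1.1.rep ⊙ₗ i.rep)).s p) ∘ₗ
        (TensorProduct.mk ℂ _ _).flip
          ((dec (((dec (t.1.1.rep ⊙ₗ i.rep)).s p).rep ⊙ᵣ t.2.1.1.rep)).proj q ⊗ₜ
            (dec (t.1.1.rep ⊙ₗ i.rep)).proj p)) ∘ₗ
    (TensorProduct.comm ℂ _ _).toLinearMap

lemma tubeComul_apply (x : TubeOn M A B) :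
    tubeComul A B x = ∑ c, ∑ h, ∑ e, ∑ f, ∑ t,
      cellComul c h e f t (coeff A B c h e f t (comp A B c h e f x)) := by
  simp only [tubeComul, cellComul, LinearMap.sum_apply]
  rfl

lemma tubeComul_emb {c h e f : Irr M} (x : TubeComp M A B c h e f) :
    tubeComul A B (emb A B c h e f x) = ∑ t, cellComul c h e f t (coeff A B c h e f t x) := by
  rw [tubeComul_apply]
  exact sum_comp_emb (fun c h e f x => ∑ t, cellComul c h e f t (coeff A B c h e f t x))
    (fun c h e f => by simp) x

lemma cellComul_tmul {c h e f : Irr M} (t : A × B × Irr M × Irr M)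
    (x : (c.rep ⟶ t.2.2.1.rep ⊙ᵣ t.2.1.1.rep) ⊗[ℂ] (t.2.2.1.rep ⟶ t.1.1.rep ⊙ₗ e.rep))
    (y : (t.2.2.2.rep ⊙ᵣ t.2.1.1.rep ⟶ h.rep) ⊗[ℂ] (t.1.1.rep ⊙ₗ f.rep ⟶ t.2.2.2.rep)) :
    cellComul c h e f t (x ⊗ₜ y) =
      ∑ i : Irr M,
      ∑ p : Fin (dec (t.1.1.rep ⊙ₗ i.rep)).n,
      ∑ q : Fin (dec (((dec (t.1.1.rep ⊙ₗ i.rep)).s p).rep ⊙ᵣ t.2.1.1.rep)).n,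
        emb A B ((dec (((dec (t.1.1.rep ⊙ₗ i.rep)).s p).rep ⊙ᵣ t.2.1.1.rep)).s q) h i f
          (cellEmb A B ((dec (((dec (t.1.1.rep ⊙ₗ i.rep)).s p).rep ⊙ᵣ t.2.1.1.rep)).s q) h i f
            (t.1, t.2.1, (dec (t.1.1.rep ⊙ₗ i.rep)).s p, t.2.2.2)
            (((dec (((dec (t.1.1.rep ⊙ₗ i.rep)).s p).rep ⊙ᵣ t.2.1.1.rep)).incl q ⊗ₜ
              (dec (t.1.1.rep ⊙ₗ i.rep)).incl p) ⊗ₜ y)) ⊗ₜ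
        emb A B c ((dec (((dec (t.1.1.rep ⊙ₗ i.rep)).s p).rep ⊙ᵣ t.2.1.1.rep)).s q) e i
          (cellEmb A B c ((dec (((dec (t.1.1.rep ⊙ₗ i.rep)).s p).rep ⊙ᵣ t.2.1.1.rep)).s q) e i
            (t.1, t.2.1, t.2.2.1, (dec (t.1.1.rep ⊙ₗ i.rep)).s p)
            (x ⊗ₜ ((dec (((dec (t.1.1.rep ⊙ₗ i.rep)).s p).rep ⊙ᵣ t.2.1.1.rep)).proj q ⊗ₜ
              (dec (t.1.1.rep ⊙ₗ i.rep)).proj p))) := by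
  simp only [cellComul, LinearMap.sum_apply]
  rfl

variable [LinearLeftAction C M] [LinearRightAction D M]

lemma emb_cellEmb {c h e f : Irr M} (t : A × B × Irr M × Irr M)
    (z : Cell t.1.1.rep t.2.1.1.rep c.rep t.2.2.1.rep e.rep f.rep t.2.2.2.rep h.rep) :
    emb A B c h e f (cellEmb A B c h e f t z) =
      gen A B t.1.1.rep t.2.1.1.rep c h e f (assemble _ _ _ _ _ _ _ _ z) := by
  rw [gen, LinearMap.comp_apply, expand_assemble]

lemma map_inclTube_cellComul {c h e f : Irr M} (t : A × B × Irr M × Irr M)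
    (z : Cell t.1.1.rep t.2.1.1.rep c.rep t.2.2.1.rep e.rep f.rep t.2.2.2.rep h.rep) :
    TensorProduct.map (inclTube A B) (inclTube A B) (cellComul c h e f t z) =
      cellComul (A := allLabels C) (B := allLabels D) c h e f
        (⟨t.1.1, Finset.mem_univ _⟩, ⟨t.2.1.1, Finset.mem_univ _⟩, t.2.2.1, t.2.2.2) z := by
  induction z using TensorProduct.induction_on with
  | zero => exact (congrArg _ (map_zero _)).trans ((map_zero _).trans (map_zero _).symm)
  | add x y hx hy =>
    exact (congrArg _ (map_add _ x y)).trans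
      ((map_add _ _ _).trans ((congrArg₂ _ hx hy).trans (map_add _ x y).symm))
  | tmul x y =>
    refine Eq.trans ?_ (cellComul_tmul (A := allLabels C) (B := allLabels D)
      (⟨t.1.1, Finset.mem_univ _⟩, ⟨t.2.1.1, Finset.mem_univ _⟩, t.2.2.1, t.2.2.2) x y).symm
    simp only [cellComul_tmul, map_sum, TensorProduct.map_tmul]
    exact Finset.sum_congr rfl fun i _ => Finset.sum_congr rfl fun p _ =>
      Finset.sum_congr rfl fun q _ => congrArg₂ (· ⊗ₜ[ℂ] ·) (inclTube_emb_cellEmb _ _)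
        (inclTube_emb_cellEmb _ _)

/-- Both factors of the coproduct carry the same arcs as the original diagram, so no closure of the
label sets is needed. -/
theorem map_inclTube_tubeComul (x : TubeOn M A B) :
    TensorProduct.map (inclTube A B) (inclTube A B) (tubeComul A B x) =
      tubeComul (allLabels C) (allLabels D) (inclTube A B x) := by
  rw [← sum_emb_comp x]
  simp only [map_sum, tubeComul_emb]
  refine Finset.sum_congr rfl fun c _ => Finset.sum_congr rfl fun h _ =>
    Finset.sum_congr rfl fun e _ => Finset.sum_congr rfl fun f _ => ?_
  rw [inclTube_emb, map_sum]
  refine Finset.sum_congr rfl fun t _ => ?_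
  rw [map_inclTube_cellComul, tubeComul_emb]
  exact (sum_coeff_cellEmb (A := allLabels C) (B := allLabels D)
    (fun t z => cellComul c h e f t z) (fun t => map_zero _)
    (⟨t.1.1, Finset.mem_univ _⟩, ⟨t.2.1.1, Finset.mem_univ _⟩, t.2.2.1, t.2.2.2) _).symm

variable (A B) in
/-- The coproduct of a diagram with arbitrary arcs. -/
def diagComul (X : C) (Y : D) (c h e f : Irr M) :
    Diag X Y c.rep e.rep f.rep h.rep →ₗ[ℂ] TubeOn M A B ⊗[ℂ] TubeOn M A B :=
  ∑ i : Irr M, ∑ q : Fin (dec ((X ⊙ₗ i.rep) ⊙ᵣ Y)).n,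
    TensorProduct.map
      (gen A B X Y ((dec ((X ⊙ₗ i.rep) ⊙ᵣ Y)).s q) h i f ∘ₗ
        TensorProduct.mk ℂ _ _ ((dec ((X ⊙ₗ i.rep) ⊙ᵣ Y)).incl q))
      (gen A B X Y c ((dec ((X ⊙ₗ i.rep) ⊙ᵣ Y)).s q) e i ∘ₗ
        (TensorProduct.mk ℂ _ _).flip ((dec ((X ⊙ₗ i.rep) ⊙ᵣ Y)).proj q)) ∘ₗ
    (TensorProduct.comm ℂ _ _).toLinearMap

lemma diagComul_tmul (X : C) (Y : D) {c h e f : Irr M} (u : c.rep ⟶ (X ⊙ₗ e.rep) ⊙ᵣ Y)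
    (v : (X ⊙ₗ f.rep) ⊙ᵣ Y ⟶ h.rep) :
    diagComul A B X Y c h e f (u ⊗ₜ v) =
      ∑ i : Irr M, ∑ q : Fin (dec ((X ⊙ₗ i.rep) ⊙ᵣ Y)).n,
        gen A B X Y ((dec ((X ⊙ₗ i.rep) ⊙ᵣ Y)).s q) h i f
          ((dec ((X ⊙ₗ i.rep) ⊙ᵣ Y)).incl q ⊗ₜ v) ⊗ₜ
        gen A B X Y c ((dec ((X ⊙ₗ i.rep) ⊙ᵣ Y)).s q) e i
          (u ⊗ₜ (dec ((X ⊙ₗ i.rep) ⊙ᵣ Y)).proj q) := by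
  simp only [diagComul, LinearMap.sum_apply]
  rfl

/-- The summation over a pair of strands `k` of which `diagComul` is built; `α`, `β` are arbitrary
morphisms in place of dual bases. -/
def cutMap {X X' : C} {Y Y' : D} {Z W : M} {c h e f i i' : Irr M}
    (x : W ⟶ (X ⊙ₗ i.rep) ⊙ᵣ Y) (v : (X ⊙ₗ f.rep) ⊙ᵣ Y ⟶ h.rep)
    (u : c.rep ⟶ (X' ⊙ₗ e.rep) ⊙ᵣ Y') (y : (X' ⊙ₗ i'.rep) ⊙ᵣ Y' ⟶ Z) (k : Irr M) :
    (Z ⟶ k.rep) →ₗ[ℂ] (k.rep ⟶ W) →ₗ[ℂ] TubeOn M A B ⊗[ℂ] TubeOn M A B :=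
  LinearMap.mk₂ ℂ (fun α β => gen A B X Y k h i f ((β ≫ x) ⊗ₜ v) ⊗ₜ
      gen A B X' Y' c k e i' (u ⊗ₜ (y ≫ α)))
    (by intros; simp only [Preadditive.comp_add, tmul_add, map_add])
    (by intros; simp only [Linear.comp_smul, tmul_smul, map_smul])
    (by intros; simp only [Preadditive.add_comp, add_tmul, map_add])
    (by intros; simp only [Linear.smul_comp, ← smul_tmul', map_smul])

/-- The morphism travels in three moves: from `v` down to the cut within the first factor, across
the sum over the cut edge by `sum_dec_slide`, and from the cut down to `u` within the second factor.
-/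
lemma slideInvariant_diagComul (c h e f : Irr M) :
    SlideInvariant fun (X : C) (Y : D) => diagComul A B X Y c h e f where
  slide {X X' Y Y'} φ ψ u v := by
    simp only [diagComul_tmul, (slideInvariant_gen _ _ _ _).slide]
    refine Finset.sum_congr rfl fun i _ => ?_
    have H := sum_dec_slide (arcMap φ ψ i.rep) (cutMap (A := A) (B := B) (𝟙 _) v u (𝟙 _))
    simp only [cutMap, LinearMap.mk₂_apply, Category.comp_id, Category.id_comp,
      (slideInvariant_gen _ _ _ _).slide] at H
    exact H

lemma cellComul_eq_sum_gen {a : Irr C} {b : Irr D} (ha : a ∈ A) (hb : b ∈ B)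
    {c d e f g h : Irr M} (μ : c.rep ⟶ d.rep ⊙ᵣ b.rep) (ν : d.rep ⟶ a.rep ⊙ₗ e.rep)
    (γ : g.rep ⊙ᵣ b.rep ⟶ h.rep) (ζ : a.rep ⊙ₗ f.rep ⟶ g.rep) :
    cellComul (A := A) (B := B) c h e f (⟨a, ha⟩, ⟨b, hb⟩, d, g) ((μ ⊗ₜ ν) ⊗ₜ (γ ⊗ₜ ζ)) =
      ∑ i : Irr M, ∑ p : Fin (dec (a.rep ⊙ₗ i.rep)).n,
      ∑ q : Fin (dec (((dec (a.rep ⊙ₗ i.rep)).s p).rep ⊙ᵣ b.rep)).n,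
        gen A B a.rep b.rep ((dec (((dec (a.rep ⊙ₗ i.rep)).s p).rep ⊙ᵣ b.rep)).s q) h i f
          (((dec (((dec (a.rep ⊙ₗ i.rep)).s p).rep ⊙ᵣ b.rep)).incl q ≫
            (dec (a.rep ⊙ₗ i.rep)).incl p ⊵ᵣ b.rep) ⊗ₜ (ζ ⊵ᵣ b.rep ≫ γ)) ⊗ₜ
        gen A B a.rep b.rep c ((dec (((dec (a.rep ⊙ₗ i.rep)).s p).rep ⊙ᵣ b.rep)).s q) e i
          ((μ ≫ ν ⊵ᵣ b.rep) ⊗ₜ ((dec (a.rep ⊙ₗ i.rep)).proj p ⊵ᵣ b.rep ≫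
            (dec (((dec (a.rep ⊙ₗ i.rep)).s p).rep ⊙ᵣ b.rep)).proj q)) := by
  rw [cellComul_tmul]
  refine Finset.sum_congr rfl fun i _ => Finset.sum_congr rfl fun p _ =>
    Finset.sum_congr rfl fun q _ => ?_
  rw [emb_cellEmb, emb_cellEmb, assemble_tmul, assemble_tmul]

/-- The coproduct cuts a strand in two stages, through `a ⊙ i` and then through `j ⊙ b`. Together
these resolve the identity of `(a ⊙ i) ⊙ b`, and any other decomposition of that object gives the
same element. -/
lemma cellComul_eq_diagComul {c h e f : Irr M} (t : A × B × Irr M × Irr M)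
    (z : Cell t.1.1.rep t.2.1.1.rep c.rep t.2.2.1.rep e.rep f.rep t.2.2.2.rep h.rep) :
    cellComul c h e f t z =
      diagComul A B t.1.1.rep t.2.1.1.rep c h e f (assemble _ _ _ _ _ _ _ _ z) := by
  induction z using TensorProduct.induction_on with
  | zero => simp
  | add x y hx hy => rw [map_add, map_add, map_add, hx, hy]
  | tmul x y =>
    induction x using TensorProduct.induction_on with
    | zero => simp
    | add x x' hx hx' => rw [add_tmul, map_add, map_add, map_add, hx, hx']
    | tmul μ ν =>
      induction y using TensorProduct.induction_on with
      | zero => simp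
      | add x x' hx hx' => rw [tmul_add, map_add, map_add, map_add, hx, hx']
      | tmul γ ζ =>
        obtain ⟨⟨a, ha⟩, ⟨b, hb⟩, d, g⟩ := t
        rw [cellComul_eq_sum_gen, assemble_tmul, diagComul_tmul]
        refine Finset.sum_congr rfl fun i _ => ?_
        -- For fixed `p`, sliding along the included summand replaces the decomposition of `j ⊙ b`
        -- by that of `(a ⊙ i) ⊙ b`; the sum over `p` is then an identity.
        have H (p) := sum_dec_slide ((dec (a.rep ⊙ₗ i.rep)).incl p ⊵ᵣ b.rep)
          (cutMap (A := A) (B := B) (c := c) (h := h) (e := e) (f := f) (i := i) (i' := i)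
            (X := a.rep) (Y := b.rep) (X' := a.rep) (Y' := b.rep)
            (𝟙 _) (ζ ⊵ᵣ b.rep ≫ γ) (μ ≫ ν ⊵ᵣ b.rep)
            ((dec (a.rep ⊙ₗ i.rep)).proj p ⊵ᵣ b.rep))
        simp only [cutMap, LinearMap.mk₂_apply, Category.comp_id] at H
        refine (Finset.sum_congr rfl fun p _ => H p).trans ?_
        rw [Finset.sum_comm]
        refine Finset.sum_congr rfl fun q _ => ?_
        simp only [← tmul_sum, ← map_sum, ← Category.assoc, ← Preadditive.sum_comp,
          ← MonoidalRightAction.comp_actionHomLeft, ← whisker_sum, SimpleDecomp.sum_proj_incl]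
        simp

theorem tubeComul_gen {X : C} {Y : D} (hX : LabelsIn A X) (hY : LabelsIn B Y) {c h e f : Irr M}
    (x : Diag X Y c.rep e.rep f.rep h.rep) :
    tubeComul A B (gen A B X Y c h e f x) = diagComul A B X Y c h e f x := by
  rw [← (slideInvariant_diagComul (A := A) (B := B) c h e f).sum_toDiag_expand hX hY x, gen,
    LinearMap.comp_apply, tubeComul_emb]
  simp only [cellComul_eq_diagComul]
  rfl

variable [BimoduleCategory C D M]

lemma strand_sum {ι : Type*} (s : Finset ι) (X : C) (Y : D) {m m' : M} (g : ι → (m ⟶ m')) :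
    (X ⊴ₗ (∑ i ∈ s, g i)) ⊵ᵣ Y = ∑ i ∈ s, (X ⊴ₗ g i) ⊵ᵣ Y :=
  map_sum (IsLinearMap.mk' (R := ℂ) (fun g : m ⟶ m' => (X ⊴ₗ g) ⊵ᵣ Y)
    ⟨fun g g' => by
      rw [LinearLeftAction.actionHomRight_add, LinearRightAction.add_actionHomLeft],
      fun r g => by
      rw [LinearLeftAction.actionHomRight_smul, LinearRightAction.smul_actionHomLeft]⟩) g s

/-- Cutting a stacked diagram amounts to cutting the inner diagram, which creates an edge, and then
cutting the outer diagram around that edge. -/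
lemma diagComul_stack {X X' : C} {Y Y' : D} {c h m n e f : Irr M}
    (u : c.rep ⟶ (X ⊙ₗ m.rep) ⊙ᵣ Y) (v : (X ⊙ₗ n.rep) ⊙ᵣ Y ⟶ h.rep)
    (u' : m.rep ⟶ (X' ⊙ₗ e.rep) ⊙ᵣ Y') (v' : (X' ⊙ₗ f.rep) ⊙ᵣ Y' ⟶ n.rep) :
    TensorProduct.map₂ (tubeMul (allLabels C) (allLabels D)) (tubeMul (allLabels C) (allLabels D))
        (diagComul _ _ X Y c h m n (u ⊗ₜ v)) (diagComul _ _ X' Y' m n e f (u' ⊗ₜ v')) =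
      diagComul _ _ (X ⊗ X') (Y' ⊗ Y) c h e f
        (stack _ _ _ _ _ _ _ _ _ _ (u ⊗ₜ v) (u' ⊗ₜ v')) := by
  simp only [diagComul_tmul, stack_tmul, map_sum, LinearMap.sum_apply,
    TensorProduct.map₂_apply_tmul, TensorProduct.map_tmul]
  refine Finset.sum_congr rfl fun i _ => ?_
  have H (q : Fin (dec ((X' ⊙ₗ i.rep) ⊙ᵣ Y')).n) :=
    sum_dec_slide ((X ⊴ₗ (dec ((X' ⊙ₗ i.rep) ⊙ᵣ Y')).incl q) ⊵ᵣ Y ≫ (stackIso X X' Y Y' i.rep).hom)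
    (cutMap (A := allLabels C) (B := allLabels D) (X := X ⊗ X') (Y := Y' ⊗ Y)
      (X' := X ⊗ X') (Y' := Y' ⊗ Y) (𝟙 _)
      ((stackIso X X' Y Y' f.rep).inv ≫ (X ⊴ₗ v') ⊵ᵣ Y ≫ v)
      (u ≫ (X ⊴ₗ u') ⊵ᵣ Y ≫ (stackIso X X' Y Y' e.rep).hom)
      ((stackIso X X' Y Y' i.rep).inv ≫ (X ⊴ₗ (dec ((X' ⊙ₗ i.rep) ⊙ᵣ Y')).proj q) ⊵ᵣ Y))
  simp only [cutMap, LinearMap.mk₂_apply, Category.comp_id, Category.assoc] at H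
  -- Only the terms survive in which the new inner edge of the outer diagram is the cut edge of the
  -- inner one. Then `H` transports the outer cut to the decomposition for the fused arcs, and the
  -- sum over `q` becomes an identity.
  trans ∑ q : Fin (dec ((X' ⊙ₗ i.rep) ⊙ᵣ Y')).n, ∑ k,
        (gen (allLabels C) (allLabels D) (X ⊗ X') (Y' ⊗ Y)
          ((dec (((X ⊗ X') ⊙ₗ i.rep) ⊙ᵣ Y' ⊗ Y)).s k) h i f)
            ((dec (((X ⊗ X') ⊙ₗ i.rep) ⊙ᵣ Y' ⊗ Y)).incl k ⊗ₜ[ℂ]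
              ((stackIso X X' Y Y' f.rep).inv ≫ (X ⊴ₗ v') ⊵ᵣ Y ≫ v)) ⊗ₜ[ℂ]
          (gen (allLabels C) (allLabels D) (X ⊗ X') (Y' ⊗ Y) c
            ((dec (((X ⊗ X') ⊙ₗ i.rep) ⊙ᵣ Y' ⊗ Y)).s k) e i)
            ((u ≫ (X ⊴ₗ u') ⊵ᵣ Y ≫ (stackIso X X' Y Y' e.rep).hom) ⊗ₜ[ℂ]
              ((stackIso X X' Y Y' i.rep).inv ≫
                (X ⊴ₗ ((dec ((X' ⊙ₗ i.rep) ⊙ᵣ Y')).proj q ≫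
                  (dec ((X' ⊙ₗ i.rep) ⊙ᵣ Y')).incl q)) ⊵ᵣ Y ≫
                    (stackIso X X' Y Y' i.rep).hom ≫
                    (dec (((X ⊗ X') ⊙ₗ i.rep) ⊙ᵣ Y' ⊗ Y)).proj k))
  · refine Finset.sum_congr rfl fun q _ => ?_
    rw [Finset.sum_eq_single ((dec ((X' ⊙ₗ i.rep) ⊙ᵣ Y')).s q)]
    · simp only [tubeMul_gen_all, stack_tmul, H, MonoidalLeftAction.actionHomRight_comp,
        MonoidalRightAction.comp_actionHomLeft, Category.assoc]
    · intro j _ hj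
      refine Finset.sum_eq_zero fun k _ => ?_
      rw [tubeMul_gen_of_ne (by simp [hj]), zero_tmul]
    · simp
  · rw [Finset.sum_comm]
    refine Finset.sum_congr rfl fun k _ => ?_
    simp only [← tmul_sum, ← map_sum, ← Preadditive.comp_sum, ← Preadditive.sum_comp,
      ← strand_sum, SimpleDecomp.sum_proj_incl]
    simp

end Coproduct

/-! ### The counit of tube diagrams -/

section Counit

/-- The trace of the identity on the endomorphisms of a simple object is their dimension, which is
one over `ℂ`. -/
lemma endScalar_smul_id {M : Type*} [Category* M] [Abelian M] [Linear ℂ M] [IsFiniteSemisimple M]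
    (c : Irr M) (r : ℂ) : endScalar c.rep (r • 𝟙 c.rep) = r := by
  have := IsFiniteSemisimple.finiteDimensional_hom c.rep c.rep
  have h : Linear.leftComp ℂ c.rep (𝟙 c.rep) = LinearMap.id := by ext; simp
  rw [map_smul]
  simp only [endScalar, LinearMap.coe_mk, AddHom.coe_mk, h, LinearMap.trace_id,
    finrank_endomorphism_simple_eq_one]
  simp

variable {C D M : Type*} [Category* C] [Abelian C] [Linear ℂ C] [MonoidalCategory C]
  [Category* D] [Abelian D] [Linear ℂ D] [MonoidalCategory D]
  [Category* M] [Abelian M] [Linear ℂ M]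
  [MonoidalLeftAction C M] [MonoidalRightAction D M]
  [IsFiniteSemisimple C] [IsFiniteSemisimple D] [IsFiniteSemisimple M]
  {A : Finset (Irr C)} {B : Finset (Irr D)}

/-- The counit on a single vertex space. -/
def cellCounit (a : Irr C) (b : Irr D) (c d e : Irr M) :
    Cell a.rep b.rep c.rep d.rep e.rep e.rep d.rep c.rep →ₗ[ℂ] ℂ :=
  LinearMap.mul' ℂ ℂ ∘ₗ
  TensorProduct.map
    (TensorProduct.lift (LinearMap.mk₂ ℂ
      (fun (μ : c.rep ⟶ d.rep ⊙ᵣ b.rep) (γ : d.rep ⊙ᵣ b.rep ⟶ c.rep) =>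
        endScalar c.rep (μ ≫ γ))
      (by intros; simp) (by intros; simp) (by intros; simp) (by intros; simp)))
    (TensorProduct.lift (LinearMap.mk₂ ℂ
      (fun (ν : d.rep ⟶ a.rep ⊙ₗ e.rep) (ζ : a.rep ⊙ₗ e.rep ⟶ d.rep) =>
        endScalar d.rep (ν ≫ ζ))
      (by intros; simp) (by intros; simp) (by intros; simp) (by intros; simp))) ∘ₗ
  (TensorProduct.tensorTensorTensorComm ℂ _ _ _ _).toLinearMap

lemma tubeCounit_apply (x : TubeOn M A B) :
    tubeCounit A B x = ∑ c, ∑ e, ∑ a : A, ∑ b : B, ∑ d,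
      cellCounit a.1 b.1 c d e (coeff A B c c e e (a, b, d, d) (comp A B c c e e x)) := by
  simp only [tubeCounit, LinearMap.sum_apply]
  rfl

lemma tubeCounit_emb_of_ne {c h e f : Irr M} (hne : (c, e) ≠ (h, f))
    (x : TubeComp M A B c h e f) : tubeCounit A B (emb A B c h e f x) = 0 := by
  rw [tubeCounit_apply]
  refine Finset.sum_eq_zero fun c' _ => Finset.sum_eq_zero fun e' _ => ?_
  rw [comp_emb_of_ne fun H => hne ?_]
  · simp
  · simp only [Prod.mk.injEq] at H ⊢
    exact ⟨H.1.symm.trans H.2.1, H.2.2.1.symm.trans H.2.2.2⟩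

lemma tubeCounit_emb {c e : Irr M} (x : TubeComp M A B c c e e) :
    tubeCounit A B (emb A B c c e e x) = ∑ a : A, ∑ b : B, ∑ d,
      cellCounit a.1 b.1 c d e (coeff A B c c e e (a, b, d, d) x) := by
  rw [tubeCounit_apply, Finset.sum_eq_single c, Finset.sum_eq_single e, comp_emb_self]
  any_goals simp
  · intro e' he
    rw [comp_emb_of_ne (by simp [he])]
    simp
  · intro c' hc
    refine Finset.sum_eq_zero fun e' _ => ?_
    rw [comp_emb_of_ne (by simp [hc])]
    simp

/-- The scalar of the endomorphism obtained by closing a diagram with equal edges. -/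
def diagCounit (X : C) (Y : D) (c e : Irr M) : Diag X Y c.rep e.rep e.rep c.rep →ₗ[ℂ] ℂ :=
  TensorProduct.lift (LinearMap.mk₂ ℂ (fun u v => endScalar c.rep (u ≫ v))
    (by intros; simp) (by intros; simp) (by intros; simp) (by intros; simp))

@[simp]
lemma diagCounit_tmul {X : C} {Y : D} {c e : Irr M} (u : c.rep ⟶ (X ⊙ₗ e.rep) ⊙ᵣ Y)
    (v : (X ⊙ₗ e.rep) ⊙ᵣ Y ⟶ c.rep) :
    diagCounit X Y c e (u ⊗ₜ v) = endScalar c.rep (u ≫ v) := rfl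

variable [LinearLeftAction C M] [LinearRightAction D M]

lemma slideInvariant_diagCounit (c e : Irr M) :
    SlideInvariant fun (X : C) (Y : D) => diagCounit X Y c e where
  slide φ ψ u v := by simp

lemma endScalar_comp_comp {m : M} {b : D} {c d g : Irr M} (μ : c.rep ⟶ d.rep ⊙ᵣ b)
    (ν : d.rep ⟶ m) (γ : g.rep ⊙ᵣ b ⟶ c.rep) (ζ : m ⟶ g.rep) (hdg : d ≠ g) :
    endScalar c.rep ((μ ≫ ν ⊵ᵣ b) ≫ ζ ⊵ᵣ b ≫ γ) = 0 := by
  have h : (0 : d.rep ⟶ g.rep) ⊵ᵣ b = 0 := by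
    simpa using LinearRightAction.smul_actionHomLeft (0 : ℂ) (0 : d.rep ⟶ g.rep) b
  rw [Category.assoc, ← MonoidalRightAction.comp_actionHomLeft_assoc,
    Irr.hom_eq_zero hdg (ν ≫ ζ), h]
  simp

/-- By Schur's lemma the inner endomorphism `ν ≫ ζ` is a scalar, which comes out of the whiskering.
Hence the product of two scalars in the counit is the scalar of one closed diagram. -/
lemma endScalar_comp_comp_self {m : M} {b : D} {c d : Irr M} (μ : c.rep ⟶ d.rep ⊙ᵣ b)
    (ν : d.rep ⟶ m) (γ : d.rep ⊙ᵣ b ⟶ c.rep) (ζ : m ⟶ d.rep) :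
    endScalar c.rep ((μ ≫ ν ⊵ᵣ b) ≫ ζ ⊵ᵣ b ≫ γ) =
      endScalar c.rep (μ ≫ γ) * endScalar d.rep (ν ≫ ζ) := by
  obtain ⟨r, hr⟩ := Irr.exists_smul_id (ν ≫ ζ)
  rw [Category.assoc, ← MonoidalRightAction.comp_actionHomLeft_assoc, hr, endScalar_smul_id,
    LinearRightAction.smul_actionHomLeft]
  simp [mul_comm]

lemma tubeCounit_emb_cellEmb {c e : Irr M} (t : A × B × Irr M × Irr M)
    (z : Cell t.1.1.rep t.2.1.1.rep c.rep t.2.2.1.rep e.rep e.rep t.2.2.2.rep c.rep) :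
    tubeCounit A B (emb A B c c e e (cellEmb A B c c e e t z)) =
      diagCounit _ _ c e (assemble _ _ _ _ _ _ _ _ z) := by
  rw [tubeCounit_emb]
  obtain ⟨a, b, d, g⟩ := t
  by_cases hdg : d = g
  · subst hdg
    rw [Finset.sum_eq_single a, Finset.sum_eq_single b, Finset.sum_eq_single d,
      coeff_cellEmb_self]
    any_goals simp
    · induction z using TensorProduct.induction_on with
      | zero => simp
      | add x y hx hy => rw [map_add, map_add, map_add, hx, hy]
      | tmul x y =>
        induction x using TensorProduct.induction_on with
        | zero => simp
        | add x x' hx hx' => rw [add_tmul, map_add, map_add, map_add, hx, hx']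
        | tmul μ ν =>
          induction y using TensorProduct.induction_on with
          | zero => simp
          | add x x' hx hx' => rw [tmul_add, map_add, map_add, map_add, hx, hx']
          | tmul γ ζ =>
            exact (endScalar_comp_comp_self μ ν γ ζ).symm
    · intro d' hd
      rw [coeff_cellEmb_of_ne (by simp [hd]), map_zero]
    · intro b' hb' hb
      refine Finset.sum_eq_zero fun d' _ => ?_
      rw [coeff_cellEmb_of_ne (fun H => hb (congrArg (fun t => t.2.1) H)), map_zero]
    · intro a' ha' ha
      refine Finset.sum_eq_zero fun b' _ => Finset.sum_eq_zero fun d' _ => ?_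
      rw [coeff_cellEmb_of_ne (fun H => ha (congrArg (fun t => t.1) H)), map_zero]
  · trans 0
    · refine Finset.sum_eq_zero fun a' _ => Finset.sum_eq_zero fun b' _ =>
        Finset.sum_eq_zero fun d' _ => ?_
      rw [coeff_cellEmb_of_ne (fun H => hdg ?_), map_zero]
      simp only [Prod.mk.injEq] at H
      exact H.2.2.1.symm.trans H.2.2.2
    · symm
      induction z using TensorProduct.induction_on with
      | zero => simp
      | add x y hx hy => rw [map_add, map_add, hx, hy, add_zero]
      | tmul x y =>
        induction x using TensorProduct.induction_on with
        | zero => simp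
        | add x x' hx hx' => rw [add_tmul, map_add, map_add, hx, hx', add_zero]
        | tmul μ ν =>
          induction y using TensorProduct.induction_on with
          | zero => simp
          | add x x' hx hx' => rw [tmul_add, map_add, map_add, hx, hx', add_zero]
          | tmul γ ζ => exact endScalar_comp_comp μ ν γ ζ hdg

lemma tubeCounit_gen {X : C} {Y : D} (hX : LabelsIn A X) (hY : LabelsIn B Y) {c e : Irr M}
    (x : Diag X Y c.rep e.rep e.rep c.rep) :
    tubeCounit A B (gen A B X Y c c e e x) = diagCounit X Y c e x := by
  rw [← (slideInvariant_diagCounit c e).sum_toDiag_expand hX hY x, gen, LinearMap.comp_apply]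
  conv_lhs => rw [← sum_cellEmb_coeff (expand A B X Y c c e e x), map_sum, map_sum]
  simp only [tubeCounit_emb_cellEmb]
  rfl

lemma tubeCounit_gen_of_ne {X : C} {Y : D} {c h e f : Irr M} (hne : (c, e) ≠ (h, f))
    (x : Diag X Y c.rep e.rep f.rep h.rep) :
    tubeCounit A B (gen A B X Y c h e f x) = 0 :=
  tubeCounit_emb_of_ne hne _

theorem tubeCounit_inclTube (x : TubeOn M A B) :
    tubeCounit (allLabels C) (allLabels D) (inclTube A B x) = tubeCounit A B x := by
  induction x using tubeOn_induction with
  | zero => simp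
  | add x x' hx hx' => simp only [map_add, hx, hx']
  | gen a ha b hb c h e f u v =>
  rw [inclTube_gen (labelsIn_rep ha) (labelsIn_rep hb)]
  by_cases hne : (c, e) = (h, f)
  · simp only [Prod.mk.injEq] at hne
    obtain ⟨rfl, rfl⟩ := hne
    rw [tubeCounit_gen (labelsIn_univ _) (labelsIn_univ _),
      tubeCounit_gen (labelsIn_rep ha) (labelsIn_rep hb)]
  · rw [tubeCounit_gen_of_ne hne, tubeCounit_gen_of_ne hne]

theorem inclTube_isSub [BimoduleCategory C D M] (hA : FusionClosed A) (hB : FusionClosed B) :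
    (tubeData (M := M) A B).IsSub (tubeData (allLabels C) (allLabels D)) (inclTube A B) where
  map_mul := inclTube_mul hA hB
  map_one := inclTube_one hA hB
  map_comul := map_inclTube_tubeComul
  map_counit := tubeCounit_inclTube
  injective := inclTube_injective

end Counit

/-! ### Diagrams with one dotted arc -/

section Crossed

variable {C D M : Type*} [Category* C] [Abelian C] [Linear ℂ C] [MonoidalCategory C]
  [Category* D] [Abelian D] [Linear ℂ D] [MonoidalCategory D]
  [Category* M] [Abelian M] [Linear ℂ M]
  [MonoidalLeftAction C M] [MonoidalRightAction D M]
  [LinearLeftAction C M] [LinearRightAction D M]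

variable (C) in
/-- Insert a left arc labelled by the tensor unit. -/
def padR (b : D) (c d g h : M) : HalfR b c d g h →ₗ[ℂ] Diag (𝟙_ C) b c d g h :=
  TensorProduct.map (Linear.rightComp ℂ c ((λₗ[C] d).inv ⊵ᵣ b))
    (Linear.leftComp ℂ h ((λₗ[C] g).hom ⊵ᵣ b))

variable (D) in
/-- Insert a right arc labelled by the tensor unit. -/
def padL (a : C) (d e f g : M) : HalfL a d e f g →ₗ[ℂ] Diag a (𝟙_ D) d e f g :=
  TensorProduct.map (Linear.rightComp ℂ d (ρᵣ[D] (a ⊙ₗ e)).inv)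
    (Linear.leftComp ℂ g (ρᵣ[D] (a ⊙ₗ f)).hom)

@[simp]
lemma padR_tmul (b : D) {c d g h : M} (μ : c ⟶ d ⊙ᵣ b) (γ : g ⊙ᵣ b ⟶ h) :
    padR C b c d g h (μ ⊗ₜ γ) = (μ ≫ (λₗ[C] d).inv ⊵ᵣ b) ⊗ₜ ((λₗ[C] g).hom ⊵ᵣ b ≫ γ) := rfl

@[simp]
lemma padL_tmul (a : C) {d e f g : M} (ν : d ⟶ a ⊙ₗ e) (ζ : a ⊙ₗ f ⟶ g) :
    padL D a d e f g (ν ⊗ₜ ζ) =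
      (ν ≫ (ρᵣ[D] (a ⊙ₗ e)).inv) ⊗ₜ ((ρᵣ[D] (a ⊙ₗ f)).hom ≫ ζ) := rfl

variable [IsFiniteSemisimple C] [IsFiniteSemisimple D] [IsFiniteSemisimple M]

/-- Replacing a dotted arc `𝟙ᵢ` by the full unit puts `unitIncl` on the lower strand and `unitProj`
on the upper one. Sliding the projection down makes them compose to the identity. -/
lemma SlideInvariant.padR_stripR {c h d g : Irr M} {V : Type*} [AddCommGroup V] [Module ℂ V]
    {T : ∀ (X : C) (Y : D), Diag X Y c.rep d.rep g.rep h.rep →ₗ[ℂ] V} (hT : SlideInvariant T)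
    (t : unitLabels C × (allLabels D) × Irr M × Irr M) (r : RComp C D M c h d g) :
    T _ _ (padR C _ _ _ _ _ (stripR c h d g t r)) = T _ _ (toDiag _ _ c h d g t r) := by
  rw [stripR, LinearMap.comp_apply]
  generalize toDiag _ _ c h d g t r = z
  induction z using TensorProduct.induction_on with
  | zero => simp
  | add x y hx hy => simp only [map_add, hx, hy]
  | tmul u v =>
    have hu := hT.slide (unitProj t.1) (𝟙 t.2.1.1.rep) (u ≫ arcMap (unitIncl t.1) (𝟙 _) d.rep) v
    rw [Category.assoc, ← arcMap_comp, unitIncl_unitProj, Category.id_comp, arcMap_id,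
      Category.comp_id] at hu
    rw [← hu]
    simp [arcMap, ← MonoidalRightAction.comp_actionHomLeft_assoc,
      ← MonoidalRightAction.comp_actionHomLeft]

lemma SlideInvariant.padL_stripL {d g e f : Irr M} {V : Type*} [AddCommGroup V] [Module ℂ V]
    {T : ∀ (X : C) (Y : D), Diag X Y d.rep e.rep f.rep g.rep →ₗ[ℂ] V} (hT : SlideInvariant T)
    (t : (allLabels C) × unitLabels D × Irr M × Irr M) (l : LComp C D M d g e f) :
    T _ _ (padL D _ _ _ _ _ (stripL d g e f t l)) = T _ _ (toDiag _ _ d g e f t l) := by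
  rw [stripL, LinearMap.comp_apply]
  generalize toDiag _ _ d g e f t l = z
  induction z using TensorProduct.induction_on with
  | zero => simp
  | add x y hx hy => simp only [map_add, hx, hy]
  | tmul u v =>
    have hu := hT.slide (𝟙 t.1.1.rep) (unitProj t.2.1) (u ≫ arcMap (𝟙 _) (unitIncl t.2.1) e.rep) v
    rw [Category.assoc, ← arcMap_comp, unitIncl_unitProj, Category.id_comp, arcMap_id,
      Category.comp_id] at hu
    rw [← hu]
    simp only [TensorProduct.map_tmul, Linear.rightComp_apply, Linear.leftComp_apply, padL_tmul,
      Category.assoc, Iso.hom_inv_id, Iso.hom_inv_id_assoc, Category.comp_id, arcMap,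
      MonoidalLeftAction.id_actionHomLeft, MonoidalRightAction.id_actionHomLeft, Category.id_comp]

lemma sum_expand_padR {c h d g : Irr M} (r : RComp C D M c h d g) :
    ∑ t, expand (unitLabels C) (allLabels D) (𝟙_ C) t.2.1.1.rep c h d g
      (padR C _ _ _ _ _ (stripR c h d g t r)) = r := by
  simp only [(slideInvariant_expand _ _ _ _ _ _).padR_stripR, sum_expand_toDiag]

lemma sum_expand_padL {d g e f : Irr M} (l : LComp C D M d g e f) :
    ∑ t, expand (allLabels C) (unitLabels D) t.1.1.rep (𝟙_ D) d g e f
      (padL D _ _ _ _ _ (stripL d g e f t l)) = l := by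
  simp only [(slideInvariant_expand _ _ _ _ _ _).padL_stripL, sum_expand_toDiag]

variable (C) in
/-- The element of `R(M_D)` represented by a diagram with a right arc only. -/
def genR (b : D) (c h d g : Irr M) :
    HalfR b c.rep d.rep g.rep h.rep →ₗ[ℂ] RComp C D M c h d g :=
  expand (unitLabels C) (allLabels D) (𝟙_ C) b c h d g ∘ₗ padR C _ _ _ _ _

variable (D) in
/-- The element of `L(_C M)` represented by a diagram with a left arc only. -/
def genL (a : C) (d g e f : Irr M) :
    HalfL a d.rep e.rep f.rep g.rep →ₗ[ℂ] LComp C D M d g e f :=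
  expand (allLabels C) (unitLabels D) a (𝟙_ D) d g e f ∘ₗ padL D _ _ _ _ _

lemma sum_genR {c h d g : Irr M} (r : RComp C D M c h d g) :
    ∑ t, genR C t.2.1.1.rep c h d g (stripR c h d g t r) = r := sum_expand_padR r

lemma sum_genL {d g e f : Irr M} (l : LComp C D M d g e f) :
    ∑ t, genL D t.1.1.rep d g e f (stripL d g e f t l) = l := sum_expand_padL l

lemma inclTube_genR (b : D) {c h d g : Irr M} (x : HalfR b c.rep d.rep g.rep h.rep) :
    inclTube (unitLabels C) (allLabels D) (emb _ _ c h d g (genR C b c h d g x)) =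
      gen _ _ (𝟙_ C) b c h d g (padR C _ _ _ _ _ x) :=
  inclTube_gen labelsIn_unit (labelsIn_univ _) _

lemma inclTube_genL (a : C) {d g e f : Irr M} (y : HalfL a d.rep e.rep f.rep g.rep) :
    inclTube (allLabels C) (unitLabels D) (emb _ _ d g e f (genL D a d g e f y)) =
      gen _ _ a (𝟙_ D) d g e f (padL D _ _ _ _ _ y) :=
  inclTube_gen (labelsIn_univ _) labelsIn_unit _

variable [BimoduleCategory C D M]

variable {A : Finset (Irr C)} {B : Finset (Irr D)}

/-- The unit arcs are absorbed by sliding left unitors on both fused arcs. By `stackIso_right_left`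
nothing else remains. -/
lemma gen_stack_padR_padL (a : C) (b : D) {c d g h e f : Irr M}
    (x : HalfR b c.rep d.rep g.rep h.rep) (y : HalfL a d.rep e.rep f.rep g.rep) :
    gen A B _ _ c h e f (stack _ _ _ _ _ _ _ _ _ _ (padR C b _ _ _ _ x) (padL D a _ _ _ _ y)) =
      gen A B a b c h e f (assemble a b _ _ _ _ _ _
        (TensorProduct.tensorTensorTensorComm ℂ _ _ _ _ (x ⊗ₜ y))) := by
  induction x using TensorProduct.induction_on with
  | zero => simp
  | add x x' hx hx' => simp only [map_add, LinearMap.add_apply, add_tmul, hx, hx']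
  | tmul μ γ =>
    induction y using TensorProduct.induction_on with
    | zero => simp
    | add y y' hy hy' => simp only [map_add, tmul_add, hy, hy']
    | tmul ν ζ =>
      have H := (slideInvariant_gen (A := A) (B := B) c h e f).slide (λ_ a).hom (λ_ b).hom
      have h₁ {m m' : M} (k : m ⟶ m') :
          (𝟙_ C ⊴ₗ k) ⊵ᵣ b ≫ (λₗ[C] m').hom ⊵ᵣ b = (λₗ[C] m).hom ⊵ᵣ b ≫ k ⊵ᵣ b := by
        rw [← MonoidalRightAction.comp_actionHomLeft, ← MonoidalRightAction.comp_actionHomLeft,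
          MonoidalLeftAction.actionUnitIso_hom_naturality]
      have h₂ : (stackIso (𝟙_ C) a b (𝟙_ D) f.rep).inv ≫ (λₗ[C] _).hom ⊵ᵣ b ≫
          (ρᵣ[D] _).hom ⊵ᵣ b = arcMap (λ_ a).hom (λ_ b).hom f.rep := by
        rw [Iso.inv_comp_eq, stackIso_right_left, MonoidalRightAction.comp_actionHomLeft]
      simp only [padR_tmul, padL_tmul, stack_tmul, Category.assoc,
        TensorProduct.tensorTensorTensorComm_tmul, assemble_tmul, reassoc_of% h₁]
      simp only [MonoidalRightAction.comp_actionHomLeft, Category.assoc]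
      rw [reassoc_of% h₂, H]
      simp only [Category.assoc, stackIso_right_left, MonoidalRightAction.comp_actionHomLeft,
        reassoc_of% h₁, MonoidalRightAction.inv_hom_actionHomLeft_assoc,
        MonoidalRightAction.inv_hom_actionHomLeft, Category.comp_id]

/-- Here right unitors slide, and `stackIso_left_right` leaves the middle associator on both
strands. -/
lemma gen_stack_padL_padR (a : C) (b : D) {d g m n e f : Irr M}
    (y : HalfL a d.rep m.rep n.rep g.rep) (x : HalfR b m.rep e.rep f.rep n.rep) :
    gen A B _ _ d g e f (stack _ _ _ _ _ _ _ _ _ _ (padL D a _ _ _ _ y) (padR C b _ _ _ _ x)) =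
      gen A B a b d g e f (slide a b _ _ _ _ _ _ y x) := by
  induction x using TensorProduct.induction_on with
  | zero => simp
  | add x x' hx hx' => simp only [map_add, hx, hx']
  | tmul μ γ =>
    induction y using TensorProduct.induction_on with
    | zero => simp
    | add y y' hy hy' => simp only [map_add, LinearMap.add_apply, hy, hy']
    | tmul ν ζ =>
      have H := (slideInvariant_gen (A := A) (B := B) d g e f).slide (ρ_ a).hom (ρ_ b).hom
      have h₂ : (stackIso a (𝟙_ C) (𝟙_ D) b f.rep).inv ≫ (ρᵣ[D] _).hom ≫
          a ⊴ₗ ((λₗ[C] f.rep).hom ⊵ᵣ b) = arcMap (ρ_ a).hom (ρ_ b).hom f.rep ≫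
          (BimoduleCategory.midAssoc a f.rep b).hom := by
        rw [Iso.inv_comp_eq, reassoc_of% stackIso_left_right]
        simp
      have h₃ : slide a b _ _ _ _ _ _ (ν ⊗ₜ ζ) (μ ⊗ₜ γ) =
        (ν ≫ (a ⊴ₗ μ) ≫ (BimoduleCategory.midAssoc a e.rep b).inv) ⊗ₜ
          ((BimoduleCategory.midAssoc a f.rep b).hom ≫ (a ⊴ₗ γ) ≫ ζ) := rfl
      simp only [padR_tmul, padL_tmul, stack_tmul, Category.assoc, h₃,
        ← MonoidalRightAction.actionUnitIso_hom_naturality_assoc]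
      simp only [MonoidalLeftAction.actionHomRight_comp, Category.assoc]
      rw [reassoc_of% h₂, H]
      simp only [Category.assoc, stackIso_left_right]
      rw [← MonoidalLeftAction.actionHomRight_comp,
        ← MonoidalRightAction.actionUnitIso_hom_naturality_assoc, Iso.inv_hom_id_assoc]
      simp only [← MonoidalLeftAction.actionHomRight_comp_assoc, Category.assoc,
        MonoidalRightAction.inv_hom_actionHomLeft, Category.comp_id]

end Crossed

/-! ### The gluing map -/

section Gluing

lemma tensorTensorTensorComm_involutive {V₁ V₂ V₃ V₄ : Type*} [AddCommGroup V₁] [Module ℂ V₁]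
    [AddCommGroup V₂] [Module ℂ V₂] [AddCommGroup V₃] [Module ℂ V₃] [AddCommGroup V₄] [Module ℂ V₄]
    (z : (V₁ ⊗[ℂ] V₂) ⊗[ℂ] (V₃ ⊗[ℂ] V₄)) :
    TensorProduct.tensorTensorTensorComm ℂ _ _ _ _
      (TensorProduct.tensorTensorTensorComm ℂ _ _ _ _ z) = z :=
  LinearEquiv.congr_fun
    (TensorProduct.tensorTensorTensorComm_trans_tensorTensorTensorComm ..) z

variable {C D M : Type*} [Category* C] [Abelian C] [Linear ℂ C] [MonoidalCategory C]
  [Category* D] [Abelian D] [Linear ℂ D] [MonoidalCategory D]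
  [Category* M] [Abelian M] [Linear ℂ M]
  [MonoidalLeftAction C M] [MonoidalRightAction D M]
  [IsFiniteSemisimple C] [IsFiniteSemisimple D] [IsFiniteSemisimple M]

lemma crossedComp_emb_self {c h d g e f : Irr M}
    (z : RComp C D M c h d g ⊗[ℂ] LComp C D M d g e f) :
    crossedComp C D c h d g e f (crossedEmb C D c h d g e f z) = z :=
  Pi.single_eq_same (M := fun q : Irr M × Irr M × Irr M × Irr M × Irr M × Irr M =>
    RComp C D M q.1 q.2.1 q.2.2.1 q.2.2.2.1 ⊗[ℂ]
      LComp C D M q.2.2.1 q.2.2.2.1 q.2.2.2.2.1 q.2.2.2.2.2) (c, h, d, g, e, f) z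

lemma crossedComp_emb_of_ne {c h d g e f c' h' d' g' e' f' : Irr M}
    (hq : (c, h, d, g, e, f) ≠ (c', h', d', g', e', f'))
    (z : RComp C D M c' h' d' g' ⊗[ℂ] LComp C D M d' g' e' f') :
    crossedComp C D c h d g e f (crossedEmb C D c' h' d' g' e' f' z) = 0 :=
  Pi.single_eq_of_ne (M := fun q : Irr M × Irr M × Irr M × Irr M × Irr M × Irr M =>
    RComp C D M q.1 q.2.1 q.2.2.1 q.2.2.2.1 ⊗[ℂ]
      LComp C D M q.2.2.1 q.2.2.2.1 q.2.2.2.2.1 q.2.2.2.2.2) hq z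

lemma sum_crossedComp_emb {V : Type*} [AddCommMonoid V]
    (F : ∀ c h d g e f : Irr M, RComp C D M c h d g ⊗[ℂ] LComp C D M d g e f → V)
    (hF : ∀ c h d g e f, F c h d g e f 0 = 0) {c h d g e f : Irr M}
    (z : RComp C D M c h d g ⊗[ℂ] LComp C D M d g e f) :
    ∑ c', ∑ h', ∑ d', ∑ g', ∑ e', ∑ f', F c' h' d' g' e' f'
      (crossedComp C D c' h' d' g' e' f' (crossedEmb C D c h d g e f z)) = F c h d g e f z := by
  have H := Finset.sum_eq_single_of_mem
    (s := (Finset.univ : Finset (Irr M × Irr M × Irr M × Irr M × Irr M × Irr M)))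
    (f := fun q => F q.1 q.2.1 q.2.2.1 q.2.2.2.1 q.2.2.2.2.1 q.2.2.2.2.2
      (crossedComp C D q.1 q.2.1 q.2.2.1 q.2.2.2.1 q.2.2.2.2.1 q.2.2.2.2.2
        (crossedEmb C D c h d g e f z))) (c, h, d, g, e, f) (Finset.mem_univ _)
    (fun q _ hq => by rw [crossedComp_emb_of_ne hq, hF])
  simp only [Fintype.sum_prod_type, crossedComp_emb_self] at H
  exact H

lemma sum_crossedEmb_comp (x : Crossed C D M) :
    ∑ c, ∑ h, ∑ d, ∑ g, ∑ e, ∑ f,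
      crossedEmb C D c h d g e f (crossedComp C D c h d g e f x) = x := by
  have h := Finset.univ_sum_single
    (M := fun q : Irr M × Irr M × Irr M × Irr M × Irr M × Irr M =>
    RComp C D M q.1 q.2.1 q.2.2.1 q.2.2.2.1 ⊗[ℂ]
      LComp C D M q.2.2.1 q.2.2.2.1 q.2.2.2.2.1 q.2.2.2.2.2) x
  simp only [Fintype.sum_prod_type] at h
  exact h

/-- The crossed product is spanned by the pairs of diagrams with matching edges. -/
lemma crossed_induction {P : Crossed C D M → Prop} (zero : P 0)
    (add : ∀ x y, P x → P y → P (x + y))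
    (tmul : ∀ (c h d g e f : Irr M) (r : RComp C D M c h d g) (l : LComp C D M d g e f),
      P (crossedEmb C D c h d g e f (r ⊗ₜ l)))
    (x : Crossed C D M) : P x := by
  rw [← sum_crossedEmb_comp x]
  refine Finset.sum_induction _ _ add zero fun c _ => Finset.sum_induction _ _ add zero fun h _ =>
    Finset.sum_induction _ _ add zero fun d _ => Finset.sum_induction _ _ add zero fun g _ =>
    Finset.sum_induction _ _ add zero fun e _ => Finset.sum_induction _ _ add zero fun f _ => ?_
  generalize crossedComp C D c h d g e f x = z
  induction z using TensorProduct.induction_on with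
  | zero => simpa using zero
  | add y z hy hz => rw [map_add]; exact add _ _ hy hz
  | tmul r l => exact tmul _ _ _ _ _ _ r l

lemma cross_apply (r : RTube C D M) (l : LTube C D M) :
    cross C D r l = ∑ c, ∑ h, ∑ d, ∑ g, ∑ e, ∑ f,
      crossedEmb C D c h d g e f (comp _ _ c h d g r ⊗ₜ comp _ _ d g e f l) := by
  simp only [cross, LinearMap.sum_apply]
  rfl

lemma cross_emb_left {c h d g : Irr M} (r : RComp C D M c h d g) (l : LTube C D M) :
    cross C D (emb _ _ c h d g r) l =
      ∑ e, ∑ f, crossedEmb C D c h d g e f (r ⊗ₜ comp _ _ d g e f l) := by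
  rw [cross_apply]
  exact sum_comp_emb (fun c h d g r =>
    ∑ e, ∑ f, crossedEmb C D c h d g e f (r ⊗ₜ comp _ _ d g e f l))
    (fun c h d g => by simp) r

lemma cross_emb {c h d g e f : Irr M} (r : RComp C D M c h d g) (l : LComp C D M d g e f) :
    cross C D (emb _ _ c h d g r) (emb _ _ d g e f l) = crossedEmb C D c h d g e f (r ⊗ₜ l) := by
  rw [cross_emb_left, Finset.sum_eq_single e, Finset.sum_eq_single f, comp_emb_self]
  any_goals simp
  · intro f' hf
    rw [comp_emb_of_ne (by simp [hf]), tmul_zero, map_zero]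
  · intro e' he
    refine Finset.sum_eq_zero fun f' _ => ?_
    rw [comp_emb_of_ne (by simp [he]), tmul_zero, map_zero]

lemma cross_emb_of_ne {c h d g d' g' e f : Irr M} (hdg : (d, g) ≠ (d', g'))
    (r : RComp C D M c h d g) (l : LComp C D M d' g' e f) :
    cross C D (emb _ _ c h d g r) (emb _ _ d' g' e f l) = 0 := by
  rw [cross_emb_left]
  refine Finset.sum_eq_zero fun e' _ => Finset.sum_eq_zero fun f' _ => ?_
  rw [comp_emb_of_ne (fun H => hdg (by simp_all)), tmul_zero, map_zero]

variable [LinearLeftAction C M] [LinearRightAction D M]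

lemma gluing_emb {c h d g e f : Irr M} (z : RComp C D M c h d g ⊗[ℂ] LComp C D M d g e f) :
    gluing C D (crossedEmb C D c h d g e f z) =
      ∑ t : unitLabels C × (allLabels D) × Irr M × Irr M,
      ∑ t' : (allLabels C) × unitLabels D × Irr M × Irr M,
        emb (allLabels C) (allLabels D) c h e f (cellEmb (allLabels C) (allLabels D) c h e f
          (t'.1, t.2.1, d, g) (TensorProduct.tensorTensorTensorComm ℂ _ _ _ _
            (TensorProduct.map (stripR c h d g t) (stripL d g e f t') z))) := by
  simp only [gluing, LinearMap.sum_apply]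
  exact sum_crossedComp_emb (fun c h d g e f z =>
    ∑ t : unitLabels C × (allLabels D) × Irr M × Irr M,
      ∑ t' : (allLabels C) × unitLabels D × Irr M × Irr M,
        emb (allLabels C) (allLabels D) c h e f (cellEmb (allLabels C) (allLabels D) c h e f
          (t'.1, t.2.1, d, g) (TensorProduct.tensorTensorTensorComm ℂ _ _ _ _
            (TensorProduct.map (stripR c h d g t) (stripL d g e f t') z))))
    (fun c h d g e f => by simp) z

lemma exists_inclTube_emb {A : Finset (Irr C)} {B : Finset (Irr D)} {c h e f : Irr M}
    (x : TubeComp M A B c h e f) :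
    ∃ y, inclTube A B (emb A B c h e f x) = emb (allLabels C) (allLabels D) c h e f y :=
  ⟨_, (inclTube_emb x).trans (map_sum _ _ _).symm⟩

variable [BimoduleCategory C D M]

lemma tubeMul_inclTube_emb_of_ne {c h d g d' g' e f : Irr M} (hdg : (d, g) ≠ (d', g'))
    {A A' : Finset (Irr C)} {B B' : Finset (Irr D)} (x : TubeComp M A B c h d g)
    (y : TubeComp M A' B' d' g' e f) :
    tubeMul (allLabels C) (allLabels D) (inclTube A B (emb A B c h d g x))
      (inclTube A' B' (emb A' B' d' g' e f y)) = 0 := by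
  obtain ⟨x', hx⟩ := exists_inclTube_emb x
  obtain ⟨y', hy⟩ := exists_inclTube_emb y
  rw [hx, hy, tubeMul_emb_of_ne hdg]

lemma tubeMul_inclTube_genR_genL (a : C) (b : D) {c h d g e f : Irr M}
    (x : HalfR b c.rep d.rep g.rep h.rep) (y : HalfL a d.rep e.rep f.rep g.rep) :
    tubeMul (allLabels C) (allLabels D)
      (inclTube _ _ (emb _ _ c h d g (genR C b c h d g x)))
      (inclTube _ _ (emb _ _ d g e f (genL D a d g e f y))) =
      gen _ _ a b c h e f (assemble a b _ _ _ _ _ _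
        (TensorProduct.tensorTensorTensorComm ℂ _ _ _ _ (x ⊗ₜ y))) := by
  rw [inclTube_genR, inclTube_genL, tubeMul_gen_all, gen_stack_padR_padL]

lemma tubeMul_inclTube_genL_genR (a : C) (b : D) {d g m n e f : Irr M}
    (y : HalfL a d.rep m.rep n.rep g.rep) (x : HalfR b m.rep e.rep f.rep n.rep) :
    tubeMul (allLabels C) (allLabels D)
      (inclTube _ _ (emb _ _ d g m n (genL D a d g m n y)))
      (inclTube _ _ (emb _ _ m n e f (genR C b m n e f x))) =
      gen _ _ a b d g e f (slide a b _ _ _ _ _ _ y x) := by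
  rw [inclTube_genR, inclTube_genL, tubeMul_gen_all, gen_stack_padL_padR]

/-- Writing `r` and `l` as sums of diagrams with unit arcs turns each product into a stack that
evaluates to the corresponding glued diagram. -/
lemma gluing_emb_tmul {c h d g e f : Irr M} (r : RComp C D M c h d g) (l : LComp C D M d g e f) :
    gluing C D (crossedEmb C D c h d g e f (r ⊗ₜ l)) =
      tubeMul (allLabels C) (allLabels D) (inclTube _ _ (emb _ _ c h d g r))
        (inclTube _ _ (emb _ _ d g e f l)) := by
  conv_rhs => rw [← sum_genR r, ← sum_genL l]
  simp only [map_sum, LinearMap.sum_apply, tubeMul_inclTube_genR_genL]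
  rw [gluing_emb, Finset.sum_comm]
  refine Finset.sum_congr rfl fun t' _ => Finset.sum_congr rfl fun t _ => ?_
  exact emb_cellEmb (A := allLabels C) (B := allLabels D) (t'.1, t.2.1, d, g) _

/-- Gluing `r ⋈ l` is the product of `r` and `l` in the tube algebra. -/
theorem gluing_cross (r : RTube C D M) (l : LTube C D M) :
    gluing C D (cross C D r l) = tubeMul (allLabels C) (allLabels D)
      (inclTube _ _ r) (inclTube _ _ l) := by
  have H (c h d g d' g' e f : Irr M) (x : RComp C D M c h d g) (y : LComp C D M d' g' e f) :
      gluing C D (cross C D (emb _ _ c h d g x) (emb _ _ d' g' e f y)) =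
        tubeMul (allLabels C) (allLabels D) (inclTube _ _ (emb _ _ c h d g x))
          (inclTube _ _ (emb _ _ d' g' e f y)) := by
    by_cases hdg : (d, g) = (d', g')
    · simp only [Prod.mk.injEq] at hdg
      obtain ⟨rfl, rfl⟩ := hdg
      rw [cross_emb, gluing_emb_tmul]
    · rw [cross_emb_of_ne hdg, tubeMul_inclTube_emb_of_ne hdg, map_zero]
  rw [← sum_emb_comp r, ← sum_emb_comp l]
  simp only [map_sum, LinearMap.sum_apply, H]

variable (C D M) in
/-- The inverse of the gluing map: cut a basic tube diagram between the two arcs. -/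
def cutting : Tube C D M →ₗ[ℂ] Crossed C D M :=
  ∑ c : Irr M, ∑ h : Irr M, ∑ e : Irr M, ∑ f : Irr M,
  ∑ t : (allLabels C) × (allLabels D) × Irr M × Irr M,
    crossedEmb C D c h t.2.2.1 t.2.2.2 e f ∘ₗ
    TensorProduct.map (genR C t.2.1.1.rep c h t.2.2.1 t.2.2.2)
      (genL D t.1.1.rep t.2.2.1 t.2.2.2 e f) ∘ₗ
    (TensorProduct.tensorTensorTensorComm ℂ _ _ _ _).toLinearMap ∘ₗ
    coeff _ _ c h e f t ∘ₗ comp _ _ c h e f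

lemma cutting_emb {c h e f : Irr M} (x : TubeComp M (allLabels C) (allLabels D) c h e f) :
    cutting C D M (emb _ _ c h e f x) =
      ∑ t : (allLabels C) × (allLabels D) × Irr M × Irr M,
        crossedEmb C D c h t.2.2.1 t.2.2.2 e f
          (TensorProduct.map (genR C t.2.1.1.rep c h t.2.2.1 t.2.2.2)
            (genL D t.1.1.rep t.2.2.1 t.2.2.2 e f)
            (TensorProduct.tensorTensorTensorComm ℂ _ _ _ _ (coeff _ _ c h e f t x))) := by
  simp only [cutting, LinearMap.sum_apply]
  exact sum_comp_emb (fun c h e f x => ∑ t : (allLabels C) × (allLabels D) × Irr M × Irr M,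
        crossedEmb C D c h t.2.2.1 t.2.2.2 e f
          (TensorProduct.map (genR C t.2.1.1.rep c h t.2.2.1 t.2.2.2)
            (genL D t.1.1.rep t.2.2.1 t.2.2.2 e f)
            (TensorProduct.tensorTensorTensorComm ℂ _ _ _ _ (coeff _ _ c h e f t x))))
    (fun c h e f => by simp) x

lemma cutting_emb_cellEmb {c h e f : Irr M} (t : (allLabels C) × (allLabels D) × Irr M × Irr M)
    (z : Cell t.1.1.rep t.2.1.1.rep c.rep t.2.2.1.rep e.rep f.rep t.2.2.2.rep h.rep) :
    cutting C D M (emb _ _ c h e f (cellEmb _ _ c h e f t z)) =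
      crossedEmb C D c h t.2.2.1 t.2.2.2 e f
        (TensorProduct.map (genR C t.2.1.1.rep c h t.2.2.1 t.2.2.2)
          (genL D t.1.1.rep t.2.2.1 t.2.2.2 e f)
          (TensorProduct.tensorTensorTensorComm ℂ _ _ _ _ z)) := by
  rw [cutting_emb]
  exact sum_coeff_cellEmb (A := allLabels C) (B := allLabels D) (fun t z =>
    crossedEmb C D c h t.2.2.1 t.2.2.2 e f
        (TensorProduct.map (genR C t.2.1.1.rep c h t.2.2.1 t.2.2.2)
          (genL D t.1.1.rep t.2.2.1 t.2.2.2 e f)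
          (TensorProduct.tensorTensorTensorComm ℂ _ _ _ _ z))) (fun t => by simp) t z

lemma gluing_genR_genL (a : C) (b : D) {c h d g e f : Irr M}
    (z : HalfR b c.rep d.rep g.rep h.rep ⊗[ℂ] HalfL a d.rep e.rep f.rep g.rep) :
    gluing C D (crossedEmb C D c h d g e f
      (TensorProduct.map (genR C b c h d g) (genL D a d g e f) z)) =
      gen _ _ a b c h e f (assemble a b _ _ _ _ _ _
        (TensorProduct.tensorTensorTensorComm ℂ _ _ _ _ z)) := by
  induction z using TensorProduct.induction_on with
  | zero => simp
  | add x y hx hy => simp only [map_add, hx, hy]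
  | tmul x y => rw [TensorProduct.map_tmul, gluing_emb_tmul, tubeMul_inclTube_genR_genL]

/-- After gluing and cutting, each factor has had its dotted arc stripped and reinserted, which is
harmless by `sum_genR` and `sum_genL`. -/
lemma cutting_gluing (x : Crossed C D M) : cutting C D M (gluing C D x) = x := by
  induction x using crossed_induction with
  | zero => simp
  | add x y hx hy => simp only [map_add, hx, hy]
  | tmul c h d g e f r l =>
    have H (t : unitLabels C × (allLabels D) × Irr M × Irr M)
        (t' : (allLabels C) × unitLabels D × Irr M × Irr M) :
        cutting C D M (emb _ _ c h e f (cellEmb _ _ c h e f (t'.1, t.2.1, d, g)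
          (TensorProduct.tensorTensorTensorComm ℂ _ _ _ _
            (stripR c h d g t r ⊗ₜ stripL d g e f t' l)))) =
        crossedEmb C D c h d g e f (genR C t.2.1.1.rep c h d g (stripR c h d g t r) ⊗ₜ
          genL D t'.1.1.rep d g e f (stripL d g e f t' l)) := by
      refine (cutting_emb_cellEmb (t'.1, t.2.1, d, g) _).trans ?_
      rw [tensorTensorTensorComm_involutive]
      rfl
    simp only [gluing_emb, map_sum, TensorProduct.map_tmul, H]
    simp only [← map_sum, ← tmul_sum, ← sum_tmul, sum_genR, sum_genL]

lemma gluing_cutting (x : Tube C D M) : gluing C D (cutting C D M x) = x := by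
  have H (c h e f : Irr M) (y : TubeComp M (allLabels C) (allLabels D) c h e f) :
      gluing C D (cutting C D M (emb _ _ c h e f y)) = emb _ _ c h e f y := by
    rw [← sum_cellEmb_coeff y]
    simp only [map_sum]
    refine Finset.sum_congr rfl fun t _ => ?_
    rw [cutting_emb_cellEmb, gluing_genR_genL, emb_cellEmb, tensorTensorTensorComm_involutive]
  rw [← sum_emb_comp x]
  simp only [map_sum, H]

theorem gluing_bijective :
    Function.Bijective (gluing C D : Crossed C D M →ₗ[ℂ] Tube C D M) :=
  Function.bijective_iff_has_inverse.2 ⟨cutting C D M, cutting_gluing, gluing_cutting⟩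

end Gluing

/-! ### The product of the crossed product -/

section CrossedProduct

variable {C D M : Type*} [Category* C] [Abelian C] [Linear ℂ C] [MonoidalCategory C]
  [Category* D] [Abelian D] [Linear ℂ D] [MonoidalCategory D]
  [Category* M] [Abelian M] [Linear ℂ M]
  [MonoidalLeftAction C M] [MonoidalRightAction D M]
  [IsFiniteSemisimple C] [IsFiniteSemisimple D] [IsFiniteSemisimple M]
  [LinearLeftAction C M] [LinearRightAction D M]

lemma split_tmul (a : C) (b : D) {c h e f : Irr M} (u : c.rep ⟶ (a ⊙ₗ e.rep) ⊙ᵣ b)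
    (v : (a ⊙ₗ f.rep) ⊙ᵣ b ⟶ h.rep) :
    split a b c h e f (u ⊗ₜ v) =
      ∑ x : Fin (dec (a ⊙ₗ e.rep)).n, ∑ y : Fin (dec (a ⊙ₗ f.rep)).n,
        Pi.single (M := fun p : Irr M × Irr M =>
          RComp C D M c h p.1 p.2 ⊗[ℂ] LComp C D M p.1 p.2 e f)
          ((dec (a ⊙ₗ e.rep)).s x, (dec (a ⊙ₗ f.rep)).s y)
          (genR C b c h ((dec (a ⊙ₗ e.rep)).s x) ((dec (a ⊙ₗ f.rep)).s y)
              ((u ≫ (dec (a ⊙ₗ e.rep)).proj x ⊵ᵣ b) ⊗ₜ ((dec (a ⊙ₗ f.rep)).incl y ⊵ᵣ b ≫ v)) ⊗ₜ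
            genL D a ((dec (a ⊙ₗ e.rep)).s x) ((dec (a ⊙ₗ f.rep)).s y) e f
              ((dec (a ⊙ₗ e.rep)).incl x ⊗ₜ (dec (a ⊙ₗ f.rep)).proj y)) := by
  simp only [genR, genL, LinearMap.comp_apply, padR_tmul, padL_tmul, Category.assoc,
    ← MonoidalRightAction.comp_actionHomLeft, ← MonoidalRightAction.comp_actionHomLeft_assoc]
  simp only [split, LinearMap.sum_apply]
  rfl

lemma exchange_apply [BimoduleCategory C D M] {d g m n d' g' : Irr M} (l : LComp C D M d g m n)
    (r : RComp C D M m n d' g') :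
    exchange d g m n d' g' l r =
      ∑ t : (allLabels C) × unitLabels D × Irr M × Irr M,
      ∑ t' : unitLabels C × (allLabels D) × Irr M × Irr M,
        split t.1.1.rep t'.2.1.1.rep d g d' g' (slide _ _ _ _ _ _ _ _
          (stripL d g m n t l) (stripR m n d' g' t' r)) := by
  simp only [exchange, LinearMap.sum_apply]
  rfl

lemma sum_gluing_single {c h e f : Irr M} (q : Irr M × Irr M)
    (z : RComp C D M c h q.1 q.2 ⊗[ℂ] LComp C D M q.1 q.2 e f) :
    ∑ p : Irr M × Irr M, gluing C D (crossedEmb C D c h p.1 p.2 e f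
      (Pi.single (M := fun p : Irr M × Irr M =>
          RComp C D M c h p.1 p.2 ⊗[ℂ] LComp C D M p.1 p.2 e f) q z p)) =
      gluing C D (crossedEmb C D c h q.1 q.2 e f z) := by
  rw [Finset.sum_eq_single q, Pi.single_eq_same]
  · intro p _ hp
    rw [Pi.single_eq_of_ne hp, map_zero, map_zero]
  · simp

variable [BimoduleCategory C D M]

/-- The splitting resolves `a ⊙ e` and `a ⊙ f` between the two arcs, so regluing sums to the
identity on both strands. -/
lemma sum_gluing_split (a : C) (b : D) {c h e f : Irr M}
    (w : Diag a b c.rep e.rep f.rep h.rep) :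
    ∑ p : Irr M × Irr M, gluing C D (crossedEmb C D c h p.1 p.2 e f (split a b c h e f w p)) =
      gen _ _ a b c h e f w := by
  induction w using TensorProduct.induction_on with
  | zero => simp
  | add x y hx hy => simp only [map_add, Pi.add_apply, Finset.sum_add_distrib, hx, hy]
  | tmul u v =>
    simp only [split_tmul, Finset.sum_apply, map_sum]
    rw [Finset.sum_comm]
    trans ∑ x : Fin (dec (a ⊙ₗ e.rep)).n, ∑ y : Fin (dec (a ⊙ₗ f.rep)).n,
      gen (allLabels C) (allLabels D) a b c h e f
        ((u ≫ ((dec (a ⊙ₗ e.rep)).proj x ≫ (dec (a ⊙ₗ e.rep)).incl x) ⊵ᵣ b) ⊗ₜ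
          (((dec (a ⊙ₗ f.rep)).proj y ≫ (dec (a ⊙ₗ f.rep)).incl y) ⊵ᵣ b ≫ v))
    · refine Finset.sum_congr rfl fun x _ => ?_
      rw [Finset.sum_comm]
      refine Finset.sum_congr rfl fun y _ => ?_
      rw [sum_gluing_single, gluing_emb_tmul, tubeMul_inclTube_genR_genL,
        TensorProduct.tensorTensorTensorComm_tmul, assemble_tmul]
      simp only [MonoidalRightAction.comp_actionHomLeft, Category.assoc]
    · simp only [← map_sum, ← tmul_sum, ← sum_tmul, ← Preadditive.comp_sum,
        ← Preadditive.sum_comp, ← whisker_sum, SimpleDecomp.sum_proj_incl]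
      simp

/-- Identifies the exchange rule with multiplication in the tube algebra, in the order left arc
outside, right arc inside. -/
lemma sum_gluing_exchange {d g m n d' g' : Irr M} (l : LComp C D M d g m n)
    (r : RComp C D M m n d' g') :
    ∑ p : Irr M × Irr M,
      gluing C D (crossedEmb C D d g p.1 p.2 d' g' (exchange d g m n d' g' l r p)) =
      tubeMul (allLabels C) (allLabels D) (inclTube _ _ (emb _ _ d g m n l))
        (inclTube _ _ (emb _ _ m n d' g' r)) := by
  conv_rhs => rw [← sum_genL l, ← sum_genR r]
  simp only [map_sum, LinearMap.sum_apply, tubeMul_inclTube_genL_genR, exchange_apply,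
    Finset.sum_apply]
  rw [Finset.sum_comm]
  conv_rhs => rw [Finset.sum_comm]
  refine Finset.sum_congr rfl fun t _ => ?_
  rw [Finset.sum_comm]
  refine Finset.sum_congr rfl fun t' _ => ?_
  rw [sum_gluing_split]

/-- For `z = r'' ⊗ l''` this is `(r r'')(l'' l') = r (r'' l'') l'`: it uses that both boundary spans
are subalgebras and that the tube product is associative. -/
lemma gluing_mulComp {c h d g x y d' g' e f : Irr M} (r : RComp C D M c h d g)
    (z : RComp C D M d g x y ⊗[ℂ] LComp C D M x y d' g') (l : LComp C D M d' g' e f) :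
    gluing C D (crossedEmb C D c h x y e f
      (TensorProduct.map
        (TensorProduct.lift (mulComp (unitLabels C) (allLabels D) c h d g x y))
        (TensorProduct.lift (mulComp (allLabels C) (unitLabels D) x y d' g' e f))
        ((TensorProduct.assoc ℂ _ _ _).symm (r ⊗ₜ (TensorProduct.assoc ℂ _ _ _ (z ⊗ₜ l)))))) =
      tubeMul (allLabels C) (allLabels D) (inclTube _ _ (emb _ _ c h d g r))
        (tubeMul _ _ (gluing C D (crossedEmb C D d g x y d' g' z))
          (inclTube _ _ (emb _ _ d' g' e f l))) := by
  induction z using TensorProduct.induction_on with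
  | zero => simp
  | add x y hx hy => simp only [map_add, add_tmul, tmul_add, LinearMap.add_apply, hx, hy]
  | tmul r' l' =>
    simp only [TensorProduct.assoc_tmul, TensorProduct.assoc_symm_tmul, TensorProduct.map_tmul,
      TensorProduct.lift.tmul, gluing_emb_tmul, ← tubeMul_emb,
      inclTube_mul (fusionClosed_unitLabels C) (fusionClosed_allLabels D),
      inclTube_mul (fusionClosed_allLabels C) (fusionClosed_unitLabels D), tubeMul_assoc]

lemma crossedMul_apply (s s' : Crossed C D M) :
    crossedMul s s' = ∑ c, ∑ h, ∑ d, ∑ g, ∑ m, ∑ n, ∑ d', ∑ g', ∑ e, ∑ f,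
      crossedMulComp c h d g m n d' g' e f
        (crossedComp C D c h d g m n s ⊗ₜ crossedComp C D m n d' g' e f s') := by
  simp only [crossedMul, LinearMap.sum_apply]
  rfl

lemma crossedMul_emb_left {c h d g m n : Irr M}
    (z : RComp C D M c h d g ⊗[ℂ] LComp C D M d g m n) (s' : Crossed C D M) :
    crossedMul (crossedEmb C D c h d g m n z) s' = ∑ d', ∑ g', ∑ e, ∑ f,
      crossedMulComp c h d g m n d' g' e f (z ⊗ₜ crossedComp C D m n d' g' e f s') := by
  rw [crossedMul_apply]
  exact sum_crossedComp_emb (fun c h d g m n z => ∑ d', ∑ g', ∑ e, ∑ f,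
    crossedMulComp c h d g m n d' g' e f (z ⊗ₜ crossedComp C D m n d' g' e f s'))
    (fun c h d g m n => by simp) z

lemma crossedMul_emb {c h d g m n d' g' e f : Irr M}
    (z : RComp C D M c h d g ⊗[ℂ] LComp C D M d g m n)
    (z' : RComp C D M m n d' g' ⊗[ℂ] LComp C D M d' g' e f) :
    crossedMul (crossedEmb C D c h d g m n z) (crossedEmb C D m n d' g' e f z') =
      crossedMulComp c h d g m n d' g' e f (z ⊗ₜ z') := by
  rw [crossedMul_emb_left]
  have H := Finset.sum_eq_single_of_mem
    (s := (Finset.univ : Finset (Irr M × Irr M × Irr M × Irr M)))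
    (f := fun q => crossedMulComp c h d g m n q.1 q.2.1 q.2.2.1 q.2.2.2
      (z ⊗ₜ crossedComp C D m n q.1 q.2.1 q.2.2.1 q.2.2.2
        (crossedEmb C D m n d' g' e f z'))) (d', g', e, f) (Finset.mem_univ _)
    (fun q _ hq => by
      rw [crossedComp_emb_of_ne (fun H => hq (by simp_all [Prod.ext_iff])), tmul_zero, map_zero])
  simp only [Fintype.sum_prod_type, crossedComp_emb_self] at H
  exact H

lemma crossedMul_emb_of_ne {c h d g m n m' n' d' g' e f : Irr M} (hmn : (m, n) ≠ (m', n'))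
    (z : RComp C D M c h d g ⊗[ℂ] LComp C D M d g m n)
    (z' : RComp C D M m' n' d' g' ⊗[ℂ] LComp C D M d' g' e f) :
    crossedMul (crossedEmb C D c h d g m n z) (crossedEmb C D m' n' d' g' e f z') = 0 := by
  rw [crossedMul_emb_left]
  refine Finset.sum_eq_zero fun d'' _ => Finset.sum_eq_zero fun g'' _ =>
    Finset.sum_eq_zero fun e'' _ => Finset.sum_eq_zero fun f'' _ => ?_
  rw [crossedComp_emb_of_ne (fun H => hmn (by simp_all)), tmul_zero, map_zero]

lemma crossedMulComp_tmul {c h d g m n d' g' e f : Irr M} (r : RComp C D M c h d g)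
    (l : LComp C D M d g m n) (r' : RComp C D M m n d' g') (l' : LComp C D M d' g' e f) :
    crossedMulComp c h d g m n d' g' e f ((r ⊗ₜ l) ⊗ₜ (r' ⊗ₜ l')) =
      ∑ p : Irr M × Irr M, crossedEmb C D c h p.1 p.2 e f
        (TensorProduct.map
          (TensorProduct.lift (mulComp (unitLabels C) (allLabels D) c h d g p.1 p.2))
          (TensorProduct.lift (mulComp (allLabels C) (unitLabels D) p.1 p.2 d' g' e f))
          ((TensorProduct.assoc ℂ _ _ _).symm (r ⊗ₜ (TensorProduct.assoc ℂ _ _ _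
            (exchange d g m n d' g' l r' p ⊗ₜ l'))))) := by
  simp only [crossedMulComp, LinearMap.sum_apply, Fintype.sum_prod_type]
  rfl

theorem gluing_mul (s s' : Crossed C D M) :
    gluing C D (crossedMul s s') =
      tubeMul (allLabels C) (allLabels D) (gluing C D s) (gluing C D s') := by
  induction s using crossed_induction with
  | zero => simp
  | add x y hx hy => simp only [map_add, LinearMap.add_apply, hx, hy]
  | tmul c h d g m n r l =>
  induction s' using crossed_induction with
  | zero => simp
  | add x y hx hy => simp only [map_add, hx, hy]
  | tmul m' n' d' g' e f r' l' =>
  by_cases hmn : (m, n) = (m', n')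
  · simp only [Prod.mk.injEq] at hmn
    obtain ⟨rfl, rfl⟩ := hmn
    rw [crossedMul_emb, crossedMulComp_tmul]
    simp only [map_sum, gluing_mulComp]
    rw [← map_sum, ← LinearMap.sum_apply, ← map_sum, sum_gluing_exchange]
    simp only [gluing_emb_tmul, tubeMul_assoc]
  -- For mismatched edges, reassociation isolates the middle product of `l` and `r'`, which
  -- vanishes.
  · rw [crossedMul_emb_of_ne hmn, map_zero, gluing_emb_tmul, gluing_emb_tmul, tubeMul_assoc,
      ← tubeMul_assoc (inclTube _ _ (emb _ _ d g m n l)), tubeMul_inclTube_emb_of_ne hmn]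
    simp

theorem gluing_one :
    gluing C D (cross C D (tubeOne _ _) (tubeOne _ _) : Crossed C D M) =
      tubeOne (allLabels C) (allLabels D) := by
  rw [gluing_cross, inclTube_one (fusionClosed_unitLabels C) (fusionClosed_allLabels D),
    inclTube_one (fusionClosed_allLabels C) (fusionClosed_unitLabels D), tubeOne_mul]

/-- No computation with the exchange rule is needed: the axioms hold after applying Φ, which is
injective and preserves product and unit. -/
theorem crossedData_isAlgebra : (crossedData C D M).IsAlgebra where
  assoc x y z := gluing_bijective.1 <| by
    simp only [crossedData, gluing_mul, tubeMul_assoc]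
  one_mul x := gluing_bijective.1 <| by
    simp only [crossedData, gluing_mul, gluing_one, tubeOne_mul]
  mul_one x := gluing_bijective.1 <| by
    simp only [crossedData, gluing_mul, gluing_one, tubeMul_one]

end CrossedProduct

/-! ### The coalgebra structure of the crossed product -/

section CrossedCoalgebra

variable {C D M : Type*} [Category* C] [Abelian C] [Linear ℂ C] [MonoidalCategory C]
  [Category* D] [Abelian D] [Linear ℂ D] [MonoidalCategory D]
  [Category* M] [Abelian M] [Linear ℂ M]
  [MonoidalLeftAction C M] [MonoidalRightAction D M]
  [IsFiniteSemisimple C] [IsFiniteSemisimple D] [IsFiniteSemisimple M]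
  [LinearLeftAction C M] [LinearRightAction D M]

lemma crossedComul_emb {c h d g e f : Irr M} (r : RComp C D M c h d g)
    (l : LComp C D M d g e f) :
    crossedComul (crossedEmb C D c h d g e f (r ⊗ₜ l)) =
      TensorProduct.map (TensorProduct.lift (cross C D)) (TensorProduct.lift (cross C D))
        (TensorProduct.tensorTensorTensorComm ℂ _ _ _ _
          (tubeComul _ _ (emb _ _ c h d g r) ⊗ₜ tubeComul _ _ (emb _ _ d g e f l))) := by
  simp only [crossedComul, LinearMap.sum_apply]
  exact sum_crossedComp_emb (fun c h d g e f z =>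
    TensorProduct.map (TensorProduct.lift (cross C D)) (TensorProduct.lift (cross C D))
      (TensorProduct.tensorTensorTensorComm ℂ (RTube C D M) (RTube C D M) (LTube C D M)
        (LTube C D M) (TensorProduct.map (tubeComul (unitLabels C) (allLabels D) ∘ₗ emb _ _ c h d g)
      (tubeComul (allLabels C) (unitLabels D) ∘ₗ emb _ _ d g e f) z)))
    (fun c h d g e f => by simp only [map_zero]) (r ⊗ₜ l)

lemma crossedCounit_emb {c h d g e f : Irr M} (r : RComp C D M c h d g)
    (l : LComp C D M d g e f) :
    crossedCounit (crossedEmb C D c h d g e f (r ⊗ₜ l)) =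
      tubeCounit _ _ (emb _ _ c h d g r) * tubeCounit _ _ (emb _ _ d g e f l) := by
  simp only [crossedCounit, LinearMap.sum_apply]
  exact sum_crossedComp_emb (fun c h d g e f z =>
    LinearMap.mul' ℂ ℂ (TensorProduct.map
      (tubeCounit (unitLabels C) (allLabels D) ∘ₗ emb _ _ c h d g)
      (tubeCounit (allLabels C) (unitLabels D) ∘ₗ emb _ _ d g e f) z))
    (fun c h d g e f => by simp only [map_zero]) (r ⊗ₜ l)

variable [BimoduleCategory C D M]

/-- The coproduct is multiplicative on tube diagrams with matching edges. -/
lemma tubeComul_tubeMul {c h m n e f : Irr M}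
    (x : TubeComp M (allLabels C) (allLabels D) c h m n)
    (y : TubeComp M (allLabels C) (allLabels D) m n e f) :
    tubeComul _ _ (tubeMul _ _ (emb _ _ c h m n x) (emb _ _ m n e f y)) =
      TensorProduct.map₂ (tubeMul (allLabels C) (allLabels D))
        (tubeMul (allLabels C) (allLabels D)) (tubeComul _ _ (emb _ _ c h m n x))
        (tubeComul _ _ (emb _ _ m n e f y)) := by
  rw [emb_eq_sum_gen x, emb_eq_sum_gen y]
  simp only [map_sum, LinearMap.sum_apply]
  refine Finset.sum_congr rfl fun t _ => Finset.sum_congr rfl fun t' _ => ?_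
  generalize toDiag _ _ c h m n t' x = u
  generalize toDiag _ _ m n e f t y = v
  rw [tubeMul_gen_all]
  simp only [tubeComul_gen (labelsIn_univ _) (labelsIn_univ _)]
  induction u using TensorProduct.induction_on with
  | zero => simp
  | add u u' hu hu' => simp only [map_add, LinearMap.add_apply, hu, hu']
  | tmul u₁ u₂ =>
  induction v using TensorProduct.induction_on with
  | zero => simp
  | add v v' hv hv' => simp only [map_add, hv, hv']
  | tmul v₁ v₂ => exact (diagComul_stack u₁ u₂ v₁ v₂).symm

lemma map_gluing_cross (s : RTube C D M ⊗[ℂ] RTube C D M) (s' : LTube C D M ⊗[ℂ] LTube C D M) :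
    TensorProduct.map (gluing C D) (gluing C D)
      (TensorProduct.map (TensorProduct.lift (cross C D)) (TensorProduct.lift (cross C D))
        (TensorProduct.tensorTensorTensorComm ℂ _ _ _ _ (s ⊗ₜ s'))) =
      TensorProduct.map₂ (tubeMul (allLabels C) (allLabels D))
        (tubeMul (allLabels C) (allLabels D))
        (TensorProduct.map (inclTube _ _) (inclTube _ _) s)
        (TensorProduct.map (inclTube _ _) (inclTube _ _) s') := by
  induction s using TensorProduct.induction_on with
  | zero => simp
  | add x y hx hy => simp only [map_add, add_tmul, LinearMap.add_apply, hx, hy]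
  | tmul r₁ r₂ =>
  induction s' using TensorProduct.induction_on with
  | zero => simp
  | add x y hx hy => simp only [map_add, tmul_add, hx, hy]
  | tmul l₁ l₂ =>
    simp only [TensorProduct.tensorTensorTensorComm_tmul, TensorProduct.map_tmul,
      TensorProduct.lift.tmul, gluing_cross, TensorProduct.map₂_apply_tmul]

/-- Under Φ ⊗ Φ the factorwise coproduct becomes the product of the images of Δ(r) and Δ(l), which
is Δ(r · l) because the edges between `r` and `l` match. -/
theorem gluing_comul (s : Crossed C D M) :
    TensorProduct.map (gluing C D) (gluing C D) (crossedComul s) =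
      tubeComul (allLabels C) (allLabels D) (gluing C D s) := by
  induction s using crossed_induction with
  | zero => simp
  | add x y hx hy => simp only [map_add, hx, hy]
  | tmul c h d g e f r l =>
    rw [crossedComul_emb, map_gluing_cross, map_inclTube_tubeComul, map_inclTube_tubeComul,
      gluing_emb_tmul]
    obtain ⟨r', hr⟩ := exists_inclTube_emb r
    obtain ⟨l', hl⟩ := exists_inclTube_emb l
    rw [hr, hl, tubeComul_tubeMul]

/-- The unitors that insert the unit arcs cancel when a factor is closed, leaving the scalars of `μ
≫ γ` and `ν ≫ ζ`. When some pair of edges differs, both sides vanish. -/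
lemma tubeCounit_gen_assemble (a : C) (b : D) {c h d g e f : Irr M}
    (x : HalfR b c.rep d.rep g.rep h.rep) (y : HalfL a d.rep e.rep f.rep g.rep) :
    tubeCounit (allLabels C) (allLabels D) (gen _ _ a b c h e f (assemble a b _ _ _ _ _ _
      (TensorProduct.tensorTensorTensorComm ℂ _ _ _ _ (x ⊗ₜ y)))) =
      tubeCounit _ _ (emb _ _ c h d g (genR C b c h d g x)) *
        tubeCounit _ _ (emb _ _ d g e f (genL D a d g e f y)) := by
  induction x using TensorProduct.induction_on with
  | zero => simp
  | add x x' hx hx' => simp only [map_add, add_tmul, add_mul, hx, hx']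
  | tmul μ γ =>
  induction y using TensorProduct.induction_on with
  | zero => simp
  | add y y' hy hy' => simp only [map_add, tmul_add, mul_add, hy, hy']
  | tmul ν ζ =>
  rw [TensorProduct.tensorTensorTensorComm_tmul, assemble_tmul]
  change _ = tubeCounit _ _ (gen _ _ (𝟙_ C) b c h d g _) *
    tubeCounit _ _ (gen _ _ a (𝟙_ D) d g e f _)
  by_cases hce : (c, e) = (h, f)
  · simp only [Prod.mk.injEq] at hce
    obtain ⟨rfl, rfl⟩ := hce
    rw [tubeCounit_gen (labelsIn_univ _) (labelsIn_univ _), diagCounit_tmul]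
    by_cases hdg : d = g
    · subst hdg
      rw [tubeCounit_gen labelsIn_unit (labelsIn_univ _),
        tubeCounit_gen (labelsIn_univ _) labelsIn_unit, padR_tmul, padL_tmul,
        diagCounit_tmul, diagCounit_tmul, endScalar_comp_comp_self]
      simp [← MonoidalRightAction.comp_actionHomLeft_assoc]
    · rw [endScalar_comp_comp _ _ _ _ hdg, tubeCounit_gen_of_ne (by simp [hdg]), zero_mul]
  · rw [tubeCounit_gen_of_ne hce]
    -- If the outer edges of `r` agree, the mismatch must lie in the inner edges `e`, `f`, so it is
    -- the counit of `l` that vanishes.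
    by_cases hch : c = h
    · rw [tubeCounit_gen_of_ne (c := d) (h := g) (fun H => hce (by simp_all)), mul_zero]
    · rw [tubeCounit_gen_of_ne (c := c) (h := h) (by simp [hch]), zero_mul]

theorem gluing_counit (s : Crossed C D M) :
    tubeCounit (allLabels C) (allLabels D) (gluing C D s) = crossedCounit s := by
  induction s using crossed_induction with
  | zero => simp
  | add x y hx hy => simp only [map_add, hx, hy]
  | tmul c h d g e f r l =>
    rw [crossedCounit_emb, gluing_emb_tmul]
    conv_rhs => rw [← sum_genR r, ← sum_genL l]
    conv_lhs => rw [← sum_genR r, ← sum_genL l]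
    simp only [map_sum, LinearMap.sum_apply, tubeMul_inclTube_genR_genL, tubeCounit_gen_assemble,
      Finset.sum_mul_sum]
    rw [Finset.sum_comm]

/-- The gluing map preserves product, unit, coproduct and counit. -/
theorem gluing_isHom : (crossedData C D M).IsHom (tubeData (allLabels C) (allLabels D))
    (gluing C D) where
  map_mul := gluing_mul
  map_one := gluing_one
  map_comul := gluing_comul
  map_counit := gluing_counit

end CrossedCoalgebra

end

end DomainWall

/-! ### The proposition -/

theorem mainTheorem9
    {C : Type*} [Category* C] [Abelian C] [Linear ℂ C] [MonoidalCategory C]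
    [MonoidalPreadditive C] [MonoidalLinear ℂ C] [RigidCategory C]
    [DomainWall.IsFiniteSemisimple C]
    {D : Type*} [Category* D] [Abelian D] [Linear ℂ D] [MonoidalCategory D]
    [MonoidalPreadditive D] [MonoidalLinear ℂ D] [RigidCategory D]
    [DomainWall.IsFiniteSemisimple D]
    {M : Type*} [Category* M] [Abelian M] [Linear ℂ M] [DomainWall.IsFiniteSemisimple M]
    [MonoidalLeftAction C M] [MonoidalRightAction D M]
    [DomainWall.LinearLeftAction C M] [DomainWall.LinearRightAction D M]
    [DomainWall.BimoduleCategory C D M] :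
    -- `R(M_D)` and `L(_C M)` are subalgebras, closed under the coproduct, of `Tube(_C M_D)`
    (DomainWall.tubeData (M := M) (DomainWall.unitLabels C) (DomainWall.allLabels D)).IsSub
      (DomainWall.tubeData (DomainWall.allLabels C) (DomainWall.allLabels D))
      (DomainWall.inclTube (DomainWall.unitLabels C) (DomainWall.allLabels D)) ∧
    (DomainWall.tubeData (M := M) (DomainWall.allLabels C) (DomainWall.unitLabels D)).IsSub
      (DomainWall.tubeData (DomainWall.allLabels C) (DomainWall.allLabels D))
      (DomainWall.inclTube (DomainWall.allLabels C) (DomainWall.unitLabels D)) ∧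
    -- the crossed product is an associative unital algebra
    (DomainWall.crossedData C D M).IsAlgebra ∧
    -- the gluing map is an isomorphism of algebras and of coalgebras
    Function.Bijective (DomainWall.gluing C D : DomainWall.Crossed C D M →ₗ[ℂ] _) ∧
    (DomainWall.crossedData C D M).IsHom
      (DomainWall.tubeData (DomainWall.allLabels C) (DomainWall.allLabels D))
      (DomainWall.gluing C D) ∧
    -- gluing `r ⋈ l` is the product of `r` and `l` in the tube algebra
    (∀ (r : DomainWall.RTube C D M) (l : DomainWall.LTube C D M),
      DomainWall.gluing C D (DomainWall.cross C D r l) =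
        (DomainWall.tubeData (DomainWall.allLabels C) (DomainWall.allLabels D)).mul
          (DomainWall.inclTube (DomainWall.unitLabels C) (DomainWall.allLabels D) r)
          (DomainWall.inclTube (DomainWall.allLabels C) (DomainWall.unitLabels D) l)) := by
  exact ⟨DomainWall.inclTube_isSub (DomainWall.fusionClosed_unitLabels C)
      (DomainWall.fusionClosed_allLabels D),
    DomainWall.inclTube_isSub (DomainWall.fusionClosed_allLabels C)
      (DomainWall.fusionClosed_unitLabels D),
    DomainWall.crossedData_isAlgebra, DomainWall.gluing_bijective, DomainWall.gluing_isHom,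
    DomainWall.gluing_cross⟩
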